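/- Let $V(x,t)$ be a real potential, smooth in $(x,t)\in\mathbb R^2$ and $L$-periodic in $x$. Fix a midpoint $t_{1/2}$ of the time step, put $W(\zeta)=V(\cdot,t_{1/2}+\zeta)$, and let $W^e,W^o$ be the even and odd parts of $W$ in $\zeta$. For $\star\in\{e,o,\text{blank}\}$ put $$\mu^{\star}_{j,k}=\int_0^h \big(h^jB_j(\zeta/h)\big)^k\,W^\star(\zeta-\tfrac h2)\,d\zeta,\qquad \Lambda[f]^{\star}_{a,b}=\int_0^h\!\!\int_0^\zeta f(h,\zeta,\xi)\big[\partial_x^aW(\zeta-\tfrac h2)\,\partial_x^bW(\xi-\tfrac h2)\big]^\star d\xi\,d\zeta,$$ where $B_j$ are the Bernoulli polynomials and $[\,\cdot\,]^{e},[\,\cdot\,]^{o}$ are the even and odd parts under simultaneous reflection of the two time arguments of $W$. Let $\psi=\zeta-\xi-\frac h3$, $\varphi_1=h^2-4h\xi+2\zeta\xi$, $\varphi_2=(h-2\zeta)^2-2\zeta\xi$, $\phi_1=h^2-6h\zeta+6h\xi+6\zeta\xi+3\zeta^2-12\xi^2$, $\phi_2=h^2-6h\zeta+6h\xi-6\zeta\xi+5\zeta^2$,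 and $\langle f\rangle_k=\frac12(f\circ\partial_x^k+\partial_x^k\circ f)$. Let $$\begin{aligned}\Theta_4={}&ih\varepsilon\partial_x^2-i\varepsilon^{-1}\mu_{0,0}-2\langle\partial_x\mu_{1,1}\rangle_1+i\varepsilon^{-1}\Lambda[\psi]_{1,1}+2i\varepsilon\langle\partial_x^2\mu_{2,1}\rangle_2+\tfrac16\langle\Lambda[\varphi_1]_{1,2}+\Lambda[\varphi_2]_{2,1}\rangle_1\\&+\tfrac16\langle\Lambda[\phi_1]_{1,2}+\Lambda[\phi_2]_{2,1}\rangle_1+\tfrac43\varepsilon^2\langle\partial_x^3\mu_{3,1}\rangle_3+\tfrac14i\varepsilon\,\partial_x^4\mu_{2,1},\\ \Theta_4^o={}&ih\varepsilon\partial_x^2-i\varepsilon^{-1}\mu^e_{0,0}-2\langle\partial_x\mu^o_{1,1}\rangle_1+i\varepsilon^{-1}\Lambda[\psi]^e_{1,1}+2i\varepsilon\langle\partial_x^2\mu^e_{2,1}\rangle_2\\&+\tfrac16\langle\Lambda[\varphi_1+\phi_1]^o_{1,2}+\Lambda[\varphi_2+\phi_2]^o_{2,1}\rangle_1+\tfrac43\varepsilon^2\langle\partial_x^3\mu^o_{3,1}\rangle_3+\tfrac14i\varepsilon\,\partial_x^4\mu^e_{2,1},\end{aligned}$$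 and let $$\begin{aligned}W^{[0]}={}&ih\varepsilon\partial_x^2,\qquad W^{[1]}=-i\varepsilon^{-1}\mu^e_{0,0},\\ W^{[2]}={}&\tfrac16ih\varepsilon^{-1}(\partial_x\mu^e_{0,0})^2-2\langle\partial_x\mu^o_{1,1}\rangle_1+\tfrac16ih^2\varepsilon\langle\partial_x^2\mu^e_{0,0}\rangle_2,\\ \mathcal W^{[3]}={}&i\varepsilon^{-1}\Lambda[\psi]^e_{1,1}-\tfrac1{24}ih^2\varepsilon\,\partial_x^4\mu^e_{0,0}-\tfrac16i\varepsilon^{-1}(\partial_x\mu^e_{0,0})^2\,\partial_x^2\mu^e_{1,2}-\tfrac2{45}ih^2\varepsilon^{-1}(\partial_x\mu^e_{0,0})^2\,\partial_x^2\mu^e_{0,0}\\ &+\tfrac16\langle\Lambda[\varphi_1+\phi_1]^o_{1,2}+\Lambda[\varphi_2+\phi_2]^o_{2,1}\rangle_1+h\langle(\partial_x\mu^e_{0,0})(\partial_x^2\mu^o_{1,1})-\tfrac13(\partial_x^2\mu^e_{0,0})(\partial_x\mu^o_{1,1})\rangle_1\\ &+\tfrac1{30}ih^3\varepsilon\langle(\partial_x^2\mu^e_{0,0})^2-2(\partial_x\mu^e_{0,0})(\partial_x^3\mu^e_{0,0})\rangle_2+2i\varepsilon\langle\partial_x^2\mu^e_{2,1}\rangle_2+\tfrac43\varepsilon^2\langle\partial_x^3\mu^o_{3,1}\rangle_3\\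 &+\tfrac13h^2\varepsilon^2\langle\partial_x^3\mu^o_{1,1}\rangle_3-\tfrac1{120}ih^4\varepsilon^3\langle\partial_x^4\mu^e_{0,0}\rangle_4.\end{aligned}$$ Sizes are understood semiclassically. A family $u_\varepsilon$ of smooth $L$-periodic functions is called semiclassical if $\|\partial_x^ku_\varepsilon\|_{L^2}=O(\varepsilon^{-k})$ as $\varepsilon\to0^+$ for every $k$, and operators $A_\varepsilon$ are $O(\varepsilon^p)$ if $\|A_\varepsilon u_\varepsilon\|_{L^2}=O(\varepsilon^p)$ for every semiclassical family. Exponentials are understood as formal power series in $h$: each exponent is replaced, for fixed $\varepsilon$ and $t_{1/2}$, by its Taylor series in $h$ at $0$, which has no constant term and whose coefficients are linear operators on smooth periodic functions, and $\exp$ is the exponential series. Then: 1. $\Theta_4^o$ is odd in $h$. 2. For every $\sigma\in(0,1]$, all time steps $h=h(\varepsilon)>0$ with $h=O(\varepsilon^\sigma)$, and all bounded midpoints $t_{1/2}=t_{1/2}(\varepsilon)$: $\Theta_4=\Theta_4^o+O(\varepsilon^{7\sigma-1})$, $W^{[0]}=O(\varepsilon^{\sigma-1})$, $W^{[1]}=O(\varepsilon^{\sigma-1})$,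 $W^{[2]}=O(\varepsilon^{3\sigma-1})$ and $\mathcal W^{[3]}=O(\varepsilon^{5\sigma-1})$. 3. There is a formal series $r=\sum_{n\ge1}h^nr_n$, whose coefficients $r_n$ are linear operators depending on $\varepsilon$ and $t_{1/2}$, such that for all $\varepsilon>0$ and all $t_{1/2}$ $$\exp(\Theta_4+r)=e^{\frac12W^{[0]}}e^{\frac12W^{[1]}}e^{\frac12W^{[2]}}e^{\mathcal W^{[3]}}e^{\frac12W^{[2]}}e^{\frac12W^{[1]}}e^{\frac12W^{[0]}},$$ and $r=O(\varepsilon^{7\sigma-1})$: for all $\sigma$, $h(\varepsilon)$ and $t_{1/2}(\varepsilon)$ as in 2, every term $h^nr_n$ is $O(\varepsilon^{7\sigma-1})$. -/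

import Mathlib

open Filter Topology Asymptotics
open scoped ContDiff

noncomputable section

namespace MagnusZassenhaus

/-! ### Function space, semiclassical families and size -/

/-- The space of smooth `L`-periodic complex-valued functions on the line. -/
def PerSmooth (L : ℝ) : Submodule ℂ (ℝ → ℂ) where
  carrier := {u | ContDiff ℝ ∞ u ∧ Function.Periodic u L}
  add_mem' := fun hu hv => ⟨hu.1.add hv.1, hu.2.add hv.2⟩
  zero_mem' := ⟨contDiff_const, fun _ => rfl⟩
  smul_mem' := fun c _ hu => ⟨hu.1.const_smul c, fun x => congrArg (fun z => c • z) (hu.2 x)⟩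

/-- The `L²` norm over one period. -/
def l2norm (L : ℝ) (u : ℝ → ℂ) : ℝ := Real.sqrt (∫ x in (0 : ℝ)..L, ‖u x‖ ^ 2)

/-- A family `u_ε` of smooth periodic functions with semiclassical oscillations:
`‖∂ₓᵏ u_ε‖ = O(ε⁻ᵏ)` as `ε → 0⁺`, for every `k`. -/
def IsSemiclassical {L : ℝ} (u : ℝ → PerSmooth L) : Prop :=
  ∀ k : ℕ, (fun ε => l2norm L (iteratedDeriv k (u ε : ℝ → ℂ))) =O[𝓝[>] (0 : ℝ)]
    fun ε => ε⁻¹ ^ k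

/-- A family of operators `A_ε` has size `O(ε^p)`: for every semiclassical family `u_ε`,
`‖A_ε u_ε‖ = O(ε^p)` as `ε → 0⁺`. -/
def HasSize {L : ℝ} (A : ℝ → PerSmooth L → (ℝ → ℂ)) (p : ℝ) : Prop :=
  ∀ u : ℝ → PerSmooth L, IsSemiclassical u →
    (fun ε => l2norm L (A ε (u ε))) =O[𝓝[>] (0 : ℝ)] fun ε => ε ^ p

/-! ### Formal power series in the time step -/

/-- The family of operators `A_h` has the asymptotic (Taylor) series `∑ₙ hⁿ aₙ` as `h → 0`.
This determines every coefficient `aₙ`. -/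
def HasExpansion {L : ℝ} (A : ℝ → PerSmooth L → (ℝ → ℂ))
    (a : PowerSeries (Module.End ℂ (PerSmooth L))) : Prop :=
  ∀ (u : PerSmooth L) (x : ℝ) (N : ℕ),
    (fun h : ℝ => A h u x -
      ∑ n ∈ Finset.range N, (h : ℂ) ^ n * (PowerSeries.coeff n a u : ℝ → ℂ) x)
      =O[𝓝 (0 : ℝ)] fun h => h ^ N

/-- The exponential `∑ₘ aᵐ / m!` of a formal power series without constant term, over a ring that
need not be commutative (the terms with `m > n` do not contribute to the coefficient of order
`n`). -/
def formalExp {R : Type*} [Ring R] [Algebra ℂ R] (a : PowerSeries R) : PowerSeries R :=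
  PowerSeries.mk fun n =>
    ∑ m ∈ Finset.range (n + 1), ((m.factorial : ℂ)⁻¹) • PowerSeries.coeff n (a ^ m)

/-! ### Differential operators -/

/-- The operator of multiplication by a real function. -/
def mulOp (f : ℝ → ℝ) (u : ℝ → ℂ) : ℝ → ℂ := fun x => (f x : ℂ) * u x

/-- The symmetrised differential operator `⟨f⟩ₖ = ½ (f ∘ ∂ₓᵏ + ∂ₓᵏ ∘ f)`. -/
def ang (f : ℝ → ℝ) (k : ℕ) (u : ℝ → ℂ) : ℝ → ℂ :=
  (1 / 2 : ℂ) • (mulOp f (iteratedDeriv k u) + iteratedDeriv k (mulOp f u))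

/-! ### The potential around the midpoint and its integrals

Potentials are functions `W x ζ` of space and time. -/

/-- `W(ζ) = V(t_{1/2} + ζ)`. -/
def shift (V : ℝ → ℝ → ℝ) (tmid : ℝ) : ℝ → ℝ → ℝ := fun x ζ => V x (tmid + ζ)

/-- Even component in time. -/
def evenPart (W : ℝ → ℝ → ℝ) : ℝ → ℝ → ℝ := fun x ζ => (W x ζ + W x (-ζ)) / 2

/-- Odd component in time. -/
def oddPart (W : ℝ → ℝ → ℝ) : ℝ → ℝ → ℝ := fun x ζ => (W x ζ - W x (-ζ)) / 2

/-- The rescaled Bernoulli polynomial `hʲ Bⱼ(ζ / h)`. -/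
def bern (j : ℕ) (h ζ : ℝ) : ℝ := h ^ j * Polynomial.aeval (ζ / h) (Polynomial.bernoulli j)

/-- The line integral `μ_{j,k}(h)`. -/
def mom (W : ℝ → ℝ → ℝ) (j k : ℕ) (h : ℝ) : ℝ → ℝ := fun x =>
  ∫ ζ in (0 : ℝ)..h, bern j h ζ ^ k * W x (ζ - h / 2)

/-- The product `[∂ₓᵃ W(p)] [∂ₓᵇ W(q)]` as a function of `x, p, q`. -/
def prodKer (W : ℝ → ℝ → ℝ) (a b : ℕ) : ℝ → ℝ → ℝ → ℝ := fun x p q =>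
  iteratedDeriv a (fun y => W y p) x * iteratedDeriv b (fun y => W y q) x

/-- Even component of a kernel, jointly in its two time variables. -/
def evenKer (K : ℝ → ℝ → ℝ → ℝ) : ℝ → ℝ → ℝ → ℝ := fun x p q => (K x p q + K x (-p) (-q)) / 2

/-- Odd component of a kernel, jointly in its two time variables. -/
def oddKer (K : ℝ → ℝ → ℝ → ℝ) : ℝ → ℝ → ℝ → ℝ := fun x p q => (K x p q - K x (-p) (-q)) / 2

/-- Integral over the triangle `0 ≤ ξ ≤ ζ ≤ h` of `f(h,ζ,ξ) K(ζ - h/2, ξ - h/2)`. With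
`K = prodKer W a b` this is `Λ[f]_{a,b}`; with its even (odd) component it is `Λ[f]ᵉ_{a,b}`
(`Λ[f]ᵒ_{a,b}`). -/
def tri (f : ℝ → ℝ → ℝ → ℝ) (K : ℝ → ℝ → ℝ → ℝ) (h : ℝ) : ℝ → ℝ := fun x =>
  ∫ ζ in (0 : ℝ)..h, ∫ ξ in (0 : ℝ)..ζ, f h ζ ξ * K x (ζ - h / 2) (ξ - h / 2)

def psi (h ζ ξ : ℝ) : ℝ := ζ - ξ - h / 3

def varphi₁ (h ζ ξ : ℝ) : ℝ := h ^ 2 - 4 * h * ξ + 2 * ζ * ξ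

def varphi₂ (h ζ ξ : ℝ) : ℝ := (h - 2 * ζ) ^ 2 - 2 * ζ * ξ

def phi₁ (h ζ ξ : ℝ) : ℝ :=
  h ^ 2 - 6 * h * ζ + 6 * h * ξ + 6 * ζ * ξ + 3 * ζ ^ 2 - 12 * ξ ^ 2

def phi₂ (h ζ ξ : ℝ) : ℝ := h ^ 2 - 6 * h * ζ + 6 * h * ξ - 6 * ζ * ξ + 5 * ζ ^ 2

/-! ### The sixth-order Magnus expansion -/

/-- The sixth-order simplified-commutator Magnus expansion `Θ₄(h)`, with the origin of time at the
midpoint of the step. -/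
def Theta4 (W : ℝ → ℝ → ℝ) (h ε : ℝ) (u : ℝ → ℂ) : ℝ → ℂ :=
  (Complex.I * h * ε) • iteratedDeriv 2 u
  - (Complex.I * (ε : ℂ)⁻¹) • mulOp (mom W 0 0 h) u
  - (2 : ℂ) • ang (iteratedDeriv 1 (mom W 1 1 h)) 1 u
  + (Complex.I * (ε : ℂ)⁻¹) • mulOp (tri psi (prodKer W 1 1) h) u
  + (2 * Complex.I * ε) • ang (iteratedDeriv 2 (mom W 2 1 h)) 2 u
  + (1 / 6 : ℂ) • ang (tri varphi₁ (prodKer W 1 2) h + tri varphi₂ (prodKer W 2 1) h) 1 u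
  + (1 / 6 : ℂ) • ang (tri phi₁ (prodKer W 1 2) h + tri phi₂ (prodKer W 2 1) h) 1 u
  + (4 / 3 * (ε : ℂ) ^ 2) • ang (iteratedDeriv 3 (mom W 3 1 h)) 3 u
  + (1 / 4 * Complex.I * ε) • mulOp (iteratedDeriv 4 (mom W 2 1 h)) u

/-- The form of `Θ₄(h)` in which only odd powers of `h` occur. -/
def Theta4Odd (W : ℝ → ℝ → ℝ) (h ε : ℝ) (u : ℝ → ℂ) : ℝ → ℂ :=
  (Complex.I * h * ε) • iteratedDeriv 2 u
  - (Complex.I * (ε : ℂ)⁻¹) • mulOp (mom (evenPart W) 0 0 h) u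
  - (2 : ℂ) • ang (iteratedDeriv 1 (mom (oddPart W) 1 1 h)) 1 u
  + (Complex.I * (ε : ℂ)⁻¹) • mulOp (tri psi (evenKer (prodKer W 1 1)) h) u
  + (2 * Complex.I * ε) • ang (iteratedDeriv 2 (mom (evenPart W) 2 1 h)) 2 u
  + (1 / 6 : ℂ) • ang (tri (varphi₁ + phi₁) (oddKer (prodKer W 1 2)) h
      + tri (varphi₂ + phi₂) (oddKer (prodKer W 2 1)) h) 1 u
  + (4 / 3 * (ε : ℂ) ^ 2) • ang (iteratedDeriv 3 (mom (oddPart W) 3 1 h)) 3 u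
  + (1 / 4 * Complex.I * ε) • mulOp (iteratedDeriv 4 (mom (evenPart W) 2 1 h)) u

/-! ### The exponents of the splitting -/

def W0 (h ε : ℝ) (u : ℝ → ℂ) : ℝ → ℂ := (Complex.I * h * ε) • iteratedDeriv 2 u

def W1 (W : ℝ → ℝ → ℝ) (h ε : ℝ) (u : ℝ → ℂ) : ℝ → ℂ :=
  (-(Complex.I * (ε : ℂ)⁻¹)) • mulOp (mom (evenPart W) 0 0 h) u

def W2 (W : ℝ → ℝ → ℝ) (h ε : ℝ) (u : ℝ → ℂ) : ℝ → ℂ :=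
  (1 / 6 * Complex.I * h * (ε : ℂ)⁻¹) • mulOp (iteratedDeriv 1 (mom (evenPart W) 0 0 h) ^ 2) u
  - (2 : ℂ) • ang (iteratedDeriv 1 (mom (oddPart W) 1 1 h)) 1 u
  + (1 / 6 * Complex.I * (h : ℂ) ^ 2 * ε) • ang (iteratedDeriv 2 (mom (evenPart W) 0 0 h)) 2 u

/-- The central exponent `𝒲^[3]`; here `m k = ∂ₓᵏ μᵉ_{0,0}` and `n k = ∂ₓᵏ μᵒ_{1,1}`. -/
def W3 (W : ℝ → ℝ → ℝ) (h ε : ℝ) (u : ℝ → ℂ) : ℝ → ℂ :=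
  let m : ℕ → ℝ → ℝ := fun k => iteratedDeriv k (mom (evenPart W) 0 0 h)
  let n : ℕ → ℝ → ℝ := fun k => iteratedDeriv k (mom (oddPart W) 1 1 h)
  (Complex.I * (ε : ℂ)⁻¹) • mulOp (tri psi (evenKer (prodKer W 1 1)) h) u
  - (1 / 24 * Complex.I * (h : ℂ) ^ 2 * ε) • mulOp (m 4) u
  - (1 / 6 * Complex.I * (ε : ℂ)⁻¹) •
      mulOp (m 1 ^ 2 * iteratedDeriv 2 (mom (evenPart W) 1 2 h)) u
  - (2 / 45 * Complex.I * (h : ℂ) ^ 2 * (ε : ℂ)⁻¹) • mulOp (m 1 ^ 2 * m 2) u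
  + (1 / 6 : ℂ) • ang (tri (varphi₁ + phi₁) (oddKer (prodKer W 1 2)) h
      + tri (varphi₂ + phi₂) (oddKer (prodKer W 2 1)) h) 1 u
  + (h : ℂ) • ang (m 1 * n 2 - (1 / 3 : ℝ) • (m 2 * n 1)) 1 u
  + (1 / 30 * Complex.I * (h : ℂ) ^ 3 * ε) • ang (m 2 ^ 2 - (2 : ℝ) • (m 1 * m 3)) 2 u
  + (2 * Complex.I * ε) • ang (iteratedDeriv 2 (mom (evenPart W) 2 1 h)) 2 u
  + (4 / 3 * (ε : ℂ) ^ 2) • ang (iteratedDeriv 3 (mom (oddPart W) 3 1 h)) 3 u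
  + (1 / 3 * (h : ℂ) ^ 2 * (ε : ℂ) ^ 2) • ang (n 3) 3 u
  - (1 / 120 * Complex.I * (h : ℂ) ^ 4 * (ε : ℂ) ^ 3) • ang (m 4) 4 u

end MagnusZassenhaus

end

open MagnusZassenhaus

/-! The product on the right is palindromic and all its exponents are odd in `h`, so its logarithm
`Z` is odd in `h` too. All Taylor coefficients lie in `opLie`, the operators `ε⁻¹a` with `a`
generated by `ε`, `ε∂ₓ` and multiplications. This is a Lie algebra: a commutator of two such `a`
gains a factor `ε`, which pays for the second `ε⁻¹`. By the Baker–Campbell–Hausdorff theorem the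
coefficients of `Z` stay in it, so the term of order `n` has size `ε^(nσ-1)`. Orders from seven on
are therefore harmless, even orders vanish below seven, and only the orders one, three and five of
`Z` have to be compared with those of `Θ₄`.

Orders one and three must agree exactly: an error of size `ε` at order three would contribute
`ε^(3σ+1)`, too large when `σ > 1/2`. This is done with exact commutators (`splitting_third_order`).
At order five an error in `opSmall`, of size `ε`, is allowed because `5σ+1 ≥ 7σ-1` for `σ ≤ 1`.
Modulo `opSmall`, commutators are Poisson brackets: the symmetric quantisation has no correction of
relative order one (`lieQuant_lie`). Order five thus becomes a polynomial identity in the momentum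
variable and the derivatives of the Taylor coefficients of the potential (`splitting_fifth_order`).

To reach these identities each exponent is written as the quantisation of a finite symbol `∑ εʲ f
ξᵏ` whose coefficients `f` are smooth in the step, the midpoint and `x`. Hadamard quotients give an
algebra homomorphism `taylor` to formal series, and the line and triangle integrals have Taylor
coefficients given by moments of polynomial weights on the unit square. The even-order moments of
`Θ₄` cancel below order seven, so it has there the same coefficients as its odd form
(`symbolCoeff_symTheta`).

The sizes come from `hasSize_quantAt`: if the coefficient of `εʲ` is divisible by `h^(N-j)`, the
operator is `O(ε^(Nσ-1))`, since `σ ≤ 1` makes a factor `ε` no larger than the bound for a factor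
`h`. The algebra is carried by `exists_symmetric_formalExp`, `symmetric_bch_of_monomial` and
`exists_palindromic_formalExp`, and everything meets in `exists_remainder`. -/

noncomputable section

namespace MagnusZassenhaus

/-! ### Formal power series over a noncommutative ring -/

section FormalSeries

variable {R : Type*} [Ring R]

open PowerSeries Finset.HasAntidiagonal
open Finset hiding mem_antidiagonal antidiagonal

/-- The series `a` is divisible by the `n`-th power of the variable. -/
def OrdGE (n : ℕ) (a : PowerSeries R) : Prop := ∀ i < n, coeff i a = 0

theorem OrdGE.add {n : ℕ} {a b : PowerSeries R} (ha : OrdGE n a) (hb : OrdGE n b) :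
    OrdGE n (a + b) := fun i hi => by rw [map_add, ha i hi, hb i hi, add_zero]

theorem OrdGE.sub {n : ℕ} {a b : PowerSeries R} (ha : OrdGE n a) (hb : OrdGE n b) :
    OrdGE n (a - b) := fun i hi => by rw [map_sub, ha i hi, hb i hi, sub_zero]

theorem OrdGE.mul {n m : ℕ} {a b : PowerSeries R} (ha : OrdGE n a) (hb : OrdGE m b) :
    OrdGE (n + m) (a * b) := fun i hi => by
  rw [coeff_mul]
  refine sum_eq_zero fun p hp => ?_
  rw [mem_antidiagonal] at hp
  by_cases h : p.1 < n
  · rw [ha _ h, zero_mul]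
  · rw [hb p.2 (by omega), mul_zero]

theorem ordGE_zero_left (a : PowerSeries R) : OrdGE 0 a := fun _ h => absurd h (Nat.not_lt_zero _)

theorem ordGE_zero (n : ℕ) : OrdGE n (0 : PowerSeries R) := fun _ _ => map_zero _

theorem OrdGE.pow {a : PowerSeries R} (ha : OrdGE 1 a) (n : ℕ) : OrdGE n (a ^ n) := by
  induction n with
  | zero => exact ordGE_zero_left _
  | succ n ih => rw [pow_succ]; exact ih.mul ha

theorem ordGE_one_iff {a : PowerSeries R} : OrdGE 1 a ↔ coeff 0 a = 0 :=
  ⟨fun h => h 0 one_pos, fun h i hi => by obtain rfl : i = 0 := by omega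
                                          exact h⟩

/-- The sum of a sequence of series whose `m`-th member has order at least `m`. -/
def fsum (a : ℕ → PowerSeries R) : PowerSeries R :=
  mk fun n => ∑ m ∈ range (n + 1), coeff n (a m)

theorem coeff_fsum {a : ℕ → PowerSeries R} (ha : ∀ m, OrdGE m (a m)) {n M : ℕ} (h : n < M) :
    coeff n (fsum a) = ∑ m ∈ range M, coeff n (a m) := by
  rw [fsum, coeff_mk]
  refine sum_subset (range_subset_range.2 h) fun m _ hm => ha m n ?_
  rw [mem_range] at hm; omega

/-- At order `n` both sides add the coefficients of `a i * b j`, once over a square of indices and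
once over the triangle `i + j ≤ n`. The products outside the triangle have order above `n`, so they
contribute nothing. -/
theorem fsum_mul {a b : ℕ → PowerSeries R} (ha : ∀ m, OrdGE m (a m)) (hb : ∀ m, OrdGE m (b m)) :
    fsum a * fsum b = fsum fun m => ∑ ij ∈ antidiagonal m, a ij.1 * b ij.2 := by
  ext n
  have h1 : coeff n (fsum a * fsum b) =
      ∑ i ∈ range (n + 1), ∑ j ∈ range (n + 1), coeff n (a i * b j) := by
    have h2 : coeff n (fsum a * fsum b) = ∑ p ∈ antidiagonal n, ∑ i ∈ range (n + 1),
        ∑ j ∈ range (n + 1), coeff p.1 (a i) * coeff p.2 (b j) := by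
      rw [coeff_mul]
      refine sum_congr rfl fun p hp => ?_
      rw [mem_antidiagonal] at hp
      rw [coeff_fsum ha (show p.1 < n + 1 by omega), coeff_fsum hb (show p.2 < n + 1 by omega),
        sum_mul_sum]
    rw [h2, sum_comm]
    refine sum_congr rfl fun i _ => ?_
    rw [sum_comm]
    simp_rw [coeff_mul]
  rw [h1, fsum, coeff_mk, ← sum_product', sum_congr rfl fun m _ => map_sum _ _ _, sum_sigma']
  symm
  refine sum_bij_ne_zero (fun x _ _ => x.2) ?_ ?_ ?_ ?_
  · rintro ⟨m, i, j⟩ hx -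
    simp only [mem_sigma, mem_range, mem_antidiagonal, mem_product] at hx ⊢
    omega
  · rintro ⟨m, i, j⟩ hx - ⟨m', i', j'⟩ hx' - h
    simp only [mem_sigma, mem_range, mem_antidiagonal, Prod.mk.injEq] at hx hx' h
    obtain ⟨rfl, rfl⟩ := h
    obtain rfl : m = m' := by omega
    rfl
  · rintro ⟨i, j⟩ _ hne
    have hle : i + j < n + 1 := by
      by_contra hlt
      exact hne ((ha i).mul (hb j) n (by omega))
    exact ⟨⟨i + j, i, j⟩, by simp [hle], hne, rfl⟩
  · rintro _ _ _; rfl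

theorem fsum_pure (b : PowerSeries R) : fsum (fun m => if m = 0 then b else 0) = b := by
  ext n
  rw [fsum, coeff_mk, sum_eq_single 0] <;> simp +contextual

theorem ordGE_neg {n : ℕ} {X : PowerSeries R} (hX : OrdGE n X) : OrdGE n (-X) := by
  have := (ordGE_zero n).sub hX
  rwa [zero_sub] at this

/-- Only odd powers of the variable occur. -/
def IsOddSeries (a : PowerSeries R) : Prop := ∀ n, Even n → coeff n a = 0

theorem IsOddSeries.ord {a : PowerSeries R} (h : IsOddSeries a) : OrdGE 1 a :=
  ordGE_one_iff.2 (h 0 Even.zero)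

variable [Algebra ℂ R]

theorem coeff_csmul (c : ℂ) (a : PowerSeries R) (n : ℕ) : coeff n (c • a) = c • coeff n a := rfl

theorem OrdGE.smul {n : ℕ} {a : PowerSeries R} (ha : OrdGE n a) (c : ℂ) : OrdGE n (c • a) :=
  fun i hi => by rw [coeff_csmul, ha i hi, smul_zero]

/-- The `m`-th term of the exponential series. -/
def expTerm (X : PowerSeries R) (m : ℕ) : PowerSeries R := ((m.factorial : ℂ)⁻¹) • X ^ m

theorem formalExp_eq (X : PowerSeries R) : formalExp X = fsum (expTerm X) := rfl

theorem expTerm_ord {X : PowerSeries R} (hX : OrdGE 1 X) (m : ℕ) : OrdGE m (expTerm X m) :=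
  (hX.pow m).smul _

/-- The commutator with `X`, as a linear map. -/
def adj (X : PowerSeries R) : Module.End ℂ (PowerSeries R) :=
  LinearMap.mulLeft ℂ X - LinearMap.mulRight ℂ X

theorem adj_apply (X Y : PowerSeries R) : adj X Y = X * Y - Y * X := rfl

theorem adj_ord {X Y : PowerSeries R} (hX : OrdGE 1 X) {n : ℕ} (hY : OrdGE n Y) :
    OrdGE (n + 1) (adj X Y) := by
  rw [adj_apply]
  refine OrdGE.sub ?_ (hY.mul hX)
  rw [add_comm]; exact hX.mul hY

theorem adj_pow_ord {X Y : PowerSeries R} (hX : OrdGE 1 X) {n : ℕ} (hY : OrdGE n Y) (k : ℕ) :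
    OrdGE (n + k) ((adj X ^ k) Y) := by
  induction k with
  | zero => exact hY
  | succ k ih => rw [pow_succ', Module.End.mul_apply]; exact adj_ord hX ih

/-- Left multiplication by `X` is the commutator plus right multiplication. These two operators
commute, so the binomial theorem applies. The ring is arbitrary because the identity is used both
for series and for endomorphisms of series. -/
theorem pow_mul_expand {S : Type*} [Ring S] [Algebra ℂ S] (X Y : S) (m : ℕ) :
    X ^ m * Y = ∑ ij ∈ antidiagonal m, m.choose ij.1 •
      (((LinearMap.mulLeft ℂ X - LinearMap.mulRight ℂ X) ^ ij.1) Y * X ^ ij.2) := by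
  have hc : Commute (LinearMap.mulLeft ℂ X - LinearMap.mulRight ℂ X) (LinearMap.mulRight ℂ X) :=
    (LinearMap.commute_mulLeft_right X X).sub_left (Commute.refl _)
  have h2 := congrArg (fun f : Module.End ℂ S => f Y) (hc.symm.add_pow' m)
  have h3 := congrArg (fun f : Module.End ℂ S => f Y) (hc.add_pow' m)
  simp only [sub_add_cancel, LinearMap.pow_mulLeft, LinearMap.mulLeft_apply] at h3
  rw [h3, LinearMap.sum_apply]
  refine sum_congr rfl fun ij _ => ?_
  rw [LinearMap.smul_apply, (hc.pow_pow ij.1 ij.2).eq, Module.End.mul_apply, LinearMap.pow_mulRight,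
    LinearMap.mulRight_apply]

theorem inv_factorial_choose {m : ℕ} {ij : ℕ × ℕ} (h : ij ∈ antidiagonal m) :
    ((m.factorial : ℂ)⁻¹) * (m.choose ij.1 : ℂ) =
      ((ij.1.factorial : ℂ)⁻¹) * ((ij.2.factorial : ℂ)⁻¹) := by
  rw [mem_antidiagonal] at h
  obtain ⟨i, j⟩ := ij
  simp only at h ⊢
  subst h
  have := Nat.add_choose_mul_factorial_mul_factorial i j
  rw [← Nat.choose_symm_add] at this
  have h1 : ((i + j).choose i : ℂ) * (i.factorial : ℂ) * (j.factorial : ℂ) =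
      ((i + j).factorial : ℂ) := by exact_mod_cast this
  have a1 : (i.factorial : ℂ) ≠ 0 := by exact_mod_cast i.factorial_ne_zero
  have a2 : (j.factorial : ℂ) ≠ 0 := by exact_mod_cast j.factorial_ne_zero
  have a3 : ((i + j).factorial : ℂ) ≠ 0 := by exact_mod_cast (i + j).factorial_ne_zero
  field_simp
  rw [← h1]

/-- The action `exp (ad X) Y`. -/
def expAd (X Y : PowerSeries R) : PowerSeries R :=
  fsum fun k => ((k.factorial : ℂ)⁻¹) • (adj X ^ k) Y

/-- This is `exp X · Y · exp (-X) = exp (ad X) Y`: dividing `pow_mul_expand` by `m!` turns its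
binomial sum into a product of two exponential series. -/
theorem formalExp_mul {X : PowerSeries R} (hX : OrdGE 1 X) (Y : PowerSeries R) :
    formalExp X * Y = expAd X Y * formalExp X := by
  have h1 : formalExp X * Y = fsum fun m => expTerm X m * Y := by
    conv_lhs => rw [← fsum_pure Y, formalExp_eq]
    rw [fsum_mul (expTerm_ord hX)]
    · congr 1; ext1 m
      rw [sum_eq_single (m, 0)]
      · simp
      · rintro ⟨i, j⟩ hij hne
        rw [mem_antidiagonal] at hij
        have : j ≠ 0 := by rintro rfl; exact hne (by simp_all)
        simp [this]
      · simp
    · intro m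
      split_ifs with h
      · subst h; exact ordGE_zero_left _
      · exact ordGE_zero m
  rw [h1, formalExp_eq, expAd, fsum_mul _ (expTerm_ord hX)]
  · congr 1; ext1 m
    rw [expTerm, smul_mul_assoc, pow_mul_expand, smul_sum]
    refine sum_congr rfl fun ij hij => ?_
    rw [expTerm, smul_mul_smul_comm, ← inv_factorial_choose hij, mul_smul, Nat.cast_smul_eq_nsmul]
    rfl
  · intro k
    have := (adj_pow_ord hX (ordGE_zero_left Y) k)
    rw [zero_add] at this
    exact this.smul _

/-- The Euler derivation, multiplying the coefficient of order `n` by `n`. -/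
def euler : Module.End ℂ (PowerSeries R) where
  toFun a := mk fun n => (n : ℂ) • coeff n a
  map_add' a b := by ext n; simp
  map_smul' c a := by
    ext n
    simp only [coeff_mk, RingHom.id_apply, coeff_csmul]
    rw [smul_comm]

theorem coeff_euler (a : PowerSeries R) (n : ℕ) : coeff n (euler a) = (n : ℂ) • coeff n a := by
  simp [euler]

theorem euler_mul (a b : PowerSeries R) : euler (a * b) = euler a * b + a * euler b := by
  ext n
  rw [coeff_euler, map_add, coeff_mul, coeff_mul, coeff_mul, smul_sum, ← sum_add_distrib]
  refine sum_congr rfl fun p hp => ?_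
  rw [mem_antidiagonal] at hp
  rw [coeff_euler, coeff_euler, smul_mul_assoc, mul_smul_comm, ← add_smul, ← hp]
  push_cast; rfl

theorem euler_ord {n : ℕ} {a : PowerSeries R} (h : OrdGE n a) : OrdGE n (euler a) :=
  fun i hi => by rw [coeff_euler, h i hi, smul_zero]

theorem euler_one : euler (1 : PowerSeries R) = 0 := by
  ext n
  rw [coeff_euler, coeff_one]
  split_ifs with h <;> simp [h]

/-- The `k`-th term of the logarithmic derivative of the exponential. -/
def dexpTerm (X Y : PowerSeries R) (k : ℕ) : PowerSeries R :=
  if k = 0 then 0 else ((k.factorial : ℂ)⁻¹) • (adj X ^ (k - 1)) Y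

/-- The logarithmic derivative of `exp X`. -/
def dexp (X : PowerSeries R) : PowerSeries R := fsum (dexpTerm X (euler X))

theorem dexpTerm_ord {X Y : PowerSeries R} (hX : OrdGE 1 X) (hY : OrdGE 1 Y) (k : ℕ) :
    OrdGE k (dexpTerm X Y k) := by
  rw [dexpTerm]
  split_ifs with h
  · subst h; exact ordGE_zero_left _
  · have := (adj_pow_ord hX hY (k - 1)).smul ((k.factorial : ℂ)⁻¹)
    rwa [show 1 + (k - 1) = k by omega] at this

/-- As `euler` is a derivation, its commutator with left multiplication by `X` is minus left
multiplication by `euler X`. Further commutators never leave the left multiplications. -/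
theorem adj_mulLeft_euler (X : PowerSeries R) (k : ℕ) :
    ((LinearMap.mulLeft ℂ (LinearMap.mulLeft ℂ X) - LinearMap.mulRight ℂ (LinearMap.mulLeft ℂ X))
      ^ (k + 1)) (euler : Module.End ℂ (PowerSeries R)) =
      -LinearMap.mulLeft ℂ ((adj X ^ k) (euler X)) := by
  induction k with
  | zero =>
    ext1 a
    simp [euler_mul]
  | succ k ih =>
    rw [pow_succ', Module.End.mul_apply, ih]
    ext1 a
    rw [pow_succ' (adj X), Module.End.mul_apply, adj_apply]
    simp [sub_mul, mul_assoc, neg_add_eq_sub]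

/-- `pow_mul_expand` is read in the endomorphism ring, with left multiplication by `X` in place of
`X` and `euler` in place of `Y`, and applied to `1`. The left side dies since `euler 1 = 0`, and the
term of index zero on the right is `euler (X ^ m)`. -/
theorem euler_pow (X : PowerSeries R) (m : ℕ) :
    euler (X ^ m) = ∑ ij ∈ antidiagonal m, m.choose ij.1 •
      ((if ij.1 = 0 then 0 else (adj X ^ (ij.1 - 1)) (euler X)) * X ^ ij.2) := by
  have h := congrArg (fun f : Module.End ℂ (PowerSeries R) => f 1)
    (pow_mul_expand (LinearMap.mulLeft ℂ X) (euler : Module.End ℂ (PowerSeries R)) m)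
  simp only [LinearMap.pow_mulLeft, Module.End.mul_apply, LinearMap.mulLeft_apply, euler_one,
    mul_zero, LinearMap.sum_apply, LinearMap.smul_apply, mul_one] at h
  cases m with
  | zero => simp [euler_one]
  | succ m =>
    rw [Nat.sum_antidiagonal_succ] at h ⊢
    simp only [pow_zero, adj_mulLeft_euler, Module.End.one_apply, LinearMap.neg_apply,
      LinearMap.mulLeft_apply, smul_neg, sum_neg_distrib, Nat.choose_zero_right, one_smul] at h
    simp only [Nat.succ_ne_zero, if_true, if_false, zero_mul, smul_zero, zero_add,
      Nat.add_sub_cancel]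
    exact add_neg_eq_zero.1 h.symm

theorem euler_fsum (a : ℕ → PowerSeries R) : euler (fsum a) = fsum fun m => euler (a m) := by
  ext n
  simp only [fsum, coeff_euler, coeff_mk, smul_sum]

theorem euler_formalExp {X : PowerSeries R} (hX : OrdGE 1 X) :
    euler (formalExp X) = dexp X * formalExp X := by
  rw [formalExp_eq, euler_fsum, dexp, fsum_mul (dexpTerm_ord hX (euler_ord hX)) (expTerm_ord hX)]
  congr 1; ext1 m
  rw [expTerm, map_smul, euler_pow, smul_sum]
  refine sum_congr rfl fun ij hij => ?_
  rw [expTerm, ← Nat.cast_smul_eq_nsmul ℂ, smul_smul, inv_factorial_choose hij, dexpTerm]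
  split_ifs
  · simp
  · rw [smul_mul_smul_comm]

theorem coeff_zero_formalExp (X : PowerSeries R) : coeff 0 (formalExp X) = 1 := by
  simp [formalExp]

theorem formalExp_mul_neg {X : PowerSeries R} (hX : OrdGE 1 X) :
    formalExp X * formalExp (-X) = 1 := by
  have hX' := ordGE_neg hX
  rw [formalExp_eq, formalExp_eq, fsum_mul (expTerm_ord hX) (expTerm_ord hX'), ← fsum_pure 1]
  congr 1; ext1 m
  have h := (Commute.neg_right (Commute.refl X)).add_pow' m
  rw [add_neg_cancel] at h
  have h2 : ∑ ij ∈ antidiagonal m, expTerm X ij.1 * expTerm (-X) ij.2 =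
      ((m.factorial : ℂ)⁻¹) • (0 : PowerSeries R) ^ m := by
    rw [h, smul_sum]
    refine sum_congr rfl fun ij hij => ?_
    rw [expTerm, expTerm, smul_mul_smul_comm, ← inv_factorial_choose hij, mul_smul,
      Nat.cast_smul_eq_nsmul]
  rw [h2]
  split_ifs with hm
  · subst hm; simp
  · rw [zero_pow hm, smul_zero]

theorem formalExp_neg_mul {X : PowerSeries R} (hX : OrdGE 1 X) :
    formalExp (-X) * formalExp X = 1 := by
  have := formalExp_mul_neg (ordGE_neg hX)
  rwa [neg_neg] at this

/-- A series with constant term one is determined by its logarithmic derivative. -/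
theorem eq_of_euler_eq {E E' Y : PowerSeries R} (hY : OrdGE 1 Y) (h0 : coeff 0 E = coeff 0 E')
    (hE : euler E = Y * E) (hE' : euler E' = Y * E') : E = E' := by
  ext n
  induction n using Nat.strong_induction_on with
  | _ n ih =>
    rcases Nat.eq_zero_or_pos n with rfl | hn
    · exact h0
    · have h1 := congrArg (coeff n) hE
      have h2 := congrArg (coeff n) hE'
      rw [coeff_euler, coeff_mul] at h1 h2
      have h3 : (n : ℂ) • coeff n E = (n : ℂ) • coeff n E' := by
        rw [h1, h2]
        refine sum_congr rfl fun p hp => ?_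
        rw [mem_antidiagonal] at hp
        rcases Nat.eq_zero_or_pos p.1 with h | h
        · rw [h, hY 0 one_pos, zero_mul, zero_mul]
        · rw [ih p.2 (by omega)]
      exact (smul_right_inj (show (n : ℂ) ≠ 0 by exact_mod_cast hn.ne')).1 h3

/-- The part of `dexp` that is at least quadratic. -/
def dexpTail (X : PowerSeries R) : PowerSeries R := dexp X - euler X

/-- Each commutator with a series of order one raises by one the order to which the two expressions
are known to agree. -/
theorem adj_pow_euler_congr {X X' : PowerSeries R} (hX : OrdGE 1 X) (hX' : OrdGE 1 X') {n : ℕ}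
    (h : OrdGE n (X - X')) (k : ℕ) :
    OrdGE (n + k) ((adj X ^ k) (euler X) - (adj X' ^ k) (euler X')) := by
  induction k with
  | zero =>
    have := euler_ord h
    rwa [map_sub] at this
  | succ k ih =>
    simp only [pow_succ', Module.End.mul_apply]
    set a := (adj X ^ k) (euler X)
    set a' := (adj X' ^ k) (euler X')
    have ha : OrdGE (1 + k) a := adj_pow_ord hX (euler_ord hX) k
    have e : adj X a - adj X' a' = ((X - X') * a - a * (X - X')) + adj X' (a - a') := by
      simp only [adj_apply]; noncomm_ring
    rw [e]
    refine OrdGE.add (OrdGE.sub ?_ ?_) (adj_ord hX' ih)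
    · have := h.mul ha
      rwa [show n + (1 + k) = n + (k + 1) by omega] at this
    · have := ha.mul h
      rwa [show 1 + k + n = n + (k + 1) by omega] at this

theorem coeff_dexpTail {X : PowerSeries R} (hX : OrdGE 1 X) {n M : ℕ} (hn : n < M) :
    coeff n (dexpTail X) = ∑ k ∈ range M, (((k + 2).factorial : ℂ)⁻¹) •
      coeff n ((adj X ^ (k + 1)) (euler X)) := by
  rw [dexpTail, map_sub, dexp,
    coeff_fsum (dexpTerm_ord hX (euler_ord hX)) (show n < M + 2 by omega), sum_range_succ',
    sum_range_succ']
  simp [dexpTerm]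

/-- Every term of the tail contains a commutator, so its coefficient of order `n` only sees the
coefficients of `X` below `n`. This triangularity makes `dexp` injective and lets `dexp Z = Y` be
solved recursively. -/
theorem dexpTail_congr {X X' : PowerSeries R} (hX : OrdGE 1 X) (hX' : OrdGE 1 X') {n : ℕ}
    (h : OrdGE n (X - X')) : coeff n (dexpTail X) = coeff n (dexpTail X') := by
  rw [coeff_dexpTail hX n.lt_succ_self, coeff_dexpTail hX' n.lt_succ_self]
  refine sum_congr rfl fun k _ => ?_
  have := adj_pow_euler_congr hX hX' h (k + 1) n (by omega)
  rw [map_sub, sub_eq_zero] at this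
  rw [this]

theorem dexp_injective {X X' : PowerSeries R} (hX : OrdGE 1 X) (hX' : OrdGE 1 X')
    (h : dexp X = dexp X') : X = X' := by
  ext n
  induction n using Nat.strong_induction_on with
  | _ n ih =>
    rcases Nat.eq_zero_or_pos n with rfl | hn
    · rw [hX 0 one_pos, hX' 0 one_pos]
    · have h1 : OrdGE n (X - X') := fun i hi => by rw [map_sub, ih i hi, sub_self]
      have h2 := dexpTail_congr hX hX' h1
      rw [dexpTail, dexpTail, h, map_sub, map_sub, sub_right_inj, coeff_euler, coeff_euler] at h2
      exact (smul_right_inj (show (n : ℂ) ≠ 0 by exact_mod_cast hn.ne')).1 h2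

/-- Equal exponentials have equal logarithmic derivatives, because exponentials are invertible; then
`dexp_injective` applies. -/
theorem formalExp_injective {X X' : PowerSeries R} (hX : OrdGE 1 X) (hX' : OrdGE 1 X')
    (h : formalExp X = formalExp X') : X = X' := by
  refine dexp_injective hX hX' ?_
  have h1 := euler_formalExp hX
  rw [h, euler_formalExp hX'] at h1
  have h2 := congrArg (· * formalExp (-X')) h1
  simpa only [mul_assoc, formalExp_mul_neg hX', mul_one] using h2.symm

/-! ### Series with coefficients in a Lie subalgebra -/

/-- The coefficients of the solution of `dexp Z = Y`. -/
def dexpInvCoeff (Y : PowerSeries R) : ℕ → R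
  -- At `n = 0` the inverse is `0` by convention, so the constant term vanishes. The tail is
  -- evaluated on the solution truncated below `n`, which suffices by `dexpTail_congr`.
  | n => (n : ℂ)⁻¹ • (coeff n Y -
      coeff n (dexpTail (mk fun j => if _h : j < n then dexpInvCoeff Y j else 0)))
termination_by n => n

/-- The solution of `dexp Z = Y`. -/
def dexpInv (Y : PowerSeries R) : PowerSeries R := mk (dexpInvCoeff Y)

theorem dexpInv_ord (Y : PowerSeries R) : OrdGE 1 (dexpInv Y) := by
  rw [ordGE_one_iff, dexpInv, coeff_mk, dexpInvCoeff]; simp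

theorem dexp_dexpInv {Y : PowerSeries R} (hY : OrdGE 1 Y) : dexp (dexpInv Y) = Y := by
  ext n
  have h0 := dexpInv_ord Y
  have e : dexp (dexpInv Y) = euler (dexpInv Y) + dexpTail (dexpInv Y) := by
    rw [dexpTail]; abel
  rw [e, map_add, coeff_euler]
  rcases Nat.eq_zero_or_pos n with rfl | hn
  · rw [hY 0 one_pos, coeff_dexpTail h0 one_pos, sum_range_one,
      (adj_pow_ord h0 (euler_ord h0) (0 + 1)) 0 (by omega)]
    simp
  · set Zt : PowerSeries R := mk fun j => if _h : j < n then dexpInvCoeff Y j else 0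
    have hZt : OrdGE 1 Zt := by
      rw [ordGE_one_iff, coeff_mk, dif_pos hn, dexpInvCoeff]; simp
    have hc : OrdGE n (dexpInv Y - Zt) := fun i hi => by
      rw [map_sub, dexpInv, coeff_mk, coeff_mk, dif_pos hi, sub_self]
    rw [dexpTail_congr h0 hZt hc]
    conv_lhs => rw [dexpInv, coeff_mk, dexpInvCoeff]
    rw [smul_smul, mul_inv_cancel₀ (show (n : ℂ) ≠ 0 by exact_mod_cast hn.ne'), one_smul]
    exact sub_add_cancel _ _

/-- A submodule closed under commutators. -/
def IsLieClosed (K : Submodule ℂ R) : Prop := ∀ x ∈ K, ∀ y ∈ K, x * y - y * x ∈ K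

/-- All coefficients of `a` belong to `K`. -/
def CoeffsIn (K : Submodule ℂ R) (a : PowerSeries R) : Prop := ∀ n, coeff n a ∈ K

variable {K : Submodule ℂ R}

/-- Reversing the antidiagonal in the second product pairs the terms into commutators of
coefficients. Since `dexp`, `expAd` and `dexpInv` are made of commutators and linear operations
only, they preserve the Lie algebra as well. -/
theorem CoeffsIn.adj (hK : IsLieClosed K) {a b : PowerSeries R} (ha : CoeffsIn K a)
    (hb : CoeffsIn K b) : CoeffsIn K (adj a b) := fun n => by
  rw [adj_apply, map_sub, coeff_mul, coeff_mul,
    ← Nat.sum_antidiagonal_swap (f := fun p => coeff p.1 b * coeff p.2 a), ← sum_sub_distrib]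
  exact K.sum_mem fun p _ => hK _ (ha _) _ (hb _)

theorem CoeffsIn.adj_pow (hK : IsLieClosed K) {a b : PowerSeries R} (ha : CoeffsIn K a)
    (hb : CoeffsIn K b) (k : ℕ) : CoeffsIn K ((MagnusZassenhaus.adj a ^ k) b) := by
  induction k with
  | zero => exact hb
  | succ k ih => rw [pow_succ', Module.End.mul_apply]; exact ha.adj hK ih

theorem CoeffsIn.smul {a : PowerSeries R} (ha : CoeffsIn K a) (c : ℂ) : CoeffsIn K (c • a) :=
  fun n => K.smul_mem _ (ha n)

theorem CoeffsIn.euler {a : PowerSeries R} (ha : CoeffsIn K a) : CoeffsIn K (euler a) :=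
  fun n => by rw [coeff_euler]; exact K.smul_mem _ (ha n)

theorem CoeffsIn.fsum {a : ℕ → PowerSeries R} (ha : ∀ m, CoeffsIn K (a m)) :
    CoeffsIn K (fsum a) := fun n => by
  rw [MagnusZassenhaus.fsum, coeff_mk]; exact K.sum_mem fun m _ => ha m n

theorem CoeffsIn.dexp (hK : IsLieClosed K) {a : PowerSeries R} (ha : CoeffsIn K a) :
    CoeffsIn K (dexp a) := by
  refine CoeffsIn.fsum fun m => ?_
  rw [dexpTerm]
  split_ifs
  · intro n; simp
  · exact (ha.adj_pow hK ha.euler _).smul _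

theorem CoeffsIn.sub {a b : PowerSeries R} (ha : CoeffsIn K a) (hb : CoeffsIn K b) :
    CoeffsIn K (a - b) := fun n => by rw [map_sub]; exact K.sub_mem (ha n) (hb n)

theorem CoeffsIn.add {a b : PowerSeries R} (ha : CoeffsIn K a) (hb : CoeffsIn K b) :
    CoeffsIn K (a + b) := fun n => by rw [map_add]; exact K.add_mem (ha n) (hb n)

theorem CoeffsIn.expAd (hK : IsLieClosed K) {a b : PowerSeries R} (ha : CoeffsIn K a)
    (hb : CoeffsIn K b) : CoeffsIn K (expAd a b) :=
  CoeffsIn.fsum fun k => (ha.adj_pow hK hb k).smul _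

theorem CoeffsIn.dexpInv (hK : IsLieClosed K) {Y : PowerSeries R} (hY : CoeffsIn K Y) :
    CoeffsIn K (dexpInv Y) := by
  intro n
  rw [MagnusZassenhaus.dexpInv, coeff_mk]
  induction n using Nat.strong_induction_on with
  | _ n ih =>
    rw [dexpInvCoeff]
    refine K.smul_mem _ (K.sub_mem (hY n) ?_)
    have hc : CoeffsIn K (mk fun j => if _h : j < n then dexpInvCoeff Y j else 0) := by
      intro j
      rw [coeff_mk]
      split_ifs with h
      · exact ih j h
      · exact K.zero_mem
    exact (hc.dexp hK).sub hc.euler n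

theorem expAd_ord (X : PowerSeries R) {Y : PowerSeries R} (hY : OrdGE 1 Y) :
    OrdGE 1 (expAd X Y) := by
  rw [ordGE_one_iff, expAd, fsum, coeff_mk]
  have := hY 0 one_pos
  rw [coeff_zero_eq_constantCoeff_apply] at this
  simp [this]

theorem dexp_ord (X : PowerSeries R) : OrdGE 1 (dexp X) := by
  rw [ordGE_one_iff, dexp, fsum, coeff_mk]
  simp [dexpTerm]

/-- The Baker–Campbell–Hausdorff theorem: the product of two exponentials of series with
coefficients in a Lie algebra is the exponential of such a series. -/
theorem exists_formalExp_mul (hK : IsLieClosed K) {X Y : PowerSeries R} (hX : OrdGE 1 X)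
    (hY : OrdGE 1 Y) (hXK : CoeffsIn K X) (hYK : CoeffsIn K Y) :
    ∃ Z : PowerSeries R, OrdGE 1 Z ∧ CoeffsIn K Z ∧ formalExp Z = formalExp X * formalExp Y := by
  -- `U` is the logarithmic derivative of `exp X · exp Y`: the derivative of the second factor is
  -- moved to the left through `exp X`, which acts on it by `exp (ad X)`. Solving `dexp Z = U`
  -- inside the Lie algebra then gives `Z`, as a series is determined by its logarithmic derivative
  -- and its constant term.
  set U := dexp X + expAd X (dexp Y)
  have hU : OrdGE 1 U := (dexp_ord X).add (expAd_ord X (dexp_ord Y))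
  have hUK : CoeffsIn K U := (hXK.dexp hK).add (hXK.expAd hK (hYK.dexp hK))
  refine ⟨dexpInv U, dexpInv_ord U, hUK.dexpInv hK, eq_of_euler_eq hU ?_ ?_ ?_⟩
  · rw [coeff_zero_formalExp, coeff_mul]
    simp [coeff_zero_formalExp, -coeff_zero_eq_constantCoeff]
  · rw [euler_formalExp (dexpInv_ord U), dexp_dexpInv hU]
  · rw [euler_mul, euler_formalExp hX, euler_formalExp hY, add_mul, ← mul_assoc, ← mul_assoc,
      ← mul_assoc, formalExp_mul hX]

/-! ### Odd series -/

theorem IsOddSeries.smul {a : PowerSeries R} (h : IsOddSeries a) (c : ℂ) : IsOddSeries (c • a) :=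
  fun n hn => by rw [coeff_csmul, h n hn, smul_zero]

/-- The substitution `h ↦ -h`. -/
def reflect (a : PowerSeries R) : PowerSeries R := mk fun n => (-1 : ℂ) ^ n • coeff n a

theorem coeff_reflect (a : PowerSeries R) (n : ℕ) :
    coeff n (reflect a) = (-1 : ℂ) ^ n • coeff n a := by rw [reflect, coeff_mk]

theorem reflect_mul (a b : PowerSeries R) : reflect (a * b) = reflect a * reflect b := by
  ext n
  rw [coeff_reflect, coeff_mul, coeff_mul, smul_sum]
  refine sum_congr rfl fun p hp => ?_
  rw [mem_antidiagonal] at hp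
  rw [coeff_reflect, coeff_reflect, smul_mul_smul_comm, ← pow_add, hp]

theorem reflect_one : reflect (1 : PowerSeries R) = 1 := by
  ext n
  rw [coeff_reflect, coeff_one]
  split_ifs with h <;> simp [h]

theorem reflect_pow (a : PowerSeries R) (m : ℕ) : reflect (a ^ m) = reflect a ^ m := by
  induction m with
  | zero => simp [reflect_one]
  | succ m ih => rw [pow_succ, reflect_mul, ih, pow_succ]

theorem reflect_formalExp (a : PowerSeries R) :
    reflect (formalExp a) = formalExp (reflect a) := by
  ext n
  rw [coeff_reflect, formalExp, formalExp, coeff_mk, coeff_mk, smul_sum]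
  refine sum_congr rfl fun m _ => ?_
  rw [← reflect_pow, coeff_reflect, smul_comm]

theorem isOddSeries_iff {a : PowerSeries R} : IsOddSeries a ↔ reflect a = -a := by
  constructor
  · intro h
    ext n
    rw [coeff_reflect, map_neg]
    rcases Nat.even_or_odd n with hn | hn
    · rw [h n hn]; simp
    · rw [hn.neg_one_pow]; simp
  · intro h n hn
    have h1 := congrArg (coeff n) h
    rw [coeff_reflect, map_neg, hn.neg_one_pow, one_smul] at h1
    have h2 : (2 : ℂ) • coeff n a = 0 := by rw [two_smul]; nth_rewrite 2 [h1]; simp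
    exact (smul_eq_zero.1 h2).resolve_left two_ne_zero

/-- The symmetric Baker–Campbell–Hausdorff theorem: existence and oddness of the exponent. -/
theorem exists_symmetric_formalExp (hK : IsLieClosed K) {X Y : PowerSeries R}
    (hX : IsOddSeries X) (hY : IsOddSeries Y) (hXK : CoeffsIn K X) (hYK : CoeffsIn K Y) :
    ∃ Z : PowerSeries R, IsOddSeries Z ∧ CoeffsIn K Z ∧
      formalExp Z = formalExp ((1 / 2 : ℂ) • X) * formalExp Y * formalExp ((1 / 2 : ℂ) • X) := by
  have hX2 := hX.smul (1 / 2)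
  obtain ⟨Z₁, h1, h1K, e1⟩ := exists_formalExp_mul hK hX2.ord hY.ord (hXK.smul _) hYK
  obtain ⟨Z, h2, h2K, e2⟩ := exists_formalExp_mul hK h1 hX2.ord h1K (hXK.smul (1 / 2))
  rw [e1] at e2
  refine ⟨Z, ?_, h2K, e2⟩
  have hr : OrdGE 1 (reflect Z) := fun i hi => by rw [coeff_reflect, h2 i hi, smul_zero]
  rw [isOddSeries_iff]
  refine formalExp_injective hr (ordGE_neg h2) ?_
  -- Replacing `h` by `-h` inverts each of the three factors. For a palindromic word this gives the
  -- inverse word, so the product telescopes from the middle.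
  have a1 : formalExp (reflect Z) * formalExp Z = 1 := by
    rw [← reflect_formalExp, e2, reflect_mul, reflect_mul, reflect_formalExp, reflect_formalExp,
      isOddSeries_iff.1 hX2, isOddSeries_iff.1 hY]
    set a := formalExp ((1 / 2 : ℂ) • X)
    set a' := formalExp (-((1 / 2 : ℂ) • X))
    set b := formalExp Y
    set b' := formalExp (-Y)
    have ha : a' * a = 1 := formalExp_neg_mul hX2.ord
    have hb : b' * b = 1 := formalExp_neg_mul hY.ord
    calc a' * b' * a' * (a * b * a) = a' * (b' * ((a' * a) * b)) * a := by simp only [mul_assoc]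
      _ = 1 := by rw [ha, one_mul, hb, mul_one, ha]
  calc formalExp (reflect Z) = formalExp (reflect Z) * (formalExp Z * formalExp (-Z)) := by
        rw [formalExp_mul_neg h2, mul_one]
    _ = formalExp (-Z) := by rw [← mul_assoc, a1, one_mul]

end FormalSeries

end MagnusZassenhaus
namespace MagnusZassenhaus

/-! ### Coefficients of the symmetric Baker–Campbell–Hausdorff exponent up to order five -/

section SymmetricBCH

variable {R : Type*} [Ring R]

open PowerSeries

theorem coeff_symm_mul {A B : PowerSeries R} (hA : coeff 0 A = 1) (hB : coeff 0 B = 1) :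
    coeff 1 (A * B * A) = 2 • coeff 1 A + coeff 1 B ∧
    coeff 3 (A * B * A) = 2 • coeff 3 A + coeff 3 B + coeff 2 A * coeff 1 A + coeff 1 A * coeff 2 A
      + coeff 1 A * coeff 1 B * coeff 1 A + coeff 2 A * coeff 1 B + coeff 1 B * coeff 2 A
      + coeff 1 A * coeff 2 B + coeff 2 B * coeff 1 A ∧
    coeff 5 (A * B * A) = 2 • coeff 5 A + coeff 5 B + coeff 4 A * coeff 1 A + coeff 1 A * coeff 4 A
      + coeff 3 A * coeff 2 A + coeff 2 A * coeff 3 A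
      + coeff 4 A * coeff 1 B + coeff 1 B * coeff 4 A + coeff 3 A * coeff 1 B * coeff 1 A
      + coeff 1 A * coeff 1 B * coeff 3 A + coeff 2 A * coeff 1 B * coeff 2 A
      + coeff 3 A * coeff 2 B + coeff 2 B * coeff 3 A + coeff 2 A * coeff 2 B * coeff 1 A
      + coeff 1 A * coeff 2 B * coeff 2 A
      + coeff 2 A * coeff 3 B + coeff 3 B * coeff 2 A + coeff 1 A * coeff 3 B * coeff 1 A
      + coeff 1 A * coeff 4 B + coeff 4 B * coeff 1 A := by
  rw [coeff_zero_eq_constantCoeff_apply] at hA hB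
  refine ⟨?_, ?_, ?_⟩ <;>
  · simp only [coeff_mul, Finset.Nat.antidiagonal_succ, Finset.Nat.antidiagonal_zero,
      Finset.sum_cons, Finset.map_cons, Finset.map_singleton, Finset.sum_singleton,
      Function.Embedding.prodMap, Function.Embedding.coeFn_mk, Prod.map_apply,
      Function.Embedding.refl_apply, Nat.succ_eq_add_one, Nat.reduceAdd,
      coeff_zero_eq_constantCoeff, hA, hB, one_mul, mul_one, add_mul, zero_add, two_smul]
    abel

variable [Algebra ℂ R]

theorem coeff_formalExp_of_odd {X : PowerSeries R} (hX : IsOddSeries X) :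
    coeff 1 (formalExp X) = coeff 1 X ∧
    coeff 2 (formalExp X) = (1 / 2 : ℂ) • (coeff 1 X * coeff 1 X) ∧
    coeff 3 (formalExp X) = coeff 3 X + (1 / 6 : ℂ) • (coeff 1 X * coeff 1 X * coeff 1 X) ∧
    coeff 4 (formalExp X) = (1 / 2 : ℂ) • (coeff 1 X * coeff 3 X + coeff 3 X * coeff 1 X) +
      (1 / 24 : ℂ) • (coeff 1 X * coeff 1 X * coeff 1 X * coeff 1 X) ∧
    coeff 5 (formalExp X) = coeff 5 X + (1 / 6 : ℂ) • (coeff 3 X * coeff 1 X * coeff 1 X +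
      coeff 1 X * coeff 3 X * coeff 1 X + coeff 1 X * coeff 1 X * coeff 3 X) +
      (1 / 120 : ℂ) • (coeff 1 X * coeff 1 X * coeff 1 X * coeff 1 X * coeff 1 X) := by
  have h0 := hX 0 Even.zero
  rw [coeff_zero_eq_constantCoeff_apply] at h0
  have h2 := hX 2 (by decide)
  have h4 := hX 4 (by decide)
  refine ⟨?_, ?_, ?_, ?_, ?_⟩ <;>
  · simp only [formalExp, coeff_mk, Finset.sum_range_succ, Finset.sum_range_zero, pow_succ,
      pow_zero,
      one_mul, coeff_mul, Finset.Nat.antidiagonal_succ, Finset.Nat.antidiagonal_zero,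
      Finset.sum_cons, Finset.map_cons, Finset.map_singleton, Finset.sum_singleton, coeff_one,
      Function.Embedding.prodMap, Function.Embedding.coeFn_mk, Prod.map_apply,
      Function.Embedding.refl_apply, Nat.succ_eq_add_one, Nat.reduceAdd, h0, h2, h4,
      coeff_zero_eq_constantCoeff, zero_mul, mul_zero, add_zero, zero_add, Nat.factorial]
    norm_num
    try simp only [smul_add, add_mul]
    try abel

variable {X Y Z : PowerSeries R}

/-- Since `Y` starts at order three, the only nested commutator of total order at most five is the
one with two factors `coeff 1 X` and one factor `coeff 3 Y`. -/
theorem symmetric_bch_of_coeff_one_eq_zero (hX : IsOddSeries X) (hY : IsOddSeries Y)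
    (hZ : IsOddSeries Z) (hY1 : coeff 1 Y = 0)
    (h : formalExp Z = formalExp ((1 / 2 : ℂ) • X) * formalExp Y * formalExp ((1 / 2 : ℂ) • X)) :
    coeff 1 Z = coeff 1 X ∧ coeff 3 Z = coeff 3 X + coeff 3 Y ∧
    coeff 5 Z = coeff 5 X + coeff 5 Y - (1 / 24 : ℂ) • ⁅coeff 1 X, ⁅coeff 1 X, coeff 3 Y⁆⁆ := by
  obtain ⟨x1, x2, x3, x4, x5⟩ := coeff_formalExp_of_odd (hX.smul (1 / 2))
  obtain ⟨y1, y2, y3, y4, y5⟩ := coeff_formalExp_of_odd hY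
  obtain ⟨z1, -, z3, -, z5⟩ := coeff_formalExp_of_odd hZ
  obtain ⟨c1, c3, c5⟩ := coeff_symm_mul (coeff_zero_formalExp ((1 / 2 : ℂ) • X))
    (coeff_zero_formalExp Y)
  rw [← h] at c1 c3 c5
  simp only [x1, x2, x3, x4, x5, y1, y2, y3, y4, y5, z1, z3, z5, coeff_csmul, hY1]
    at c1 c3 c5
  have d1 : coeff 1 Z = coeff 1 X := by rw [c1]; module
  rw [d1] at c3 c5
  have d3 : coeff 3 Z = coeff 3 X + coeff 3 Y := by
    rw [← eq_sub_iff_add_eq] at c3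
    rw [c3]
    simp only [smul_mul_assoc, mul_smul_comm, smul_smul, mul_assoc, mul_zero, zero_mul]
    module
  rw [d3] at c5
  refine ⟨d1, d3, ?_⟩
  rw [add_assoc, ← eq_sub_iff_add_eq] at c5
  rw [c5]
  simp only [Ring.lie_def, smul_mul_assoc, mul_smul_comm, smul_smul, mul_assoc, mul_zero, zero_mul,
    mul_add, add_mul, mul_sub, sub_mul, smul_add, smul_sub]
  module

/-- Up to order five `X` consists of its linear term alone. Comparing the exponential series order
by order determines the coefficients of `Z` successively. With all brackets expanded, what remains
is a linear identity between noncommutative words. -/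
theorem symmetric_bch_of_monomial (hX : IsOddSeries X) (hY : IsOddSeries Y)
    (hZ : IsOddSeries Z) (hX3 : coeff 3 X = 0) (hX5 : coeff 5 X = 0)
    (h : formalExp Z = formalExp ((1 / 2 : ℂ) • X) * formalExp Y * formalExp ((1 / 2 : ℂ) • X)) :
    coeff 1 Z = coeff 1 X + coeff 1 Y ∧
    coeff 3 Z = coeff 3 Y - (1 / 24 : ℂ) • ⁅coeff 1 X, ⁅coeff 1 X, coeff 1 Y⁆⁆
      - (1 / 12 : ℂ) • ⁅coeff 1 Y, ⁅coeff 1 X, coeff 1 Y⁆⁆ ∧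
    coeff 5 Z = coeff 5 Y - (1 / 24 : ℂ) • ⁅coeff 1 X, ⁅coeff 1 X, coeff 3 Y⁆⁆
      - (1 / 12 : ℂ) • ⁅coeff 3 Y, ⁅coeff 1 X, coeff 1 Y⁆⁆
      - (1 / 12 : ℂ) • ⁅coeff 1 Y, ⁅coeff 1 X, coeff 3 Y⁆⁆
      + (7 / 5760 : ℂ) • ⁅coeff 1 X, ⁅coeff 1 X, ⁅coeff 1 X, ⁅coeff 1 X, coeff 1 Y⁆⁆⁆⁆
      + (1 / 360 : ℂ) • ⁅coeff 1 Y, ⁅coeff 1 X, ⁅coeff 1 X, ⁅coeff 1 X, coeff 1 Y⁆⁆⁆⁆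
      + (1 / 480 : ℂ) • ⁅coeff 1 X, ⁅coeff 1 X, ⁅coeff 1 Y, ⁅coeff 1 X, coeff 1 Y⁆⁆⁆⁆
      + (1 / 120 : ℂ) • ⁅coeff 1 Y, ⁅coeff 1 Y, ⁅coeff 1 X, ⁅coeff 1 X, coeff 1 Y⁆⁆⁆⁆
      - (1 / 360 : ℂ) • ⁅coeff 1 X, ⁅coeff 1 Y, ⁅coeff 1 Y, ⁅coeff 1 X, coeff 1 Y⁆⁆⁆⁆
      + (1 / 720 : ℂ) • ⁅coeff 1 Y, ⁅coeff 1 Y, ⁅coeff 1 Y, ⁅coeff 1 X, coeff 1 Y⁆⁆⁆⁆ := by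
  obtain ⟨x1, x2, x3, x4, x5⟩ := coeff_formalExp_of_odd (hX.smul (1 / 2))
  obtain ⟨y1, y2, y3, y4, y5⟩ := coeff_formalExp_of_odd hY
  obtain ⟨z1, -, z3, -, z5⟩ := coeff_formalExp_of_odd hZ
  obtain ⟨c1, c3, c5⟩ := coeff_symm_mul (coeff_zero_formalExp ((1 / 2 : ℂ) • X))
    (coeff_zero_formalExp Y)
  rw [← h] at c1 c3 c5
  simp only [x1, x2, x3, x4, x5, y1, y2, y3, y4, y5, z1, z3, z5, coeff_csmul, hX3, hX5]
    at c1 c3 c5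
  generalize coeff 1 X = x at *
  generalize coeff 1 Y = y at *
  generalize coeff 3 Y = y' at *
  generalize coeff 5 Y = y'' at *
  have d1 : coeff 1 Z = x + y := by rw [c1]; module
  rw [d1] at c3 c5
  rw [← eq_sub_iff_add_eq] at c3
  have d3 : coeff 3 Z = y' - (1 / 24 : ℂ) • ⁅x, ⁅x, y⁆⁆ - (1 / 12 : ℂ) • ⁅y, ⁅x, y⁆⁆ := by
    rw [c3]
    simp only [Ring.lie_def, smul_mul_assoc, mul_smul_comm, smul_smul, mul_assoc,
      mul_add, add_mul, mul_sub, sub_mul, smul_add, smul_sub, smul_zero]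
    module
  refine ⟨d1, d3, ?_⟩
  rw [d3, add_assoc, ← eq_sub_iff_add_eq] at c5
  rw [c5]
  simp only [Ring.lie_def, smul_mul_assoc, mul_smul_comm, smul_smul, mul_assoc, mul_zero,
    zero_mul, mul_add, add_mul, mul_sub, sub_mul, smul_add, smul_sub, smul_zero]
  module

end SymmetricBCH
end MagnusZassenhaus
namespace MagnusZassenhaus

/-! ### Integrals depending smoothly on a parameter -/

section ParametricIntegral

variable {E : Type} [NormedAddCommGroup E] [NormedSpace ℝ E] [ProperSpace E]

/-- Differentiation under the integral sign: the derivative is bounded on the compact product of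
`[0, 1]` with a closed unit ball, and this bound is the dominating function. -/
theorem hasFDerivAt_parametric_integral {F : Type} [NormedAddCommGroup F] [NormedSpace ℝ F]
    [CompleteSpace F] {Φ : ℝ × E → F} (hΦ : ContDiff ℝ 1 Φ) (y : E) :
    HasFDerivAt (fun y => ∫ s in (0 : ℝ)..1, Φ (s, y))
      (∫ s in (0 : ℝ)..1, (fderiv ℝ Φ (s, y)).comp (ContinuousLinearMap.inr ℝ ℝ E)) y := by
  have hc : Continuous fun p : ℝ × E =>
      (fderiv ℝ Φ p).comp (ContinuousLinearMap.inr ℝ ℝ E) :=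
    (hΦ.continuous_fderiv one_ne_zero).clm_comp continuous_const
  obtain ⟨C, hC⟩ := ((isCompact_Icc (a := (0 : ℝ)) (b := 1)).prod
    (isCompact_closedBall y 1)).exists_bound_of_continuousOn hc.continuousOn
  refine intervalIntegral.hasFDerivAt_integral_of_dominated_of_fderiv_le (bound := fun _ => C)
    (s := Metric.closedBall y 1)
    (F' := fun y s => (fderiv ℝ Φ (s, y)).comp (ContinuousLinearMap.inr ℝ ℝ E))
    (Metric.closedBall_mem_nhds y one_pos) ?_ ?_ ?_ ?_ ?_ ?_
  · exact Eventually.of_forall fun y =>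
      (hΦ.continuous.comp (Continuous.prodMk_left y)).aestronglyMeasurable
  · exact (hΦ.continuous.comp (Continuous.prodMk_left y)).intervalIntegrable _ _
  · exact (hc.comp (Continuous.prodMk_left y)).aestronglyMeasurable
  · refine Eventually.of_forall fun s hs z hz => hC (s, z) ⟨?_, hz⟩
    rw [Set.uIoc_of_le zero_le_one] at hs
    exact Set.Ioc_subset_Icc_self hs
  · exact intervalIntegrable_const
  · refine Eventually.of_forall fun s _ z _ => ?_
    have h1 := (hΦ.differentiable one_ne_zero (s, z)).hasFDerivAt
    exact h1.comp z (hasFDerivAt_prodMk_right s z)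

/-- The derivative is again a parametric integral, with values in a space of linear maps. The
induction on the order therefore lets the target space vary. -/
theorem contDiff_parametric_integral {F : Type} [NormedAddCommGroup F] [NormedSpace ℝ F]
    [CompleteSpace F] {Φ : ℝ × E → F} (hΦ : ContDiff ℝ ∞ Φ) :
    ContDiff ℝ ∞ fun y => ∫ s in (0 : ℝ)..1, Φ (s, y) := by
  rw [contDiff_infty]
  intro n
  induction n generalizing F with
  | zero =>
    rw [Nat.cast_zero, contDiff_zero]
    have h : Differentiable ℝ fun y => ∫ s in (0 : ℝ)..1, Φ (s, y) := fun y =>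
      (hasFDerivAt_parametric_integral (hΦ.of_le (by simp)) y).differentiableAt
    exact h.continuous
  | succ n ih =>
    have h := hasFDerivAt_parametric_integral (hΦ.of_le (by simp))
    rw [Nat.cast_add, Nat.cast_one, contDiff_succ_iff_fderiv]
    refine ⟨fun y => (h y).differentiableAt, by simp, ?_⟩
    rw [show fderiv ℝ (fun y => ∫ s in (0 : ℝ)..1, Φ (s, y)) = _ from funext fun y => (h y).fderiv]
    exact ih (Φ := fun p => (fderiv ℝ Φ p).comp (ContinuousLinearMap.inr ℝ ℝ E))
      ((hΦ.fderiv_right (by simp)).clm_comp contDiff_const)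

end ParametricIntegral

/-! ### Smooth periodic families -/

section Families

variable {E : Type} [NormedAddCommGroup E] [NormedSpace ℝ E] {L : ℝ}

variable (E L) in
/-- Families of `L`-periodic functions, depending smoothly on a parameter in `E`. -/
def pfunAlgebra : Subalgebra ℂ (E → ℝ → ℂ) where
  carrier := {f | ContDiff ℝ ∞ (fun p : E × ℝ => f p.1 p.2) ∧ ∀ e, Function.Periodic (f e) L}
  add_mem' hf hg := ⟨hf.1.add hg.1, fun e => (hf.2 e).add (hg.2 e)⟩
  mul_mem' hf hg := ⟨hf.1.mul hg.1, fun e => (hf.2 e).mul (hg.2 e)⟩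
  algebraMap_mem' _ := ⟨contDiff_const, fun _ _ => rfl⟩

variable (E L) in
/-- The type of smooth families of periodic functions. -/
def PFun : Type := pfunAlgebra E L

instance : CommRing (PFun E L) := inferInstanceAs (CommRing (pfunAlgebra E L))

instance : Algebra ℂ (PFun E L) := inferInstanceAs (Algebra ℂ (pfunAlgebra E L))

/-- The underlying function of two variables. -/
def PFun.val (f : PFun E L) : E → ℝ → ℂ := Subtype.val f

instance : CoeFun (PFun E L) fun _ => E → ℝ → ℂ := ⟨PFun.val⟩

/-- The family given by a smooth periodic function. -/
def PFun.mk (f : E → ℝ → ℂ) (hf : ContDiff ℝ ∞ (fun p : E × ℝ => f p.1 p.2))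
    (hp : ∀ e, Function.Periodic (f e) L) : PFun E L :=
  (⟨f, hf, hp⟩ : pfunAlgebra E L)

@[simp] theorem PFun.add_apply (f g : PFun E L) (e : E) (x : ℝ) : (f + g) e x = f e x + g e x := rfl

@[simp] theorem PFun.sub_apply (f g : PFun E L) (e : E) (x : ℝ) : (f - g) e x = f e x - g e x := rfl

@[simp] theorem PFun.neg_apply (f : PFun E L) (e : E) (x : ℝ) : (-f) e x = -f e x := rfl

@[simp] theorem PFun.mul_apply (f g : PFun E L) (e : E) (x : ℝ) : (f * g) e x = f e x * g e x := rfl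

@[simp] theorem PFun.smul_apply (c : ℂ) (f : PFun E L) (e : E) (x : ℝ) :
    (c • f) e x = c * f e x := rfl

@[simp] theorem PFun.zero_apply (e : E) (x : ℝ) : (0 : PFun E L) e x = 0 := rfl

@[simp] theorem PFun.one_apply (e : E) (x : ℝ) : (1 : PFun E L) e x = 1 := rfl

@[simp] theorem PFun.algebraMap_apply (c : ℂ) (e : E) (x : ℝ) :
    (algebraMap ℂ (PFun E L) c) e x = c := rfl

@[simp] theorem PFun.pow_apply (f : PFun E L) (n : ℕ) (e : E) (x : ℝ) :
    (f ^ n) e x = f e x ^ n := rfl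

theorem PFun.contDiff (f : PFun E L) : ContDiff ℝ ∞ (fun p : E × ℝ => f p.1 p.2) :=
  Subtype.property f |>.1

theorem PFun.periodic (f : PFun E L) (e : E) : Function.Periodic (f e) L := (Subtype.property f).2 e

theorem PFun.contDiff_slice (f : PFun E L) (e : E) : ContDiff ℝ ∞ (f e) :=
  f.contDiff.comp (contDiff_const.prodMk contDiff_id)

theorem PFun.differentiable_slice (f : PFun E L) (e : E) : Differentiable ℝ (f e) :=
  (f.contDiff_slice e).differentiable (by simp)

@[ext] theorem PFun.ext {f g : PFun E L} (h : ∀ e x, f e x = g e x) : f = g :=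
  Subtype.ext (funext fun e => funext fun x => h e x)

/-- The derivative in the space variable, as a function. -/
def PFun.deriv (f : PFun E L) : PFun E L := PFun.mk (fun e => _root_.deriv (f e)) (by
    have h : (fun p : E × ℝ => _root_.deriv (f p.1) p.2) =
        fun p => fderiv ℝ (fun p : E × ℝ => f p.1 p.2) p ((0 : E), (1 : ℝ)) := by
      funext p
      have h1 : HasFDerivAt (fun p : E × ℝ => f p.1 p.2) _ (p.1, p.2) :=
        (f.contDiff.differentiable (by simp) p).hasFDerivAt
      have h2 := h1.comp p.2 (hasFDerivAt_prodMk_right p.1 p.2)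
      have h3 : _root_.deriv (f p.1) p.2 = _ := h2.hasDerivAt.deriv
      simpa using h3
    rw [h]
    exact (f.contDiff.fderiv_right (m := ∞) (by simp)).clm_apply contDiff_const) (by
    intro e x
    have h : (fun y => f e (y + L)) = f e := funext fun y => f.periodic e y
    have h2 := deriv_comp_add_const (f e) L x
    rw [h] at h2
    exact h2.symm)

/-- The derivative in the space variable. -/
def δ : Derivation ℂ (PFun E L) (PFun E L) := Derivation.mk'
  { toFun := PFun.deriv
    map_add' := fun f g => by
      ext e x
      exact deriv_add (f.differentiable_slice e x) (g.differentiable_slice e x)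
    map_smul' := fun c f => by
      ext e x
      exact deriv_const_smul c (f.differentiable_slice e x) }
  fun f g => by
    ext e x
    have := deriv_mul (f.differentiable_slice e x) (g.differentiable_slice e x)
    change deriv (f e * g e) x = f e x * deriv (g e) x + g e x * deriv (f e) x
    rw [this]; ring

theorem δ_apply (f : PFun E L) (e : E) (x : ℝ) : (δ f) e x = deriv (f e) x := rfl

theorem δ_iterate_apply (f : PFun E L) (k : ℕ) (e : E) :
    ((⇑(δ : Derivation ℂ (PFun E L) (PFun E L)))^[k] f) e = iteratedDeriv k (f e) := by
  induction k with
  | zero => simp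
  | succ k ih =>
    rw [Function.iterate_succ_apply', iteratedDeriv_succ, ← ih]; rfl

/-- Change of parameter. -/
def PFun.comap {E' : Type} [NormedAddCommGroup E'] [NormedSpace ℝ E'] (φ : E' → E)
    (hφ : ContDiff ℝ ∞ φ) : PFun E L →ₐ[ℂ] PFun E' L where
  toFun f := PFun.mk (fun e => f (φ e)) (f.contDiff.comp
    ((hφ.comp contDiff_fst).prodMk contDiff_snd) :) fun e => f.periodic (φ e)
  map_one' := rfl
  map_mul' _ _ := rfl
  map_zero' := rfl
  map_add' _ _ := rfl
  commutes' _ := rfl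

theorem PFun.comap_apply {E' : Type} [NormedAddCommGroup E'] [NormedSpace ℝ E'] (φ : E' → E)
    (hφ : ContDiff ℝ ∞ φ) (f : PFun E L) (e : E') (x : ℝ) :
    (PFun.comap φ hφ f) e x = f (φ e) x := rfl

/-- Integration over a parameter in the unit interval. -/
def PFun.integral [ProperSpace E] (f : PFun (ℝ × E) L) : PFun E L :=
  PFun.mk (fun e x => ∫ s in (0 : ℝ)..1, f (s, e) x)
    (contDiff_parametric_integral (E := E × ℝ) (Φ := fun q => f (q.1, q.2.1) q.2.2)
        (f.contDiff.comp ((contDiff_fst.prodMk (contDiff_fst.comp contDiff_snd)).prodMk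
          (contDiff_snd.comp contDiff_snd))))
    (by
      intro e x
      simp only [f.periodic _ x])

theorem PFun.integral_apply [ProperSpace E] (f : PFun (ℝ × E) L) (e : E) (x : ℝ) :
    f.integral e x = ∫ s in (0 : ℝ)..1, f (s, e) x := rfl

theorem PFun.continuous_param (f : PFun (ℝ × E) L) (e : E) (x : ℝ) :
    Continuous fun s : ℝ => f (s, e) x :=
  f.contDiff.continuous.comp (by fun_prop : Continuous fun s : ℝ => ((s, e), x))

end Families
end MagnusZassenhaus
namespace MagnusZassenhaus

/-! ### Taylor series in the time step -/

section Taylor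

variable {L : ℝ}

variable (L) in
/-- Coefficient functions depending on the midpoint. -/
abbrev CoeffFun := PFun ℝ L

variable (L) in
/-- Functions depending on the time step and the midpoint. -/
abbrev StepFun := PFun (ℝ × ℝ) L

/-- The time step. -/
def stepVar : StepFun L := PFun.mk (fun p _ => (p.1 : ℂ))
  (Complex.ofRealCLM.contDiff.comp (contDiff_fst.comp contDiff_fst)) fun _ _ => rfl

@[simp] theorem stepVar_apply (p : ℝ × ℝ) (x : ℝ) : (stepVar : StepFun L) p x = p.1 := rfl

/-- Functions not depending on the time step. -/
def constStep : CoeffFun L →ₐ[ℂ] StepFun L := PFun.comap Prod.snd contDiff_snd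

@[simp] theorem constStep_apply (f : CoeffFun L) (p : ℝ × ℝ) (x : ℝ) :
    constStep f p x = f p.2 x := rfl

/-- The value at time step zero. -/
def atZero : StepFun L →ₐ[ℂ] CoeffFun L :=
  PFun.comap (fun t => (0, t)) (contDiff_const.prodMk contDiff_id)

theorem atZero_apply (f : StepFun L) (t x : ℝ) : atZero f t x = f (0, t) x := rfl

@[simp] theorem atZero_constStep (f : CoeffFun L) : atZero (constStep f) = f := rfl

@[simp] theorem atZero_stepVar : atZero (stepVar : StepFun L) = 0 := by
  ext t x; simp [atZero_apply]

theorem δ_stepVar : δ (stepVar : StepFun L) = 0 := by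
  ext e x
  rw [δ_apply]
  exact deriv_const x (e.1 : ℂ)

/-- For `h ≠ 0` one divides. The set of these `h` is dense and both sides are continuous. -/
theorem stepVar_mul_cancel {f g : StepFun L} (h : stepVar * f = stepVar * g) : f = g := by
  ext ⟨a, t⟩ x
  have hc : ∀ f : StepFun L, Continuous fun a : ℝ => f (a, t) x := fun f =>
    f.contDiff.continuous.comp (by fun_prop : Continuous fun a : ℝ => ((a, t), x))
  have h1 : Set.EqOn (fun a : ℝ => f (a, t) x) (fun a => g (a, t) x) {0}ᶜ := fun b hb => by
    have h2 : (stepVar * f : StepFun L) (b, t) x = (stepVar * g : StepFun L) (b, t) x := by rw [h]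
    simp only [PFun.mul_apply, stepVar_apply] at h2
    exact mul_left_cancel₀ (by exact_mod_cast hb) h2
  exact congrFun ((hc f).ext_on (dense_compl_singleton 0) (hc g) h1) a

/-- The derivative in the time step. -/
def stepDeriv (f : StepFun L) : StepFun L :=
  PFun.mk (fun p x => fderiv ℝ (fun q : (ℝ × ℝ) × ℝ => f q.1 q.2) (p, x) ((1, 0), 0))
    ((f.contDiff.fderiv_right (m := ∞) (by simp)).clm_apply contDiff_const)
    (by
      intro e x
      have h : (fun q : (ℝ × ℝ) × ℝ => f (q + (0, L)).1 (q + (0, L)).2) =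
          fun q : (ℝ × ℝ) × ℝ => f q.1 q.2 := by
        funext q
        simpa using f.periodic q.1 q.2
      have h2 := fderiv_comp_add_right (𝕜 := ℝ) (f := fun q : (ℝ × ℝ) × ℝ => f q.1 q.2)
        (x := (e, x)) (0, L)
      rw [h] at h2
      simp only [Prod.mk_add_mk, add_zero] at h2
      change (fderiv ℝ _ (e, x + L)) _ = (fderiv ℝ _ (e, x)) _
      rw [← h2])

theorem hasDerivAt_step (f : StepFun L) (a t x : ℝ) :
    HasDerivAt (fun a => f (a, t) x) (stepDeriv f (a, t) x) a := by
  have h1 := (f.contDiff.differentiable (by simp) ((a, t), x)).hasFDerivAt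
  have h2 : HasDerivAt (fun a : ℝ => ((a, t), x)) ((1, 0), 0) a :=
    ((hasDerivAt_id a).prodMk (hasDerivAt_const a t)).prodMk (hasDerivAt_const a x)
  exact h1.comp_hasDerivAt a h2

/-- The quotient `(f - f₀) / h`. -/
def hadamard (f : StepFun L) : StepFun L :=
  (PFun.comap (fun q : ℝ × (ℝ × ℝ) => (q.1 * q.2.1, q.2.2))
    (by fun_prop) (stepDeriv f)).integral

/-- The fundamental theorem of calculus for `s ↦ f (s h)` on `[0, 1]`. -/
theorem hadamard_spec (f : StepFun L) : f = constStep (atZero f) + stepVar * hadamard f := by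
  ext ⟨a, t⟩ x
  simp only [PFun.add_apply, PFun.mul_apply, constStep_apply, atZero_apply, stepVar_apply]
  rw [hadamard, PFun.integral_apply]
  simp only [PFun.comap_apply]
  have hd : ∀ s ∈ Set.uIcc (0 : ℝ) 1, HasDerivAt (fun s : ℝ => f (s * a, t) x)
      ((a : ℂ) * stepDeriv f (s * a, t) x) s := fun s _ => by
    have h := (hasDerivAt_step f (s * a) t x).scomp s ((hasDerivAt_id s).mul_const a)
    simpa [Function.comp_def] using h
  have hi : IntervalIntegrable (fun s : ℝ => (a : ℂ) * stepDeriv f (s * a, t) x)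
      MeasureTheory.volume 0 1 :=
    (continuous_const.mul ((stepDeriv f).contDiff.continuous.comp
      (by fun_prop : Continuous fun s : ℝ => ((s * a, t), x)))).intervalIntegrable _ _
  have := intervalIntegral.integral_eq_sub_of_hasDerivAt hd hi
  rw [intervalIntegral.integral_const_mul] at this
  rw [this]
  simp

/-- This reduces the rules for `hadamard` to algebra: it is enough to exhibit a decomposition of the
right form. -/
theorem hadamard_unique {f g : StepFun L} {c : CoeffFun L} (h : f = constStep c + stepVar * g) :
    c = atZero f ∧ g = hadamard f := by
  have h0 : c = atZero f := by rw [h]; simp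
  refine ⟨h0, stepVar_mul_cancel ?_⟩
  have h1 := hadamard_spec f
  rw [← h0] at h1
  exact add_left_cancel (h.symm.trans h1)

theorem hadamard_add (f g : StepFun L) : hadamard (f + g) = hadamard f + hadamard g := by
  refine (hadamard_unique (c := atZero f + atZero g) ?_).2.symm
  conv_lhs => rw [hadamard_spec f, hadamard_spec g]
  rw [map_add]; ring

/-- The asymmetric form, with `f` frozen at step zero in one term, is the recursion that a Cauchy
product satisfies when its first summand is split off. This is what `taylorCoeff_mul` needs. -/
theorem hadamard_mul (f g : StepFun L) :
    hadamard (f * g) = constStep (atZero f) * hadamard g + hadamard f * g := by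
  refine (hadamard_unique (c := atZero f * atZero g) ?_).2.symm
  have h : f * g = constStep (atZero f) * (constStep (atZero g) + stepVar * hadamard g)
      + stepVar * hadamard f * g := by
    conv_lhs => rw [hadamard_spec f]
    rw [add_mul, ← hadamard_spec g]
  rw [h, map_mul]; ring

theorem hadamard_constStep (c : CoeffFun L) : hadamard (constStep c) = 0 :=
  (hadamard_unique (c := c) (by rw [mul_zero, add_zero])).2.symm

theorem hadamard_stepVar : hadamard (stepVar : StepFun L) = 1 :=
  (hadamard_unique (c := 0) (by rw [map_zero, mul_one, zero_add])).2.symm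

theorem hadamard_stepVar_mul (f : StepFun L) : hadamard (stepVar * f) = f :=
  (hadamard_unique (c := 0) (by rw [map_zero, zero_add])).2.symm

theorem hadamard_δ (f : StepFun L) : hadamard (δ f) = δ (hadamard f) := by
  refine (hadamard_unique (c := δ (atZero f)) ?_).2.symm
  conv_lhs => rw [hadamard_spec f]
  rw [map_add, Derivation.leibniz, δ_stepVar]
  simp only [smul_eq_mul, mul_zero, add_zero]
  rfl

/-- The Taylor coefficients in the time step. -/
def taylorCoeff : ℕ → StepFun L → CoeffFun L
  | 0, f => atZero f
  | n + 1, f => taylorCoeff n (hadamard f)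

theorem taylorCoeff_zero (f : StepFun L) : taylorCoeff 0 f = atZero f := rfl

theorem taylorCoeff_succ (n : ℕ) (f : StepFun L) :
    taylorCoeff (n + 1) f = taylorCoeff n (hadamard f) := rfl

theorem taylorCoeff_add (n : ℕ) (f g : StepFun L) :
    taylorCoeff n (f + g) = taylorCoeff n f + taylorCoeff n g := by
  induction n generalizing f g with
  | zero => exact map_add _ _ _
  | succ n ih => rw [taylorCoeff_succ, hadamard_add, ih]; rfl

theorem taylorCoeff_constStep (n : ℕ) (c : CoeffFun L) :
    taylorCoeff n (constStep c) = if n = 0 then c else 0 := by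
  induction n generalizing c with
  | zero => rfl
  | succ n ih =>
    rw [taylorCoeff_succ, hadamard_constStep, ← map_zero constStep, ih]; simp

theorem taylorCoeff_constStep_mul (n : ℕ) (c : CoeffFun L) (f : StepFun L) :
    taylorCoeff n (constStep c * f) = c * taylorCoeff n f := by
  induction n generalizing c f with
  | zero => simp [taylorCoeff_zero]
  | succ n ih =>
    rw [taylorCoeff_succ, hadamard_mul, hadamard_constStep, zero_mul, add_zero, atZero_constStep,
      ih]; rfl

theorem taylorCoeff_mul (n : ℕ) (f g : StepFun L) :
    taylorCoeff n (f * g) = ∑ p ∈ Finset.HasAntidiagonal.antidiagonal n,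
      taylorCoeff p.1 f * taylorCoeff p.2 g := by
  induction n generalizing f g with
  | zero => simp [taylorCoeff_zero]
  | succ n ih =>
    rw [taylorCoeff_succ, hadamard_mul, taylorCoeff_add, taylorCoeff_constStep_mul, ih,
      Finset.Nat.sum_antidiagonal_succ]
    rfl

/-- The Taylor series in the time step. -/
def taylor : StepFun L →ₐ[ℂ] PowerSeries (CoeffFun L) where
  toFun f := PowerSeries.mk fun n => taylorCoeff n f
  map_one' := by
    ext1 n
    rw [PowerSeries.coeff_mk, ← map_one constStep, taylorCoeff_constStep, PowerSeries.coeff_one]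
  map_mul' f g := by
    ext1 n
    rw [PowerSeries.coeff_mk, taylorCoeff_mul, PowerSeries.coeff_mul]
    simp only [PowerSeries.coeff_mk]
  map_zero' := by
    ext1 n
    rw [PowerSeries.coeff_mk, ← map_zero constStep, taylorCoeff_constStep]; simp
  map_add' f g := by
    ext1 n
    rw [PowerSeries.coeff_mk, taylorCoeff_add, map_add, PowerSeries.coeff_mk, PowerSeries.coeff_mk]
  commutes' c := by
    ext1 n
    rw [PowerSeries.coeff_mk, ← constStep.commutes c, taylorCoeff_constStep,
      PowerSeries.algebraMap_apply, PowerSeries.coeff_C]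

theorem coeff_taylor (n : ℕ) (f : StepFun L) :
    PowerSeries.coeff n (taylor f) = taylorCoeff n f :=
  PowerSeries.coeff_mk n fun n => taylorCoeff n f

theorem coeff_zero_taylor (f : StepFun L) : PowerSeries.coeff 0 (taylor f) = atZero f :=
  coeff_taylor 0 f

theorem coeff_succ_taylor (n : ℕ) (f : StepFun L) :
    PowerSeries.coeff (n + 1) (taylor f) = PowerSeries.coeff n (taylor (hadamard f)) := by
  rw [coeff_taylor, coeff_taylor, taylorCoeff_succ]

theorem taylor_stepVar : taylor (stepVar : StepFun L) = PowerSeries.X := by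
  ext1 n
  cases n with
  | zero => rw [coeff_zero_taylor, atZero_stepVar, PowerSeries.coeff_zero_X]
  | succ n =>
    rw [coeff_succ_taylor, hadamard_stepVar, map_one, PowerSeries.coeff_one, PowerSeries.coeff_X]
    simp

theorem coeff_taylor_δ (n : ℕ) (f : StepFun L) :
    PowerSeries.coeff n (taylor (δ f)) = δ (PowerSeries.coeff n (taylor f)) := by
  induction n generalizing f with
  | zero => rw [coeff_zero_taylor, coeff_zero_taylor]; rfl
  | succ n ih => rw [coeff_succ_taylor, hadamard_δ, ih, coeff_succ_taylor]

theorem coeff_taylor_δ_iterate (n k : ℕ) (f : StepFun L) :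
    PowerSeries.coeff n (taylor (δ^[k] f)) = δ^[k] (PowerSeries.coeff n (taylor f)) := by
  induction k with
  | zero => rfl
  | succ k ih => rw [Function.iterate_succ_apply', Function.iterate_succ_apply', coeff_taylor_δ, ih]

theorem taylor_expansion (f : StepFun L) (N : ℕ) :
    f = (∑ n ∈ Finset.range N, constStep (PowerSeries.coeff n (taylor f)) * stepVar ^ n)
      + stepVar ^ N * hadamard^[N] f := by
  induction N generalizing f with
  | zero => simp
  | succ N ih =>
    rw [Finset.sum_range_succ', coeff_zero_taylor]
    simp only [coeff_succ_taylor, pow_succ, ← mul_assoc]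
    rw [← Finset.sum_mul]
    conv_lhs => rw [hadamard_spec f, ih (hadamard f)]
    rw [Function.iterate_succ_apply]
    ring

/-- Vanishing Taylor coefficients become an exact factor `h ^ N` with a smooth cofactor, which is
the form needed for the size estimates. -/
theorem stepVar_pow_dvd_iff {f : StepFun L} {N : ℕ} :
    stepVar ^ N ∣ f ↔ ∀ n < N, PowerSeries.coeff n (taylor f) = 0 := by
  constructor
  · rintro ⟨g, rfl⟩ n hn
    rw [map_mul, map_pow, taylor_stepVar, PowerSeries.coeff_X_pow_mul', if_neg (by omega)]
  · intro h
    refine ⟨hadamard^[N] f, ?_⟩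
    conv_lhs => rw [taylor_expansion f N]
    rw [Finset.sum_eq_zero, zero_add]
    intro n hn
    rw [h n (Finset.mem_range.1 hn), map_zero, zero_mul]

/-- The reflection of the time step. -/
def reflectStep : StepFun L →ₐ[ℂ] StepFun L :=
  PFun.comap (fun p => (-p.1, p.2)) (by fun_prop)

@[simp] theorem reflectStep_apply (f : StepFun L) (h t x : ℝ) :
    reflectStep f (h, t) x = f (-h, t) x := rfl

theorem coeff_taylor_reflectStep (n : ℕ) (f : StepFun L) :
    PowerSeries.coeff n (taylor (reflectStep f)) =
      (-1 : ℂ) ^ n • PowerSeries.coeff n (taylor f) := by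
  induction n generalizing f with
  | zero =>
    rw [coeff_zero_taylor, coeff_zero_taylor, pow_zero, one_smul]
    ext t x; simp [atZero_apply]
  | succ n ih =>
    have h : hadamard (reflectStep f) = -reflectStep (hadamard f) := by
      refine (hadamard_unique (c := atZero f) ?_).2.symm
      have h1 := congrArg reflectStep (hadamard_spec f)
      have h2 : reflectStep (stepVar : StepFun L) = -stepVar := by
        ext ⟨a, t⟩ x; simp
      rw [map_add, map_mul, h2] at h1
      rw [h1, mul_neg, neg_mul]; rfl
    rw [coeff_succ_taylor, h, map_neg, map_neg, ih, coeff_succ_taylor, pow_succ, mul_neg_one,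
      neg_smul]

/-! ### Weighted integrals -/

section Integral

variable {E : Type} [NormedAddCommGroup E] [NormedSpace ℝ E] [ProperSpace E]

theorem PFun.integral_add (f g : PFun (ℝ × E) L) : (f + g).integral = f.integral + g.integral := by
  ext e x
  exact intervalIntegral.integral_add ((f.continuous_param e x).intervalIntegrable _ _)
    ((g.continuous_param e x).intervalIntegrable _ _)

theorem PFun.integral_comap_mul (c : PFun E L) (f : PFun (ℝ × E) L) :
    (PFun.comap Prod.snd contDiff_snd c * f).integral = c * f.integral := by
  ext e x
  exact intervalIntegral.integral_const_mul (c e x) fun s => f (s, e) x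

end Integral

/-- Functions of `r`, `s`, the time step and the midpoint. -/
abbrev lift₂ : StepFun L →ₐ[ℂ] PFun (ℝ × (ℝ × (ℝ × ℝ))) L :=
  (PFun.comap Prod.snd contDiff_snd).comp (PFun.comap Prod.snd contDiff_snd)

theorem integral_lift₂_mul (c : StepFun L) (f : PFun (ℝ × (ℝ × (ℝ × ℝ))) L) :
    (lift₂ c * f).integral.integral = c * f.integral.integral := by
  rw [AlgHom.comp_apply, PFun.integral_comap_mul, PFun.integral_comap_mul]

/-- A weight depending on `s` and `r`. -/
def weightFun (w : ℝ × ℝ → ℝ) (hw : ContDiff ℝ ∞ w) : PFun (ℝ × (ℝ × (ℝ × ℝ))) L :=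
  PFun.mk (fun (q : ℝ × (ℝ × (ℝ × ℝ))) _ => (w (q.2.1, q.1) : ℂ))
    (Complex.ofRealCLM.contDiff.comp (hw.comp (by fun_prop))) (fun _ _ => rfl)

theorem weightFun_apply (w : ℝ × ℝ → ℝ) (hw : ContDiff ℝ ∞ w) (q : ℝ × (ℝ × (ℝ × ℝ))) (x : ℝ) :
    (weightFun w hw : PFun _ L) q x = w (q.2.1, q.1) := rfl

/-- The substitution of the outer time variable. -/
def outerVar : StepFun L →ₐ[ℂ] PFun (ℝ × (ℝ × (ℝ × ℝ))) L :=
  PFun.comap (fun q : ℝ × (ℝ × (ℝ × ℝ)) => (q.2.2.1 * (q.2.1 - 1 / 2), q.2.2.2)) (by fun_prop)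

/-- The substitution of the inner time variable. -/
def innerVar : StepFun L →ₐ[ℂ] PFun (ℝ × (ℝ × (ℝ × ℝ))) L :=
  PFun.comap (fun q : ℝ × (ℝ × (ℝ × ℝ)) => (q.2.2.1 * (q.2.1 * q.1 - 1 / 2), q.2.2.2))
    (by fun_prop)

/-- The double integral `∫₀¹ ∫₀¹ w(s,r) f(h(s-½)) g(h(sr-½)) dr ds`. -/
def weighted (w : ℝ × ℝ → ℝ) (hw : ContDiff ℝ ∞ w) (f g : StepFun L) : StepFun L :=
  (weightFun w hw * outerVar f * innerVar g).integral.integral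

theorem weighted_apply (w : ℝ × ℝ → ℝ) (hw : ContDiff ℝ ∞ w) (f g : StepFun L) (h t x : ℝ) :
    weighted w hw f g (h, t) x = ∫ s in (0 : ℝ)..1, ∫ r in (0 : ℝ)..1,
      (w (s, r) : ℂ) * f (h * (s - 1 / 2), t) x * g (h * (s * r - 1 / 2), t) x := rfl

/-- The moments of a weight. -/
def moment (w : ℝ × ℝ → ℝ) (k l : ℕ) : ℝ :=
  ∫ s in (0 : ℝ)..1, ∫ r in (0 : ℝ)..1, w (s, r) * (s - 1 / 2) ^ k * (s * r - 1 / 2) ^ l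

/-- Multiplication of a weight by the outer variable. -/
def outerWeight (w : ℝ × ℝ → ℝ) : ℝ × ℝ → ℝ := fun p => w p * (p.1 - 1 / 2)

/-- Multiplication of a weight by the inner variable. -/
def innerWeight (w : ℝ × ℝ → ℝ) : ℝ × ℝ → ℝ := fun p => w p * (p.1 * p.2 - 1 / 2)

theorem contDiff_outerWeight (w : ℝ × ℝ → ℝ) (hw : ContDiff ℝ ∞ w) :
    ContDiff ℝ ∞ (outerWeight w) := by
  unfold outerWeight; fun_prop

theorem contDiff_innerWeight (w : ℝ × ℝ → ℝ) (hw : ContDiff ℝ ∞ w) :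
    ContDiff ℝ ∞ (innerWeight w) := by
  unfold innerWeight; fun_prop

variable (w : ℝ × ℝ → ℝ) (hw : ContDiff ℝ ∞ w)

theorem moment_outerWeight (k l : ℕ) : moment (outerWeight w) k l = moment w (k + 1) l := by
  simp only [moment, outerWeight, pow_succ']
  congr! 4; ring

theorem moment_innerWeight (l : ℕ) : moment (innerWeight w) 0 l = moment w 0 (l + 1) := by
  simp only [moment, innerWeight, pow_succ', pow_zero]
  congr! 4; ring

/-- The outer argument is `h (s - 1/2)`. A factor of the step inside `f` therefore comes out as `h`
and leaves `s - 1/2` in the weight, which raises the first index of the moments. -/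
theorem weighted_const_add (a : CoeffFun L) (f g : StepFun L) :
    weighted w hw (constStep a + stepVar * f) g = constStep a * weighted w hw 1 g +
      stepVar * weighted (outerWeight w) (contDiff_outerWeight w hw) f g := by
  have e : weightFun w hw * outerVar (constStep a + stepVar * f) * innerVar g =
      lift₂ (constStep a) * (weightFun w hw * outerVar 1 * innerVar g) +
      lift₂ stepVar * (weightFun (outerWeight w) (contDiff_outerWeight w hw) * outerVar f
        * innerVar g) := by
    have h1 : outerVar (constStep a) = lift₂ (constStep a) := rfl
    have h2 : weightFun w hw * outerVar (stepVar : StepFun L) =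
        lift₂ stepVar * weightFun (outerWeight w) (contDiff_outerWeight w hw) := by
      ext q x
      simp [weightFun_apply, outerVar, PFun.comap_apply, outerWeight]
      ring
    rw [map_add, map_mul, h1, map_one]
    linear_combination outerVar f * innerVar g * h2
  rw [weighted, e, PFun.integral_add, PFun.integral_add, integral_lift₂_mul, integral_lift₂_mul]
  rfl

theorem weighted_one_const_add (a : CoeffFun L) (g : StepFun L) :
    weighted w hw 1 (constStep a + stepVar * g) = constStep a * weighted w hw 1 1 +
      stepVar * weighted (innerWeight w) (contDiff_innerWeight w hw) 1 g := by
  have e : weightFun w hw * outerVar 1 * innerVar (constStep a + stepVar * g) =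
      lift₂ (constStep a) * (weightFun w hw * outerVar 1 * innerVar 1) +
      lift₂ stepVar * (weightFun (innerWeight w) (contDiff_innerWeight w hw) * outerVar 1
        * innerVar g) := by
    have h1 : innerVar (constStep a) = lift₂ (constStep a) := rfl
    have h2 : weightFun w hw * innerVar (stepVar : StepFun L) =
        lift₂ stepVar * weightFun (innerWeight w) (contDiff_innerWeight w hw) := by
      ext q x
      simp [weightFun_apply, innerVar, PFun.comap_apply, innerWeight]
      ring
    rw [map_add, map_mul, h1, map_one, map_one]
    linear_combination innerVar g * h2
  rw [weighted, e, PFun.integral_add, PFun.integral_add, integral_lift₂_mul, integral_lift₂_mul]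
  rfl

theorem atZero_weighted (f g : StepFun L) :
    atZero (weighted w hw f g) = (moment w 0 0 : ℂ) • (atZero f * atZero g) := by
  ext t x
  rw [atZero_apply, weighted_apply]
  simp only [zero_mul, PFun.smul_apply, PFun.mul_apply, atZero_apply, mul_assoc,
    intervalIntegral.integral_mul_const, intervalIntegral.integral_ofReal, moment, pow_zero,
    mul_one]

theorem weighted_one_one :
    weighted w hw 1 1 = (constStep (algebraMap ℂ (CoeffFun L) (moment w 0 0))) := by
  ext p x
  rw [weighted_apply w hw 1 1 p.1 p.2]
  simp only [PFun.one_apply, mul_one, intervalIntegral.integral_ofReal, constStep_apply,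
    PFun.algebraMap_apply, moment, pow_zero]

theorem taylorCoeff_weighted_one (n : ℕ) (g : StepFun L) :
    taylorCoeff n (weighted w hw 1 g) = (moment w 0 n : ℂ) • taylorCoeff n g := by
  induction n generalizing w g with
  | zero =>
    rw [taylorCoeff_zero, atZero_weighted, map_one, one_mul]; rfl
  | succ n ih =>
    have h := weighted_one_const_add w hw (atZero g) (hadamard g)
    rw [← hadamard_spec g, weighted_one_one, ← map_mul] at h
    rw [taylorCoeff_succ, ← (hadamard_unique h).2, ih, moment_innerWeight]; rfl

/-- Formally, `f` and `g` are expanded in powers of their arguments and integrated termwise. The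
induction strips the Taylor coefficients of `f` one at a time; each constant reduces to the case `f
= 1`, where those of `g` have been stripped in the same way. -/
theorem taylorCoeff_weighted (n : ℕ) (f g : StepFun L) :
    taylorCoeff n (weighted w hw f g) = ∑ p ∈ Finset.HasAntidiagonal.antidiagonal n,
      (moment w p.1 p.2 : ℂ) • (taylorCoeff p.1 f * taylorCoeff p.2 g) := by
  induction n generalizing w f with
  | zero => simp [taylorCoeff_zero, atZero_weighted]
  | succ n ih =>
    have h := weighted_const_add w hw (atZero f) (hadamard f) g
    rw [← hadamard_spec f] at h
    rw [h, taylorCoeff_add, taylorCoeff_constStep_mul, taylorCoeff_weighted_one,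
      taylorCoeff_succ n (stepVar * _), hadamard_stepVar_mul, ih, Finset.Nat.sum_antidiagonal_succ,
      mul_smul_comm]
    simp only [moment_outerWeight]
    rfl

end Taylor
end MagnusZassenhaus
namespace MagnusZassenhaus

/-! ### Operators on smooth periodic functions -/

section Operators

variable {L : ℝ}

theorem PerSmooth.contDiff (u : PerSmooth L) : ContDiff ℝ ∞ (u : ℝ → ℂ) := u.2.1

theorem PerSmooth.differentiable (u : PerSmooth L) : Differentiable ℝ (u : ℝ → ℂ) :=
  (PerSmooth.contDiff u).differentiable (by simp)

theorem periodic_deriv {f : ℝ → ℂ} (h : Function.Periodic f L) : Function.Periodic (deriv f) L := by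
  intro x
  have h1 : (fun y => f (y + L)) = f := funext h
  have h2 := deriv_comp_add_const f L x
  rw [h1] at h2
  exact h2.symm

/-- Differentiation. -/
def derivEnd : Module.End ℂ (PerSmooth L) where
  toFun u := ⟨deriv (u : ℝ → ℂ),
    (contDiff_infty_iff_deriv.1 (PerSmooth.contDiff u)).2, periodic_deriv u.2.2⟩
  map_add' u v := Subtype.ext <| funext fun x =>
    deriv_add (PerSmooth.differentiable u x) (PerSmooth.differentiable v x)
  map_smul' c u := Subtype.ext <| funext fun x =>
    deriv_const_smul c (PerSmooth.differentiable u x)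

theorem derivEnd_apply (u : PerSmooth L) : (derivEnd u : ℝ → ℂ) = deriv (u : ℝ → ℂ) := rfl

theorem derivEnd_pow_apply (k : ℕ) (u : PerSmooth L) :
    ((derivEnd ^ k) u : ℝ → ℂ) = iteratedDeriv k (u : ℝ → ℂ) := by
  induction k with
  | zero => simp
  | succ k ih =>
    rw [pow_succ', Module.End.mul_apply, derivEnd_apply, ih, iteratedDeriv_succ]

variable {E : Type} [NormedAddCommGroup E] [NormedSpace ℝ E]

/-- Multiplication by a member of a family of functions. -/
def mulEnd (e : E) : PFun E L →ₐ[ℂ] Module.End ℂ (PerSmooth L) where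
  toFun f :=
    { toFun := fun u => ⟨fun x => f e x * (u : ℝ → ℂ) x,
        (f.contDiff_slice e).mul (PerSmooth.contDiff u), (f.periodic e).mul u.2.2⟩
      map_add' := fun _ _ => Subtype.ext <| funext fun _ => mul_add _ _ _
      map_smul' := fun _ _ => Subtype.ext <| funext fun _ => mul_left_comm _ _ _ }
  map_one' := LinearMap.ext fun _ => Subtype.ext <| funext fun _ => one_mul _
  map_mul' _ _ := LinearMap.ext fun _ => Subtype.ext <| funext fun _ => mul_assoc _ _ _
  map_zero' := LinearMap.ext fun _ => Subtype.ext <| funext fun _ => zero_mul _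
  map_add' _ _ := LinearMap.ext fun _ => Subtype.ext <| funext fun _ => add_mul _ _ _
  commutes' _ := LinearMap.ext fun _ => rfl

theorem mulEnd_apply (e : E) (f : PFun E L) (u : PerSmooth L) (x : ℝ) :
    (mulEnd e f u : ℝ → ℂ) x = f e x * (u : ℝ → ℂ) x := rfl

theorem derivEnd_mul_mulEnd (e : E) (f : PFun E L) :
    derivEnd * mulEnd e f = mulEnd e f * derivEnd + mulEnd e (δ f) := by
  refine LinearMap.ext fun u => Subtype.ext <| funext fun x => ?_
  have h := deriv_mul (f.differentiable_slice e x) (PerSmooth.differentiable u x)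
  change deriv (f e * (u : ℝ → ℂ)) x = f e x * deriv (u : ℝ → ℂ) x + deriv (f e) x * (u : ℝ → ℂ) x
  rw [h]; ring

/-- The symmetrised operator `½ (f (ε∂)ᵏ + (ε∂)ᵏ f)`. -/
def angAt (e : E) (ε : ℝ) (k : ℕ) : PFun E L →ₗ[ℂ] Module.End ℂ (PerSmooth L) where
  toFun f := (1 / 2 : ℂ) • (mulEnd e f * ((ε : ℂ) • derivEnd) ^ k +
    ((ε : ℂ) • derivEnd) ^ k * mulEnd e f)
  map_add' f g := by rw [map_add]; simp only [add_mul, mul_add, smul_add]; abel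
  map_smul' c f := by
    rw [map_smul, smul_mul_assoc, mul_smul_comm, ← smul_add, smul_comm]; rfl

/-- Quantisation of the symbol `∑ εʲ f ξᵏ`, as `∑ ε^{j+k-1} ⟨f⟩ₖ`. -/
def quantAt (e : E) (ε : ℝ) : (ℕ × ℕ →₀ PFun E L) →ₗ[ℂ] Module.End ℂ (PerSmooth L) :=
  Finsupp.lsum ℂ fun jk => ((ε : ℂ) ^ jk.1 * (ε : ℂ)⁻¹) • angAt e ε jk.2

theorem quantAt_single (e : E) (ε : ℝ) (j k : ℕ) (f : PFun E L) :
    quantAt e ε (Finsupp.single (j, k) f) =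
      ((ε : ℂ) ^ j * (ε : ℂ)⁻¹) • angAt e ε k f := by
  rw [quantAt, Finsupp.lsum_single]; rfl

theorem ang_eq_angAt {e : E} {g : PFun E L} {f : ℝ → ℝ} (h : ∀ x, g e x = f x) {ε : ℝ} (k : ℕ)
    (u : PerSmooth L) : (ε : ℂ) ^ k • ang f k u = (angAt e ε k g u : ℝ → ℂ) := by
  have h1 : ∀ v : PerSmooth L, mulOp f v = (mulEnd e g v : ℝ → ℂ) := fun v =>
    funext fun x => by rw [mulOp, mulEnd_apply, h]
  rw [ang, h1, ← derivEnd_pow_apply, ← derivEnd_pow_apply, h1]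
  change _ = (((1 / 2 : ℂ) • (mulEnd e g * ((ε : ℂ) • derivEnd) ^ k +
    ((ε : ℂ) • derivEnd) ^ k * mulEnd e g) : Module.End ℂ (PerSmooth L)) u).1
  rw [smul_pow, mul_smul_comm, smul_mul_assoc, ← smul_add, smul_comm]
  rfl

end Operators

/-! ### Families of operators -/

section Families

variable {L : ℝ}

variable (L) in
/-- Families of operators, indexed by the midpoint and the semiclassical parameter. -/
def OpFam : Type := ℝ × ℝ → Module.End ℂ (PerSmooth L)

instance : Ring (OpFam L) := inferInstanceAs (Ring (ℝ × ℝ → Module.End ℂ (PerSmooth L)))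

instance : Algebra ℂ (OpFam L) :=
  inferInstanceAs (Algebra ℂ (ℝ × ℝ → Module.End ℂ (PerSmooth L)))

/-- A member of a family of operators. -/
def evalOp (p : ℝ × ℝ) : OpFam L →ₐ[ℂ] Module.End ℂ (PerSmooth L) :=
  Pi.evalAlgHom ℂ (fun _ => Module.End ℂ (PerSmooth L)) p

theorem OpFam.ext {x y : OpFam L} (h : ∀ p, evalOp p x = evalOp p y) : x = y := funext h

/-- The semiclassical parameter, replaced by `1` where it is not positive. -/
def epos (ε : ℝ) : ℝ := if 0 < ε then ε else 1

theorem epos_pos (ε : ℝ) : 0 < epos ε := by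
  unfold epos; split_ifs with h
  · exact h
  · exact one_pos

theorem epos_of_pos {ε : ℝ} (h : 0 < ε) : epos ε = ε := if_pos h

theorem epos_ne_zero (ε : ℝ) : (epos ε : ℂ) ≠ 0 := by exact_mod_cast (epos_pos ε).ne'

/-- The semiclassical parameter as an operator. -/
def epsOp : OpFam L := fun p => (epos p.2 : ℂ) • (1 : Module.End ℂ (PerSmooth L))

/-- The inverse of the semiclassical parameter. -/
def epsInv : OpFam L := fun p => (epos p.2 : ℂ)⁻¹ • (1 : Module.End ℂ (PerSmooth L))

/-- The semiclassical derivative. -/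
def epsD : OpFam L := fun p => (epos p.2 : ℂ) • derivEnd

theorem evalOp_epsOp (p : ℝ × ℝ) : evalOp p (epsOp : OpFam L) = (epos p.2 : ℂ) • 1 := rfl

theorem evalOp_epsInv (p : ℝ × ℝ) : evalOp p (epsInv : OpFam L) = (epos p.2 : ℂ)⁻¹ • 1 := rfl

theorem evalOp_epsD (p : ℝ × ℝ) : evalOp p (epsD : OpFam L) = (epos p.2 : ℂ) • derivEnd := rfl

/-- Multiplication operators. -/
def mulFam : CoeffFun L →ₐ[ℂ] OpFam L := AlgHom.pi fun p : ℝ × ℝ =>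
  (mulEnd p.1 : CoeffFun L →ₐ[ℂ] Module.End ℂ (PerSmooth L))

theorem evalOp_mulFam (f : CoeffFun L) (p : ℝ × ℝ) : evalOp p (mulFam f) = mulEnd p.1 f := rfl

theorem epsOp_comm (x : OpFam L) : epsOp * x = x * epsOp := by
  refine OpFam.ext fun p => ?_
  simp [evalOp_epsOp]

theorem epsInv_comm (x : OpFam L) : epsInv * x = x * epsInv := by
  refine OpFam.ext fun p => ?_
  simp [evalOp_epsInv]

@[simp] theorem epsInv_mul_epsOp : (epsInv * epsOp : OpFam L) = 1 := by
  refine OpFam.ext fun p => ?_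
  rw [map_mul, map_one, evalOp_epsInv, evalOp_epsOp, smul_mul_smul_comm,
    inv_mul_cancel₀ (epos_ne_zero _), one_smul, one_mul]

@[simp] theorem epsOp_mul_epsInv : (epsOp * epsInv : OpFam L) = 1 := by
  rw [epsOp_comm, epsInv_mul_epsOp]

theorem epsOp_cancel {x y : OpFam L} (h : epsOp * x = epsOp * y) : x = y := by
  have := congrArg (epsInv * ·) h
  simpa only [← mul_assoc, epsInv_mul_epsOp, one_mul] using this

theorem epsD_mul_mulFam (f : CoeffFun L) :
    epsD * mulFam f = mulFam f * epsD + epsOp * mulFam (δ f) := by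
  refine OpFam.ext fun p => ?_
  simp only [map_mul, map_add, evalOp_epsD, evalOp_epsOp, evalOp_mulFam, smul_mul_assoc,
    mul_smul_comm,
    one_mul, derivEnd_mul_mulEnd, smul_add]

variable (L) in
/-- Semiclassical differential operators of order zero. -/
def opZero : Subalgebra ℂ (OpFam L) :=
  Algebra.adjoin ℂ ({epsOp, epsD} ∪ Set.range mulFam)

theorem epsOp_mem : (epsOp : OpFam L) ∈ opZero L := Algebra.subset_adjoin (by simp)

theorem epsD_mem : (epsD : OpFam L) ∈ opZero L := Algebra.subset_adjoin (by simp)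

theorem mulFam_mem (f : CoeffFun L) : mulFam f ∈ opZero L := Algebra.subset_adjoin (by simp)

/-- The commutator with `x` is a derivation and `epsOp` is central, so the gain of a factor passes
from generators to sums and products. -/
theorem commutator_mem_of_generator {x : OpFam L}
    (h : ∀ y ∈ ({epsOp, epsD} ∪ Set.range mulFam : Set (OpFam L)),
      ∃ z ∈ opZero L, x * y - y * x = epsOp * z) {y : OpFam L} (hy : y ∈ opZero L) :
    ∃ z ∈ opZero L, x * y - y * x = epsOp * z := by
  induction hy using Algebra.adjoin_induction with
  | mem y hy => exact h y hy
  | algebraMap c => exact ⟨0, zero_mem _, by rw [Algebra.commutes, sub_self, mul_zero]⟩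
  | add y z _ _ hy hz =>
    obtain ⟨a, ha, ea⟩ := hy
    obtain ⟨b, hb, eb⟩ := hz
    refine ⟨a + b, add_mem ha hb, ?_⟩
    rw [mul_add epsOp, ← ea, ← eb]; noncomm_ring
  | mul y z hym hzm hy hz =>
    obtain ⟨a, ha, ea⟩ := hy
    obtain ⟨b, hb, eb⟩ := hz
    refine ⟨a * z + y * b, add_mem (mul_mem ha hzm) (mul_mem hym hb), ?_⟩
    have h1 : epsOp * (y * b) = y * (epsOp * b) := by
      rw [← mul_assoc, epsOp_comm, mul_assoc]
    rw [mul_add epsOp, h1, ← mul_assoc epsOp a z, ← ea, ← eb]; noncomm_ring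

/-- Commutators of semiclassical operators gain one power of the semiclassical parameter. -/
theorem commutator_mem {x y : OpFam L} (hx : x ∈ opZero L) (hy : y ∈ opZero L) :
    ∃ z ∈ opZero L, x * y - y * x = epsOp * z := by
  have swap : ∀ {x y : OpFam L}, (∃ z ∈ opZero L, x * y - y * x = epsOp * z) →
      ∃ z ∈ opZero L, y * x - x * y = epsOp * z := by
    rintro x y ⟨z, hz, e⟩
    exact ⟨-z, neg_mem hz, by rw [mul_neg, ← e, neg_sub]⟩
  have hmm : ∀ f g : CoeffFun L, ∃ z ∈ opZero L,
      mulFam f * mulFam g - mulFam g * mulFam f = epsOp * z := fun f g =>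
    ⟨0, zero_mem _, by rw [← map_mul, ← map_mul, mul_comm, sub_self, mul_zero]⟩
  have hmd : ∀ f : CoeffFun L, ∃ z ∈ opZero L, epsD * mulFam f - mulFam f * epsD = epsOp * z :=
    fun f => ⟨mulFam (δ f), mulFam_mem _, by rw [epsD_mul_mulFam]; abel⟩
  have he : ∀ x : OpFam L, ∃ z ∈ opZero L, epsOp * x - x * epsOp = epsOp * z := fun x =>
    ⟨0, zero_mem _, by rw [epsOp_comm, sub_self, mul_zero]⟩
  -- The reduction to generators is made once for each argument. Among the generators only `ε∂` and
  -- a function fail to commute, and their commutator is `ε` times the derivative of the function.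
  refine commutator_mem_of_generator (fun y hy => swap ?_) hy
  refine commutator_mem_of_generator (fun x hx => ?_) hx
  rcases hy with (rfl | rfl) | ⟨f, rfl⟩
  · exact he _
  · rcases hx with (rfl | rfl) | ⟨g, rfl⟩
    · exact swap (he _)
    · exact ⟨0, zero_mem _, by rw [sub_self, mul_zero]⟩
    · exact hmd g
  · rcases hx with (rfl | rfl) | ⟨g, rfl⟩
    · exact swap (he _)
    · exact swap (hmd f)
    · exact hmm f g

variable (L) in
/-- Operators of size `ε⁻¹`. -/
def opLie : Submodule ℂ (OpFam L) where
  carrier := {x | epsOp * x ∈ opZero L}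
  add_mem' hx hy := by rw [Set.mem_ofPred_eq, mul_add]; exact add_mem hx hy
  zero_mem' := by rw [Set.mem_ofPred_eq, mul_zero]; exact zero_mem _
  smul_mem' c x hx := by
    rw [Set.mem_ofPred_eq, mul_smul_comm]; exact Subalgebra.smul_mem _ hx c

variable (L) in
/-- Operators of size `ε`. -/
def opSmall : Submodule ℂ (OpFam L) where
  carrier := {x | epsInv * x ∈ opZero L}
  add_mem' hx hy := by rw [Set.mem_ofPred_eq, mul_add]; exact add_mem hx hy
  zero_mem' := by rw [Set.mem_ofPred_eq, mul_zero]; exact zero_mem _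
  smul_mem' c x hx := by
    rw [Set.mem_ofPred_eq, mul_smul_comm]; exact Subalgebra.smul_mem _ hx c

theorem mem_opLie {x : OpFam L} : x ∈ opLie L ↔ epsOp * x ∈ opZero L := Iff.rfl

theorem mem_opSmall {x : OpFam L} : x ∈ opSmall L ↔ epsInv * x ∈ opZero L := Iff.rfl

theorem epsInv_mul_mem {x : OpFam L} (hx : x ∈ opZero L) : epsInv * x ∈ opLie L := by
  rw [mem_opLie, ← mul_assoc, epsOp_mul_epsInv, one_mul]; exact hx

theorem epsOp_mul_mem {x : OpFam L} (hx : x ∈ opZero L) : epsOp * x ∈ opSmall L := by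
  rw [mem_opSmall, ← mul_assoc, epsInv_mul_epsOp, one_mul]; exact hx

/-- Two prefactors `ε⁻¹` meet the factor `ε` gained in the commutator, leaving one `ε⁻¹`. -/
theorem opLie_isLieClosed : IsLieClosed (opLie L) := by
  intro x hx y hy
  obtain ⟨z, hz, e⟩ := commutator_mem hx hy
  have h : epsOp * (x * y - y * x) = z := by
    apply epsOp_cancel
    rw [← e, mul_sub, mul_sub, mul_assoc epsOp x, mul_assoc epsOp y, ← mul_assoc x,
      ← mul_assoc y, ← epsOp_comm x, ← epsOp_comm y, mul_assoc, mul_assoc]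
  rw [mem_opLie, h]; exact hz

/-- The prefactors `ε` and `ε⁻¹` cancel, and the commutator supplies a new `ε`. Errors in `opSmall`
thus survive further brackets. -/
theorem opSmall_lie_mem {x y : OpFam L} (hx : x ∈ opSmall L) (hy : y ∈ opLie L) :
    ⁅x, y⁆ ∈ opSmall L := by
  obtain ⟨z, hz, e⟩ := commutator_mem hx hy
  have h : ⁅x, y⁆ = epsOp * z := by
    rw [Ring.lie_def, ← e]
    have h1 : epsInv * x * (epsOp * y) = x * y := by
      rw [epsInv_comm, mul_assoc, ← mul_assoc epsInv, epsInv_mul_epsOp, one_mul]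
    have h2 : epsOp * y * (epsInv * x) = y * x := by
      rw [epsOp_comm, mul_assoc, ← mul_assoc epsOp, epsOp_mul_epsInv, one_mul]
    rw [h1, h2]
  rw [h]; exact epsOp_mul_mem hz

theorem lie_opSmall_mem {x y : OpFam L} (hx : x ∈ opLie L) (hy : y ∈ opSmall L) :
    ⁅x, y⁆ ∈ opSmall L := by
  rw [Ring.lie_def, ← neg_sub, ← Ring.lie_def]; exact neg_mem (opSmall_lie_mem hy hx)

/-! ### Symbols -/

open Polynomial

/-- Differentiation of the coefficients of a polynomial symbol. -/
def symbδ : (CoeffFun L)[X] →ₗ[ℂ] (CoeffFun L)[X] :=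
  Polynomial.lsum fun k =>
    ((Polynomial.monomial k).restrictScalars ℂ).comp (δ : Derivation ℂ (CoeffFun L) _).toLinearMap

theorem symbδ_monomial (k : ℕ) (f : CoeffFun L) :
    symbδ (monomial k f) = monomial k (δ f) := by
  rw [symbδ, Polynomial.lsum_apply, Polynomial.sum_monomial_index]
  · rfl
  · exact map_zero _

@[simp] theorem symbδ_C (f : CoeffFun L) : symbδ (C f) = C (δ f) := symbδ_monomial 0 f

theorem symbδ_mul (p q : (CoeffFun L)[X]) : symbδ (p * q) = symbδ p * q + p * symbδ q := by
  induction p using Polynomial.induction_on' with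
  | add p r hp hr => rw [add_mul, map_add, map_add, hp, hr]; ring
  | monomial k f =>
    induction q using Polynomial.induction_on' with
    | add q r hq hr => rw [mul_add, map_add, map_add, hq, hr]; ring
    | monomial l g =>
      rw [monomial_mul_monomial, symbδ_monomial, symbδ_monomial, symbδ_monomial,
        monomial_mul_monomial, monomial_mul_monomial, ← map_add, Derivation.leibniz, smul_eq_mul,
        smul_eq_mul]
      congr 1; ring

@[simp] theorem symbδ_X : symbδ (X : (CoeffFun L)[X]) = 0 := by
  rw [← monomial_one_one_eq_X, symbδ_monomial, Derivation.map_one_eq_zero, map_zero]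

/-- Standard quantisation of a polynomial symbol. -/
def stdQuant : (CoeffFun L)[X] →ₗ[ℂ] OpFam L :=
  Polynomial.lsum fun k => (LinearMap.mulRight ℂ (epsD ^ k)).comp mulFam.toLinearMap

theorem stdQuant_monomial (k : ℕ) (f : CoeffFun L) :
    stdQuant (monomial k f) = mulFam f * epsD ^ k := by
  rw [stdQuant, Polynomial.lsum_apply, Polynomial.sum_monomial_index]
  · rfl
  · exact map_zero _

theorem stdQuant_mem (p : (CoeffFun L)[X]) : stdQuant p ∈ opZero L := by
  induction p using Polynomial.induction_on' with
  | add p q hp hq => rw [map_add]; exact add_mem hp hq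
  | monomial k f =>
    rw [stdQuant_monomial]; exact mul_mem (mulFam_mem f) (pow_mem epsD_mem k)

theorem stdQuant_C_mul (f : CoeffFun L) (p : (CoeffFun L)[X]) :
    stdQuant (C f * p) = mulFam f * stdQuant p := by
  induction p using Polynomial.induction_on' with
  | add p q hp hq => rw [mul_add, map_add, hp, hq, map_add, mul_add]
  | monomial k g => rw [C_mul_monomial, stdQuant_monomial, stdQuant_monomial, map_mul, mul_assoc]

theorem stdQuant_mul_X (p : (CoeffFun L)[X]) : stdQuant (p * X) = stdQuant p * epsD := by
  induction p using Polynomial.induction_on' with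
  | add p q hp hq => rw [add_mul, map_add, hp, hq, map_add, add_mul]
  | monomial k g => rw [monomial_mul_X, stdQuant_monomial, stdQuant_monomial, pow_succ, mul_assoc]

theorem epsD_mul_stdQuant (p : (CoeffFun L)[X]) :
    epsD * stdQuant p = stdQuant (X * p) + epsOp * stdQuant (symbδ p) := by
  induction p using Polynomial.induction_on' with
  | add p q hp hq =>
    rw [map_add, mul_add, hp, hq, mul_add, map_add, map_add, map_add, mul_add]
    abel
  | monomial k g =>
    rw [X_mul_monomial, symbδ_monomial, stdQuant_monomial, stdQuant_monomial, stdQuant_monomial,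
      ← mul_assoc, epsD_mul_mulFam, add_mul, pow_succ', mul_assoc, mul_assoc]

/-- Composition of quantised symbols, up to third order. -/
theorem stdQuant_mul (p q : (CoeffFun L)[X]) : ∃ z ∈ opZero L,
    stdQuant p * stdQuant q = stdQuant (p * q) + epsOp * stdQuant (derivative p * symbδ q) +
      epsOp ^ 2 * ((1 / 2 : ℂ) • stdQuant (derivative (derivative p) * symbδ (symbδ q))) +
      epsOp ^ 3 * z := by
  induction p using Polynomial.induction_on generalizing q with
  | C f =>
    have h : stdQuant (C f) = mulFam f := by simpa using stdQuant_monomial 0 f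
    exact ⟨0, zero_mem _, by simp [stdQuant_C_mul, h]⟩
  | add p r hp hr =>
    obtain ⟨a, ha, ea⟩ := hp q
    obtain ⟨b, hb, eb⟩ := hr q
    refine ⟨a + b, add_mem ha hb, ?_⟩
    simp only [map_add, add_mul, mul_add, smul_add, ea, eb]
    abel
  | monomial n f ih =>
    rw [pow_succ, ← mul_assoc]
    set p := C f * X ^ n
    obtain ⟨a, ha, ea⟩ := ih (X * q)
    obtain ⟨b, hb, eb⟩ := ih (symbδ q)
    -- Moving one `ε∂` past `q` replaces `q` by `ξ q` plus `ε` times its derivative. In the second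
    -- piece the term of second order acquires an extra `ε` and joins the error.
    refine ⟨a + (1 / 2 : ℂ) • stdQuant (derivative (derivative p) * symbδ (symbδ (symbδ q)))
      + epsOp * b, add_mem (add_mem ha (Subalgebra.smul_mem _ (stdQuant_mem _) _))
        (mul_mem epsOp_mem hb), ?_⟩
    have e1 : stdQuant (derivative (p * X) * symbδ q) =
        stdQuant (derivative p * symbδ (X * q)) + stdQuant (p * symbδ q) := by
      rw [← map_add]; congr 1
      rw [derivative_mul, derivative_X, symbδ_mul, symbδ_X]; ring
    have e2 : stdQuant (derivative (derivative (p * X)) * symbδ (symbδ q)) =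
        stdQuant (derivative (derivative p) * symbδ (symbδ (X * q))) +
          (2 : ℂ) • stdQuant (derivative p * symbδ (symbδ q)) := by
      rw [two_smul, ← map_add, ← map_add]; congr 1
      simp only [derivative_mul, derivative_X, symbδ_mul, symbδ_X, map_add, derivative_one,
        map_zero]
      ring
    have h : stdQuant p * (epsOp * stdQuant (symbδ q)) =
        epsOp * (stdQuant p * stdQuant (symbδ q)) := by
      rw [← mul_assoc, ← epsOp_comm, mul_assoc]
    rw [stdQuant_mul_X, mul_assoc, epsD_mul_stdQuant, mul_add, ea, h, eb, e1, e2, mul_assoc p X q]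
    simp only [mul_add, smul_add, mul_smul_comm, smul_smul, ← mul_assoc, pow_succ, pow_zero,
      one_mul]
    norm_num
    abel

/-- The Poisson bracket of symbols. -/
def poisson (p q : (CoeffFun L)[X]) : (CoeffFun L)[X] :=
  derivative p * symbδ q - derivative q * symbδ p

/-- Symmetric quantisation of a polynomial symbol, up to second order. -/
def symQuant (p : (CoeffFun L)[X]) : OpFam L :=
  stdQuant p + (1 / 2 : ℂ) • (epsOp * stdQuant (derivative (symbδ p)))

theorem symQuant_mem (p : (CoeffFun L)[X]) : symQuant p ∈ opZero L :=
  add_mem (stdQuant_mem _) (Subalgebra.smul_mem _ (mul_mem epsOp_mem (stdQuant_mem _)) _)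

theorem derivative_symbδ (p : (CoeffFun L)[X]) : derivative (symbδ p) = symbδ (derivative p) := by
  induction p using Polynomial.induction_on' with
  | add p q hp hq => simp only [map_add, hp, hq]
  | monomial k f =>
    rw [symbδ_monomial, derivative_monomial, derivative_monomial, symbδ_monomial]
    congr 1
    rw [Derivation.leibniz, Derivation.map_natCast]
    simp [mul_comm]

/-- The terms are sorted by powers of `ε`. At order two the term with factor `1/4` is symmetric in
the two symbols and will drop out of the commutator. -/
theorem symQuant_mul (p q : (CoeffFun L)[X]) : ∃ z ∈ opZero L,
    symQuant p * symQuant q = stdQuant (p * q) + epsOp * (stdQuant (derivative p * symbδ q) +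
      (1 / 2 : ℂ) • stdQuant (symbδ (derivative p) * q + p * symbδ (derivative q))) +
      epsOp ^ 2 * ((1 / 4 : ℂ) • stdQuant (symbδ (derivative p) * symbδ (derivative q)) +
        (1 / 2 : ℂ) • stdQuant (derivative (derivative p) * symbδ (symbδ q) +
          symbδ (derivative (derivative p)) * symbδ q +
          derivative p * symbδ (symbδ (derivative q)))) +
      epsOp ^ 3 * z := by
  obtain ⟨a, ha, ea⟩ := stdQuant_mul p q
  obtain ⟨b, hb, eb⟩ := stdQuant_mul (derivative (symbδ p)) q
  obtain ⟨c, hc, ec⟩ := stdQuant_mul p (derivative (symbδ q))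
  obtain ⟨d, hd, ed⟩ := stdQuant_mul (derivative (symbδ p)) (derivative (symbδ q))
  have e0 : symQuant p * symQuant q = stdQuant p * stdQuant q +
      (1 / 2 : ℂ) • (epsOp * (stdQuant (derivative (symbδ p)) * stdQuant q)) +
      (1 / 2 : ℂ) • (epsOp * (stdQuant p * stdQuant (derivative (symbδ q)))) +
      (1 / 4 : ℂ) • (epsOp ^ 2 *
        (stdQuant (derivative (symbδ p)) * stdQuant (derivative (symbδ q)))) := by
    have h1 : stdQuant p * (epsOp * stdQuant (derivative (symbδ q))) =
        epsOp * (stdQuant p * stdQuant (derivative (symbδ q))) := by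
      rw [← mul_assoc, ← epsOp_comm, mul_assoc]
    have h2 : epsOp * stdQuant (derivative (symbδ p)) * (epsOp * stdQuant (derivative (symbδ q))) =
        epsOp ^ 2 * (stdQuant (derivative (symbδ p)) * stdQuant (derivative (symbδ q))) := by
      rw [pow_two, mul_assoc, ← mul_assoc (stdQuant (derivative (symbδ p))), ← epsOp_comm]
      simp only [mul_assoc]
    simp only [symQuant, add_mul, mul_add, smul_mul_assoc, mul_smul_comm, h1, h2,
      mul_assoc epsOp]
    module
  refine ⟨a + (1 / 4 : ℂ) • stdQuant (derivative (derivative (derivative (symbδ p))) *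
      symbδ (symbδ q)) + (1 / 4 : ℂ) • stdQuant (derivative (derivative p) *
      symbδ (symbδ (derivative (symbδ q)))) + (1 / 4 : ℂ) • stdQuant
      (derivative (derivative (symbδ p)) * symbδ (derivative (symbδ q))) +
      (1 / 2 : ℂ) • (epsOp * b) + (1 / 2 : ℂ) • (epsOp * c) +
      (1 / 8 : ℂ) • (epsOp * stdQuant (derivative (derivative (derivative (symbδ p))) *
        symbδ (symbδ (derivative (symbδ q))))) + (1 / 4 : ℂ) • (epsOp ^ 2 * d), ?_, ?_⟩
  · repeat' apply add_mem
    all_goals first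
      | assumption
      | refine Subalgebra.smul_mem _ ?_ _
    all_goals first
      | exact stdQuant_mem _
      | exact mul_mem epsOp_mem (stdQuant_mem _)
      | exact mul_mem epsOp_mem ‹_›
      | exact mul_mem (pow_mem epsOp_mem 2) ‹_›
  · rw [e0, ea, eb, ec, ed]
    simp only [← derivative_symbδ, map_add, mul_add, smul_add, mul_smul_comm, smul_smul, pow_succ,
      pow_zero, one_mul, mul_assoc]
    module

/-- Commutators of quantised symbols are quantised Poisson brackets, up to relative order two. -/
theorem symQuant_commutator (p q : (CoeffFun L)[X]) : ∃ z ∈ opZero L,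
    symQuant p * symQuant q - symQuant q * symQuant p =
      epsOp * symQuant (poisson p q) + epsOp ^ 3 * z := by
  obtain ⟨a, ha, ea⟩ := symQuant_mul p q
  obtain ⟨b, hb, eb⟩ := symQuant_mul q p
  refine ⟨a - b, sub_mem ha hb, ?_⟩
  rw [ea, eb, symQuant, poisson]
  -- The antisymmetrised second-order terms form exactly the mixed derivative of the Poisson
  -- bracket, which is the correction contained in `symQuant`. Hence no error of order `ε²` is left.
  have h : derivative (symbδ (derivative p * symbδ q - derivative q * symbδ p)) =
      symbδ (derivative (derivative p)) * symbδ q + derivative (derivative p) * symbδ (symbδ q) +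
      derivative p * symbδ (symbδ (derivative q)) -
      (symbδ (derivative (derivative q)) * symbδ p + derivative (derivative q) * symbδ (symbδ p) +
      derivative q * symbδ (symbδ (derivative p))) := by
    simp only [map_sub, symbδ_mul, derivative_mul, map_add, derivative_symbδ]
    ring
  rw [h, mul_comm q p, mul_comm (symbδ (derivative q)) (symbδ (derivative p)),
    mul_comm (symbδ (derivative q)) p, mul_comm q (symbδ (derivative p))]
  simp only [map_add, map_sub, mul_add, mul_sub, smul_add, smul_sub, mul_smul_comm,
    pow_succ, pow_zero, one_mul, mul_assoc]
  module

/-- The operator of size `ε⁻¹` with a given principal symbol. -/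
def lieQuant (p : (CoeffFun L)[X]) : OpFam L := epsInv * symQuant p

theorem lieQuant_mem (p : (CoeffFun L)[X]) : lieQuant p ∈ opLie L := epsInv_mul_mem (symQuant_mem p)

/-- `symQuant_commutator` is divided by `ε²`: its leading factor `ε` becomes `ε⁻¹`, and its error
`ε³` becomes `ε`. -/
theorem lieQuant_lie (p q : (CoeffFun L)[X]) :
    ⁅lieQuant p, lieQuant q⁆ - lieQuant (poisson p q) ∈ opSmall L := by
  obtain ⟨z, hz, e⟩ := symQuant_commutator p q
  have h : ∀ x y : OpFam L, epsInv * x * (epsInv * y) = epsInv * (epsInv * (x * y)) := fun x y => by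
    rw [mul_assoc, ← mul_assoc x, ← epsInv_comm, mul_assoc]
  have h1 : ⁅lieQuant p, lieQuant q⁆ - lieQuant (poisson p q) = epsOp * z := by
    have k : ∀ x : OpFam L, epsInv * (epsOp * x) = x := fun x => by
      rw [← mul_assoc, epsInv_mul_epsOp, one_mul]
    have h3 : epsOp ^ 3 * z = epsOp * (epsOp * (epsOp * z)) := by
      rw [pow_succ, pow_two, mul_assoc, mul_assoc]
    rw [Ring.lie_def, lieQuant, lieQuant, lieQuant, h, h, ← mul_sub, ← mul_sub, ← mul_sub, e,
      mul_add, k, h3, k, add_sub_cancel_left, k]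
  rw [h1]
  exact epsOp_mul_mem hz

end Families
end MagnusZassenhaus
namespace MagnusZassenhaus

/-! ### Sizes -/

section Norm

variable {L : ℝ}

theorem l2norm_nonneg (u : ℝ → ℂ) : 0 ≤ l2norm L u := Real.sqrt_nonneg _

/-- The lossy constant comes from `(a + b)² ≤ 2a² + 2b²`. Only orders of magnitude matter, so
Minkowski's inequality is not needed. -/
theorem l2norm_add_le (hL : 0 < L) {u v : ℝ → ℂ} (hu : Continuous u) (hv : Continuous v) :
    l2norm L (u + v) ≤ 2 * (l2norm L u + l2norm L v) := by
  have hu2 : IntervalIntegrable (fun x => ‖u x‖ ^ 2) MeasureTheory.volume 0 L :=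
    (hu.norm.pow 2).intervalIntegrable _ _
  have hv2 : IntervalIntegrable (fun x => ‖v x‖ ^ 2) MeasureTheory.volume 0 L :=
    (hv.norm.pow 2).intervalIntegrable _ _
  have huv : IntervalIntegrable (fun x => ‖(u + v) x‖ ^ 2) MeasureTheory.volume 0 L :=
    ((hu.add hv).norm.pow 2).intervalIntegrable _ _
  have h1 : ∫ x in (0 : ℝ)..L, ‖(u + v) x‖ ^ 2 ≤
      2 * (∫ x in (0 : ℝ)..L, ‖u x‖ ^ 2) + 2 * ∫ x in (0 : ℝ)..L, ‖v x‖ ^ 2 := by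
    rw [← intervalIntegral.integral_const_mul, ← intervalIntegral.integral_const_mul,
      ← intervalIntegral.integral_add (hu2.const_mul 2) (hv2.const_mul 2)]
    refine intervalIntegral.integral_mono_on hL.le huv
      ((hu2.const_mul 2).add (hv2.const_mul 2)) fun x _ => ?_
    have := norm_add_le (u x) (v x)
    rw [Pi.add_apply]
    nlinarith [sq_nonneg (‖u x‖ - ‖v x‖), norm_nonneg (u x + v x)]
  have a0 : 0 ≤ ∫ x in (0 : ℝ)..L, ‖u x‖ ^ 2 :=
    intervalIntegral.integral_nonneg hL.le fun x _ => sq_nonneg _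
  have b0 : 0 ≤ ∫ x in (0 : ℝ)..L, ‖v x‖ ^ 2 :=
    intervalIntegral.integral_nonneg hL.le fun x _ => sq_nonneg _
  unfold l2norm
  refine Real.sqrt_le_iff.2 ⟨by positivity, h1.trans ?_⟩
  nlinarith [Real.sq_sqrt a0, Real.sq_sqrt b0, Real.sqrt_nonneg (∫ x in (0 : ℝ)..L, ‖u x‖ ^ 2),
    Real.sqrt_nonneg (∫ x in (0 : ℝ)..L, ‖v x‖ ^ 2),
    mul_nonneg (Real.sqrt_nonneg (∫ x in (0 : ℝ)..L, ‖u x‖ ^ 2))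
      (Real.sqrt_nonneg (∫ x in (0 : ℝ)..L, ‖v x‖ ^ 2))]

theorem l2norm_mul_le (hL : 0 < L) {f u : ℝ → ℂ} (hf : Continuous f) (hu : Continuous u) {C : ℝ}
    (hC : 0 ≤ C) (h : ∀ x, ‖f x‖ ≤ C) : l2norm L (fun x => f x * u x) ≤ C * l2norm L u := by
  unfold l2norm
  rw [← Real.sqrt_sq hC, ← Real.sqrt_mul (sq_nonneg C), ← intervalIntegral.integral_const_mul]
  refine Real.sqrt_le_sqrt (intervalIntegral.integral_mono_on hL.le
    (((hf.mul hu).norm.pow 2).intervalIntegrable _ _)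
    ((continuous_const.mul (hu.norm.pow 2)).intervalIntegrable _ _) fun x _ => ?_)
  rw [norm_mul, mul_pow]
  gcongr
  exact h x

theorem l2norm_smul (c : ℂ) (u : ℝ → ℂ) : l2norm L (c • u) = ‖c‖ * l2norm L u := by
  unfold l2norm
  simp only [Pi.smul_apply, norm_smul, mul_pow]
  rw [intervalIntegral.integral_const_mul, Real.sqrt_mul (sq_nonneg _),
    Real.sqrt_sq (norm_nonneg c)]

theorem PerSmooth.continuous (u : PerSmooth L) : Continuous (u : ℝ → ℂ) :=
  (PerSmooth.contDiff u).continuous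

theorem isSemiclassical_iff {u : ℝ → PerSmooth L} : IsSemiclassical u ↔ ∀ k : ℕ,
    (fun ε => l2norm L ((derivEnd ^ k) (u ε))) =O[𝓝[>] (0 : ℝ)] fun ε => ε⁻¹ ^ k := by
  simp only [IsSemiclassical, derivEnd_pow_apply]

theorem isBigO_l2norm_add (hL : 0 < L) {u v : ℝ → PerSmooth L} {g : ℝ → ℝ}
    (hu : (fun ε => l2norm L (u ε)) =O[𝓝[>] (0 : ℝ)] g)
    (hv : (fun ε => l2norm L (v ε)) =O[𝓝[>] (0 : ℝ)] g) :
    (fun ε => l2norm L (u ε + v ε : PerSmooth L)) =O[𝓝[>] (0 : ℝ)] g := by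
  refine IsBigO.trans (IsBigO.of_bound 2 (Eventually.of_forall fun ε => ?_)) (hu.add hv)
  rw [Real.norm_of_nonneg (l2norm_nonneg _),
    Real.norm_of_nonneg (add_nonneg (l2norm_nonneg _) (l2norm_nonneg _))]
  exact l2norm_add_le hL (PerSmooth.continuous _) (PerSmooth.continuous _)

theorem isBigO_l2norm_smul {u : ℝ → PerSmooth L} {c : ℝ → ℂ} {g f : ℝ → ℝ}
    (hc : c =O[𝓝[>] (0 : ℝ)] f) (hu : (fun ε => l2norm L (u ε)) =O[𝓝[>] (0 : ℝ)] g) :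
    (fun ε => l2norm L (c ε • u ε : PerSmooth L)) =O[𝓝[>] (0 : ℝ)] fun ε => f ε * g ε := by
  have h : ∀ ε, l2norm L (c ε • u ε : PerSmooth L) = ‖c ε‖ * l2norm L (u ε) := fun ε =>
    l2norm_smul _ _
  simp only [h]
  exact hc.norm_left.mul hu

theorem isBigO_ofReal_id : (fun ε : ℝ => (ε : ℂ)) =O[𝓝[>] (0 : ℝ)] fun ε : ℝ => ε :=
  IsBigO.of_bound 1 (Eventually.of_forall fun ε => by simp)

theorem isBigO_self_one : (fun ε : ℝ => ε) =O[𝓝[>] (0 : ℝ)] fun _ : ℝ => (1 : ℝ) := by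
  have h : Tendsto (fun ε : ℝ => ε) (𝓝[>] 0) (𝓝 0) := tendsto_id.mono_left nhdsWithin_le_nhds
  exact h.isBigO_one ℝ

theorem eventually_pos : ∀ᶠ ε in 𝓝[>] (0 : ℝ), 0 < ε := self_mem_nhdsWithin

theorem IsSemiclassical.congr {u v : ℝ → PerSmooth L} (hu : IsSemiclassical u)
    (h : u =ᶠ[𝓝[>] (0 : ℝ)] v) : IsSemiclassical v := fun k =>
  (hu k).congr' (h.mono fun ε hε => by simp only [hε]) EventuallyEq.rfl

theorem IsSemiclassical.add (hL : 0 < L) {u v : ℝ → PerSmooth L} (hu : IsSemiclassical u)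
    (hv : IsSemiclassical v) : IsSemiclassical fun ε => u ε + v ε := by
  rw [isSemiclassical_iff] at *
  intro k
  simp only [map_add]
  exact isBigO_l2norm_add hL (hu k) (hv k)

theorem IsSemiclassical.smul {u : ℝ → PerSmooth L} (hu : IsSemiclassical u) {c : ℝ → ℂ}
    (hc : c =O[𝓝[>] (0 : ℝ)] fun _ => (1 : ℝ)) : IsSemiclassical fun ε => c ε • u ε := by
  rw [isSemiclassical_iff] at *
  intro k
  simp only [map_smul]
  simpa only [one_mul] using isBigO_l2norm_smul hc (hu k)

theorem IsSemiclassical.epsDeriv {u : ℝ → PerSmooth L} (hu : IsSemiclassical u) :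
    IsSemiclassical fun ε => (ε : ℂ) • derivEnd (u ε) := by
  rw [isSemiclassical_iff] at *
  intro k
  have h := isBigO_l2norm_smul isBigO_ofReal_id (hu (k + 1))
  simp only [map_smul]
  refine h.congr' (Eventually.of_forall fun ε => by
    simp only [pow_succ, Module.End.mul_apply])
    (eventually_pos.mono fun ε hε => ?_)
  change ε * ε⁻¹ ^ (k + 1) = ε⁻¹ ^ k
  rw [pow_succ', ← mul_assoc, mul_inv_cancel₀ hε.ne', one_mul]

variable {E : Type} [NormedAddCommGroup E] [NormedSpace ℝ E]

theorem quantAt_apply_eq_sum (e : E) (ε : ℝ) (p : ℕ × ℕ →₀ PFun E L) :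
    quantAt e ε p = ∑ jk ∈ p.support, ((ε : ℂ) ^ jk.1 * (ε : ℂ)⁻¹) • angAt e ε jk.2 (p jk) := rfl

variable [ProperSpace E]

theorem PFun.exists_bound (hL : 0 < L) (f : PFun E L) (C : ℝ) :
    ∃ B, 0 ≤ B ∧ ∀ e : E, ‖e‖ ≤ C → ∀ x, ‖f e x‖ ≤ B := by
  obtain ⟨B, hB⟩ := ((isCompact_closedBall (0 : E) C).prod
    (isCompact_Icc (a := (0 : ℝ)) (b := L))).exists_bound_of_continuousOn
      f.contDiff.continuous.continuousOn
  refine ⟨max B 0, le_max_right _ _, fun e he x => ?_⟩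
  obtain ⟨y, hy, hxy⟩ := (f.periodic e).exists_mem_Ico₀ hL x
  rw [hxy]
  exact (hB (e, y) ⟨by simpa using he, Set.Ico_subset_Icc_self hy⟩).trans (le_max_left _ _)

/-- Induction on the number of derivatives through `∂(f u) = ε⁻¹ f (ε∂u) + f' u`: both terms are
again multiplications of semiclassical families. The bounds on `f` are uniform because the parameter
stays in a ball and `x` in one period. -/
theorem IsSemiclassical.mulEnd (hL : 0 < L) {q : ℝ → E} {C : ℝ}
    (hq : ∀ᶠ ε in 𝓝[>] (0 : ℝ), ‖q ε‖ ≤ C) (f : PFun E L) {u : ℝ → PerSmooth L}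
    (hu : IsSemiclassical u) : IsSemiclassical fun ε => mulEnd (q ε) f (u ε) := by
  rw [isSemiclassical_iff]
  intro k
  induction k generalizing f u with
  | zero =>
    obtain ⟨B, hB0, hB⟩ := f.exists_bound hL C
    refine IsBigO.trans (IsBigO.of_bound B ?_) (isSemiclassical_iff.1 hu 0)
    filter_upwards [hq] with ε hε
    rw [Real.norm_of_nonneg (l2norm_nonneg _), Real.norm_of_nonneg (l2norm_nonneg _)]
    exact l2norm_mul_le hL (f.contDiff_slice _).continuous (PerSmooth.continuous _) hB0 (hB _ hε)
  | succ k ih =>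
    have h1 := ih f hu.epsDeriv
    have h2 := ih (δ f) hu
    have h3 : (fun ε : ℝ => ((ε : ℂ)⁻¹)) =O[𝓝[>] (0 : ℝ)] fun ε : ℝ => ε⁻¹ :=
      IsBigO.of_bound 1 (Eventually.of_forall fun ε => by simp)
    have h4 := isBigO_l2norm_smul h3 h1
    have h5 : (fun ε : ℝ => ε⁻¹ ^ k) =O[𝓝[>] (0 : ℝ)] fun ε => ε⁻¹ ^ (k + 1) := by
      refine IsBigO.of_bound 1 ?_
      filter_upwards [Ioo_mem_nhdsGT (show (0 : ℝ) < 1 by norm_num)] with ε hε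
      have h1 : 1 ≤ ε⁻¹ := (one_le_inv₀ hε.1).2 hε.2.le
      rw [one_mul, Real.norm_of_nonneg (by positivity), Real.norm_of_nonneg (by positivity)]
      exact pow_le_pow_right₀ h1 (Nat.le_succ k)
    have h6 : (fun ε : ℝ => ε⁻¹ * ε⁻¹ ^ k) = fun ε => ε⁻¹ ^ (k + 1) := by
      funext ε; rw [pow_succ']
    rw [h6] at h4
    refine (isBigO_l2norm_add hL h4 (h2.trans h5)).congr'
      (eventually_pos.mono fun ε hε => ?_) EventuallyEq.rfl
    have hε' : (ε : ℂ) ≠ 0 := by exact_mod_cast hε.ne'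
    have e : (derivEnd ^ (k + 1)) (MagnusZassenhaus.mulEnd (q ε) f (u ε)) =
        (ε : ℂ)⁻¹ • (derivEnd ^ k) (MagnusZassenhaus.mulEnd (q ε) f ((ε : ℂ) • derivEnd (u ε))) +
        (derivEnd ^ k) (MagnusZassenhaus.mulEnd (q ε) (δ f) (u ε)) := by
      have h := LinearMap.congr_fun (derivEnd_mul_mulEnd (q ε) f) (u ε)
      rw [Module.End.mul_apply, LinearMap.add_apply, Module.End.mul_apply] at h
      rw [pow_succ, Module.End.mul_apply, h, map_add, map_smul, map_smul, smul_smul,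
        inv_mul_cancel₀ hε', one_smul]
    simp only [e]

theorem IsSemiclassical.epsDeriv_pow {u : ℝ → PerSmooth L} (hu : IsSemiclassical u) (k : ℕ) :
    IsSemiclassical fun ε => (((ε : ℂ) • derivEnd) ^ k : Module.End ℂ (PerSmooth L)) (u ε) := by
  induction k with
  | zero => simpa using hu
  | succ k ih =>
    simp only [pow_succ', Module.End.mul_apply]
    exact ih.epsDeriv

theorem IsSemiclassical.angAt (hL : 0 < L) {q : ℝ → E} {C : ℝ}
    (hq : ∀ᶠ ε in 𝓝[>] (0 : ℝ), ‖q ε‖ ≤ C) (f : PFun E L) {u : ℝ → PerSmooth L}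
    (hu : IsSemiclassical u) (k : ℕ) : IsSemiclassical fun ε => angAt (q ε) ε k f (u ε) :=
  (IsSemiclassical.add hL ((hu.epsDeriv_pow k).mulEnd hL hq f)
    ((hu.mulEnd hL hq f).epsDeriv_pow k)).smul (c := fun _ => 1 / 2)
      (isBigO_const_const _ one_ne_zero _)

/-- The generators preserve semiclassical families, hence so does the algebra they generate. In
particular its elements have size `O(1)`. -/
theorem IsSemiclassical.opZero (hL : 0 < L) {t : ℝ → ℝ} {T : ℝ} (ht : ∀ ε, |t ε| ≤ T)
    {x : OpFam L} (hx : x ∈ opZero L) {u : ℝ → PerSmooth L} (hu : IsSemiclassical u) :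
    IsSemiclassical fun ε => evalOp (t ε, ε) x (u ε) := by
  induction hx using Algebra.adjoin_induction generalizing u with
  | mem x hx =>
    rcases hx with (rfl | rfl) | ⟨f, rfl⟩
    · refine (hu.smul (isBigO_ofReal_id.trans isBigO_self_one)).congr ?_
      filter_upwards [eventually_pos] with ε hε
      rw [evalOp_epsOp, epos_of_pos hε]; rfl
    · refine hu.epsDeriv.congr ?_
      filter_upwards [eventually_pos] with ε hε
      rw [evalOp_epsD, epos_of_pos hε]; rfl
    · exact hu.mulEnd hL (Eventually.of_forall ht) f
  | algebraMap c =>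
    have := hu.smul (c := fun _ => c) (isBigO_const_const _ one_ne_zero _)
    refine this.congr (Eventually.of_forall fun ε => ?_)
    simp [Algebra.algebraMap_eq_smul_one]
  | add x y _ _ hx hy =>
    simp only [map_add, LinearMap.add_apply]
    exact (hx hu).add hL (hy hu)
  | mul x y _ _ hx hy =>
    simp only [map_mul, Module.End.mul_apply]
    exact hx (hy hu)

theorem isBigO_l2norm_smul_rpow {v : ℝ → PerSmooth L} (hv : IsSemiclassical v) {c : ℝ → ℂ} {p : ℝ}
    (hc : c =O[𝓝[>] (0 : ℝ)] fun ε => ε ^ p) :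
    (fun ε => l2norm L (c ε • v ε : PerSmooth L)) =O[𝓝[>] (0 : ℝ)] fun ε => ε ^ p := by
  have h := isBigO_l2norm_smul hc (isSemiclassical_iff.1 hv 0)
  simpa using h

theorem isBigO_rpow_of_le {p q : ℝ} (h : q ≤ p) :
    (fun ε : ℝ => ε ^ p) =O[𝓝[>] (0 : ℝ)] fun ε => ε ^ q := by
  refine IsBigO.of_bound 1 ?_
  filter_upwards [Ioo_mem_nhdsGT (show (0 : ℝ) < 1 by norm_num)] with ε hε
  rw [one_mul, Real.norm_of_nonneg (Real.rpow_nonneg hε.1.le _),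
    Real.norm_of_nonneg (Real.rpow_nonneg hε.1.le _)]
  exact Real.rpow_le_rpow_of_exponent_ge hε.1 hε.2.le h

theorem isBigO_step_pow {h : ℝ → ℝ} {σ : ℝ} (hh : h =O[𝓝[>] (0 : ℝ)] fun ε => ε ^ σ) (n : ℕ) (m : ℝ)
    {c : ℝ → ℂ} (hc : ∀ᶠ ε in 𝓝[>] (0 : ℝ), ‖c ε‖ = ε ^ m) {p : ℝ} (hp : p ≤ n * σ + m) :
    (fun ε => (h ε : ℂ) ^ n * c ε) =O[𝓝[>] (0 : ℝ)] fun ε => ε ^ p := by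
  have h1 : (fun ε => (h ε : ℂ)) =O[𝓝[>] (0 : ℝ)] fun ε => ε ^ σ := by
    refine IsBigO.trans (IsBigO.of_bound 1 (Eventually.of_forall fun ε => ?_)) hh
    simp
  have h2 : c =O[𝓝[>] (0 : ℝ)] fun ε : ℝ => ε ^ m := by
    refine IsBigO.of_bound 1 ?_
    filter_upwards [hc] with ε hε
    rw [hε, one_mul]; exact le_abs_self _
  refine (((h1.pow n).mul h2).congr' EventuallyEq.rfl ?_).trans (isBigO_rpow_of_le hp)
  filter_upwards [eventually_pos] with ε hε
  rw [← Real.rpow_mul_natCast hε.le, ← Real.rpow_add hε, mul_comm σ]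

theorem hasSize_step_pow_opZero (hL : 0 < L) {t h : ℝ → ℝ} {T : ℝ} (ht : ∀ ε, |t ε| ≤ T)
    {σ : ℝ} (hh : h =O[𝓝[>] (0 : ℝ)] fun ε => ε ^ σ) (n : ℕ) (m : ℤ) {x y : OpFam L}
    (hx : x ∈ opZero L) (hy : ∀ p : ℝ × ℝ, evalOp p y = (epos p.2 : ℂ) ^ m • evalOp p x) {p : ℝ}
    (hp : p ≤ n * σ + m) :
    HasSize (fun ε u => (h ε : ℂ) ^ n • (evalOp (t ε, ε) y u : ℝ → ℂ)) p := by
  intro u hu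
  have hc : ∀ᶠ ε in 𝓝[>] (0 : ℝ), ‖(epos ε : ℂ) ^ m‖ = ε ^ (m : ℝ) := by
    filter_upwards [eventually_pos] with ε hε
    rw [epos_of_pos hε, norm_zpow, Complex.norm_real, Real.norm_of_nonneg hε.le,
      Real.rpow_intCast]
  refine (isBigO_l2norm_smul_rpow (hu.opZero hL ht hx)
    (isBigO_step_pow hh n m hc hp)).congr_left fun ε => ?_
  change _ = l2norm L ((h ε : ℂ) ^ n • (evalOp (t ε, ε) y (u ε) : PerSmooth L))
  rw [hy, mul_smul]
  rfl

theorem hasSize_of_mem_opLie (hL : 0 < L) {t h : ℝ → ℝ} {T : ℝ} (ht : ∀ ε, |t ε| ≤ T)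
    {σ : ℝ} (hh : h =O[𝓝[>] (0 : ℝ)] fun ε => ε ^ σ) {n : ℕ} {x : OpFam L}
    (hx : x ∈ opLie L) {p : ℝ} (hp : p ≤ n * σ - 1) :
    HasSize (fun ε u => (h ε : ℂ) ^ n • (evalOp (t ε, ε) x u : ℝ → ℂ)) p := by
  refine hasSize_step_pow_opZero hL ht hh n (-1) (mem_opLie.1 hx) (fun p => ?_)
    (by push_cast; linarith)
  rw [map_mul, evalOp_epsOp, smul_mul_assoc, one_mul, smul_smul, zpow_neg_one,
    inv_mul_cancel₀ (epos_ne_zero _), one_smul]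

theorem hasSize_of_mem_opSmall (hL : 0 < L) {t h : ℝ → ℝ} {T : ℝ} (ht : ∀ ε, |t ε| ≤ T)
    {σ : ℝ} (hh : h =O[𝓝[>] (0 : ℝ)] fun ε => ε ^ σ) {n : ℕ} {x : OpFam L}
    (hx : x ∈ opSmall L) {p : ℝ} (hp : p ≤ n * σ + 1) :
    HasSize (fun ε u => (h ε : ℂ) ^ n • (evalOp (t ε, ε) x u : ℝ → ℂ)) p := by
  refine hasSize_step_pow_opZero hL ht hh n 1 (mem_opSmall.1 hx) (fun p => ?_)
    (by push_cast; linarith)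
  rw [map_mul, evalOp_epsInv, smul_mul_assoc, one_mul, smul_smul, zpow_one,
    mul_inv_cancel₀ (epos_ne_zero _), one_smul]

theorem mulEnd_stepVar_pow_mul (e : ℝ × ℝ) (n : ℕ) (f : StepFun L) :
    mulEnd e (stepVar ^ n * f) = (e.1 : ℂ) ^ n • mulEnd e f := by
  refine LinearMap.ext fun u => Subtype.ext <| funext fun x => ?_
  change (stepVar ^ n * f : StepFun L) e x * _ = (e.1 : ℂ) ^ n * (f e x * _)
  rw [PFun.mul_apply, PFun.pow_apply, stepVar_apply, mul_assoc]

theorem angAt_stepVar_pow_mul (e : ℝ × ℝ) (ε : ℝ) (k n : ℕ) (f : StepFun L) :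
    angAt e ε k (stepVar ^ n * f) = (e.1 : ℂ) ^ n • angAt e ε k f := by
  change (1 / 2 : ℂ) • (mulEnd e _ * _ + _ * mulEnd e _) = _
  rw [mulEnd_stepVar_pow_mul, smul_mul_assoc, mul_smul_comm, ← smul_add, smul_comm]
  rfl

/-- The size of a quantised symbol is determined by the orders in `h` of its coefficients. -/
theorem hasSize_quantAt (hL : 0 < L) {t h : ℝ → ℝ} {T : ℝ} (ht : ∀ ε, |t ε| ≤ T) {σ : ℝ}
    (hσ0 : 0 < σ) (hσ : σ ≤ 1) (hh : h =O[𝓝[>] (0 : ℝ)] fun ε => ε ^ σ) (N : ℕ)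
    (p : ℕ × ℕ →₀ StepFun L) (hp : ∀ jk : ℕ × ℕ, stepVar ^ (N - jk.1) ∣ p jk) :
    HasSize (fun ε u => (quantAt (h ε, t ε) ε p u : ℝ → ℂ)) (N * σ - 1) := by
  intro u hu
  -- Positivity of `σ` keeps the step bounded, so the coefficients are evaluated on a compact set of
  -- parameters.
  have h1 : (fun ε : ℝ => ε ^ σ) =O[𝓝[>] (0 : ℝ)] fun _ => (1 : ℝ) := by
    simpa only [Real.rpow_zero] using isBigO_rpow_of_le hσ0.le
  obtain ⟨C, hC⟩ := (hh.trans h1).bound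
  have hq : ∀ᶠ ε in 𝓝[>] (0 : ℝ), ‖(h ε, t ε)‖ ≤ max C T := by
    filter_upwards [hC] with ε hε
    rw [norm_one, mul_one] at hε
    exact max_le_max hε (ht ε)
  simp only [quantAt_apply_eq_sum]
  generalize p.support = s
  induction s using Finset.induction_on with
  | empty =>
    refine IsBigO.of_bound 0 (Eventually.of_forall fun ε => ?_)
    simp [l2norm]
  | insert a s has ih =>
    obtain ⟨g, hg⟩ := hp a
    simp only [Finset.sum_insert has, LinearMap.add_apply]
    refine isBigO_l2norm_add hL ?_ ih
    have hc : ∀ᶠ ε : ℝ in 𝓝[>] (0 : ℝ), ‖((ε : ℂ) ^ a.1 * (ε : ℂ)⁻¹)‖ = ε ^ ((a.1 : ℝ) - 1) := by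
      filter_upwards [eventually_pos] with ε hε
      rw [norm_mul, norm_pow, norm_inv, Complex.norm_real, Real.norm_of_nonneg hε.le,
        Real.rpow_sub hε, Real.rpow_natCast, Real.rpow_one, div_eq_mul_inv]
    -- As `σ ≤ 1`, each of the `j` missing powers of `h` is compensated by a power of `ε`. For `j >
    -- N` the truncated difference is `0` and the inequality still holds.
    have hle : (N : ℝ) * σ - 1 ≤ ((N - a.1 : ℕ) : ℝ) * σ + ((a.1 : ℝ) - 1) := by
      have h1 : (N : ℝ) ≤ ((N - a.1 : ℕ) : ℝ) + a.1 := by exact_mod_cast (by omega)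
      nlinarith [Nat.cast_nonneg (α := ℝ) a.1]
    refine (isBigO_l2norm_smul_rpow (hu.angAt hL hq g a.2)
      (isBigO_step_pow hh (N - a.1) _ hc hle)).congr_left fun ε => ?_
    rw [hg, angAt_stepVar_pow_mul, smul_smul, mul_comm]
    rfl

end Norm
end MagnusZassenhaus
namespace MagnusZassenhaus

/-! ### Taylor expansion of quantised symbols -/

section Expansion

variable {L : ℝ}

/-- The Taylor coefficients in the time step, as linear maps. -/
def taylorLin (n : ℕ) : StepFun L →ₗ[ℂ] CoeffFun L where
  toFun := taylorCoeff n
  map_add' := taylorCoeff_add n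
  map_smul' c f := by
    have h := map_smul (taylor (L := L)) c f
    have h' := congrArg (PowerSeries.coeff n) h
    rw [coeff_taylor] at h'
    rw [h', ← coeff_taylor]
    rfl

theorem taylorLin_apply (n : ℕ) (f : StepFun L) :
    taylorLin n f = PowerSeries.coeff n (taylor f) := (coeff_taylor n f).symm

/-- The Taylor coefficients of a symbol. -/
def symbolCoeff (n : ℕ) : (ℕ × ℕ →₀ StepFun L) →ₗ[ℂ] (ℕ × ℕ →₀ CoeffFun L) :=
  Finsupp.mapRange.linearMap (taylorLin n)

theorem symbolCoeff_single (n : ℕ) (jk : ℕ × ℕ) (f : StepFun L) :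
    symbolCoeff n (Finsupp.single jk f) = Finsupp.single jk (taylorLin n f) := by
  rw [symbolCoeff, Finsupp.mapRange.linearMap_apply, Finsupp.mapRange_single]

theorem symbolCoeff_apply (n : ℕ) (p : ℕ × ℕ →₀ StepFun L) (jk : ℕ × ℕ) :
    symbolCoeff n p jk = taylorLin n (p jk) := by
  rw [symbolCoeff, Finsupp.mapRange.linearMap_apply, Finsupp.mapRange_apply]

theorem angAt_constStep (h t ε : ℝ) (k : ℕ) (c : CoeffFun L) :
    angAt (h, t) ε k (constStep c) = angAt t ε k c := rfl

theorem angAt_expansion (h t ε : ℝ) (k N : ℕ) (f : StepFun L) :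
    angAt (h, t) ε k f = ∑ n ∈ Finset.range N, (h : ℂ) ^ n • angAt t ε k (taylorLin n f) +
      (h : ℂ) ^ N • angAt (h, t) ε k (hadamard^[N] f) := by
  conv_lhs => rw [taylor_expansion f N]
  rw [map_add, map_sum, angAt_stepVar_pow_mul]
  congr 1
  refine Finset.sum_congr rfl fun n _ => ?_
  rw [mul_comm, angAt_stepVar_pow_mul, angAt_constStep, taylorLin_apply]

/-- This bounds the Taylor remainder as `h → 0`. Regarding `u` as a constant family turns the
expression into a value of a `PFun`, which is continuous in `h`. -/
theorem continuous_angAt (t ε : ℝ) (k : ℕ) (f : StepFun L) (u : PerSmooth L) (x : ℝ) :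
    Continuous fun h : ℝ => (angAt (h, t) ε k f u : ℝ → ℂ) x := by
  let U : StepFun L := PFun.mk (fun _ => u) ((PerSmooth.contDiff u).comp contDiff_snd)
    fun _ => u.2.2
  have e : ∀ h, (angAt (h, t) ε k f u : ℝ → ℂ) x = (1 / 2 : ℂ) * ((ε : ℂ) ^ k *
      (f * δ^[k] U : StepFun L) (h, t) x + (ε : ℂ) ^ k * (δ^[k] (f * U) : StepFun L) (h, t) x) := by
    intro h
    rw [PFun.mul_apply, δ_iterate_apply, δ_iterate_apply]
    change (((1 / 2 : ℂ) • (mulEnd (h, t) f * ((ε : ℂ) • derivEnd) ^ k +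
      ((ε : ℂ) • derivEnd) ^ k * mulEnd (h, t) f) : Module.End ℂ (PerSmooth L)) u).1 x = _
    rw [smul_pow, mul_smul_comm, smul_mul_assoc]
    change (1 / 2 : ℂ) * ((ε : ℂ) ^ k * (f (h, t) x * ((derivEnd ^ k) u : ℝ → ℂ) x) +
      (ε : ℂ) ^ k * ((derivEnd ^ k) (mulEnd (h, t) f u) : ℝ → ℂ) x) = _
    rw [derivEnd_pow_apply, derivEnd_pow_apply]
    rfl
  simp only [e]
  have c1 := PFun.continuous_param (f * δ^[k] U : StepFun L) t x
  have c2 := PFun.continuous_param (δ^[k] (f * U) : StepFun L) t x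
  fun_prop

/-- Quantised symbols are expanded coefficient by coefficient. -/
theorem hasExpansion_quantAt (t ε : ℝ) (p : ℕ × ℕ →₀ StepFun L) :
    HasExpansion (fun h u => (quantAt (h, t) ε p u : ℝ → ℂ))
      (PowerSeries.mk fun n => quantAt t ε (symbolCoeff n p)) := by
  intro u x N
  simp only [PowerSeries.coeff_mk]
  induction p using Finsupp.induction_linear with
  | zero =>
    simp only [map_zero, LinearMap.zero_apply]
    refine IsBigO.of_bound 0 (Eventually.of_forall fun h => ?_)
    simp
  | add p q hp hq =>
    refine (hp.add hq).congr_left fun h => ?_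
    simp only [map_add, LinearMap.add_apply, Submodule.coe_add, Pi.add_apply, mul_add,
      Finset.sum_add_distrib]
    ring
  | single jk f =>
    obtain ⟨j, k⟩ := jk
    have e : ∀ h : ℝ, (quantAt (h, t) ε (Finsupp.single (j, k) f) u : ℝ → ℂ) x -
        ∑ n ∈ Finset.range N, (h : ℂ) ^ n *
          (quantAt t ε (symbolCoeff n (Finsupp.single (j, k) f)) u : ℝ → ℂ) x =
        (h : ℂ) ^ N * (((ε : ℂ) ^ j * (ε : ℂ)⁻¹) *
          (angAt (h, t) ε k (hadamard^[N] f) u : ℝ → ℂ) x) := by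
      intro h
      simp only [symbolCoeff_single, quantAt_single]
      rw [angAt_expansion h t ε k N f]
      simp only [smul_add, LinearMap.add_apply, LinearMap.smul_apply, Submodule.coe_add,
        Submodule.coe_smul, Pi.add_apply, Pi.smul_apply, smul_eq_mul, LinearMap.sum_apply,
        Submodule.coe_sum, Finset.sum_apply, Finset.mul_sum]
      rw [add_sub_right_comm, ← Finset.sum_sub_distrib, Finset.sum_eq_zero, zero_add]
      · ring
      · intro n _; ring
    simp only [e]
    have h1 : (fun h : ℝ => (h : ℂ) ^ N) =O[𝓝 (0 : ℝ)] fun h => h ^ N :=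
      IsBigO.of_bound 1 (Eventually.of_forall fun h => by simp)
    have h2 := ((continuous_angAt t ε k (hadamard^[N] f) u x).tendsto 0).isBigO_one ℝ
    simpa using h1.mul (h2.const_mul_left ((ε : ℂ) ^ j * (ε : ℂ)⁻¹))

/-- Quantisation of symbols that do not depend on the time step, as a family of operators. -/
def quant : (ℕ × ℕ →₀ CoeffFun L) →ₗ[ℂ] OpFam L :=
  LinearMap.pi fun q : ℝ × ℝ => quantAt q.1 (epos q.2)

theorem evalOp_quant (q : ℝ × ℝ) (p : ℕ × ℕ →₀ CoeffFun L) :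
    evalOp q (quant p) = quantAt q.1 (epos q.2) p := rfl

theorem quant_single (j k : ℕ) (f : CoeffFun L) :
    quant (Finsupp.single (j, k) f) = (1 / 2 : ℂ) • (epsInv * (epsOp ^ j *
      (mulFam f * epsD ^ k + epsD ^ k * mulFam f))) := by
  refine OpFam.ext fun q => ?_
  rw [evalOp_quant, quantAt_single]
  simp only [map_smul, map_mul, map_add, map_pow, evalOp_epsInv, evalOp_epsOp, evalOp_epsD,
    evalOp_mulFam]
  rw [smul_pow _ (1 : Module.End ℂ (PerSmooth L)), one_pow, smul_mul_assoc, one_mul, smul_mul_assoc,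
    one_mul]
  have e : angAt q.1 (epos q.2) k f = (1 / 2 : ℂ) •
      (mulEnd q.1 f * ((epos q.2 : ℂ) • derivEnd) ^ k +
    ((epos q.2 : ℂ) • derivEnd) ^ k * mulEnd q.1 f) := rfl
  rw [e]
  simp only [smul_smul]
  congr 1
  ring

theorem quant_single_mem_opLie (j k : ℕ) (f : CoeffFun L) :
    quant (Finsupp.single (j, k) f) ∈ opLie L := by
  rw [quant_single]
  exact Submodule.smul_mem _ _ (epsInv_mul_mem (mul_mem (pow_mem epsOp_mem j)
    (add_mem (mul_mem (mulFam_mem f) (pow_mem epsD_mem k))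
      (mul_mem (pow_mem epsD_mem k) (mulFam_mem f)))))

theorem quant_mem_opLie (p : ℕ × ℕ →₀ CoeffFun L) : quant p ∈ opLie L := by
  induction p using Finsupp.induction_linear with
  | zero => rw [map_zero]; exact zero_mem _
  | add p q hp hq => rw [map_add]; exact add_mem hp hq
  | single jk f => exact quant_single_mem_opLie jk.1 jk.2 f

/-- The quantisation carries a factor `ε⁻¹`, so a symbol with at least two explicit powers of `ε`
keeps one. -/
theorem quant_single_mem_opSmall (j k : ℕ) (f : CoeffFun L) :
    quant (Finsupp.single (j + 2, k) f) ∈ opSmall L := by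
  rw [quant_single, pow_succ', pow_succ', mul_assoc, ← mul_assoc epsInv, epsInv_mul_epsOp, one_mul,
    mul_assoc]
  exact Submodule.smul_mem _ _ (epsOp_mul_mem (mul_mem (pow_mem epsOp_mem j)
    (add_mem (mul_mem (mulFam_mem f) (pow_mem epsD_mem k))
      (mul_mem (pow_mem epsD_mem k) (mulFam_mem f)))))

-- Moving `(ε∂)ᵏ` to the right of `f` produces a first-order term, and averaging with `f (ε∂)ᵏ`
-- leaves half of it. This is the correction built into `symQuant`, so the two quantisations differ
-- at relative order `ε²` only.
open Polynomial in
theorem quant_single_sub_lieQuant_mem (k : ℕ) (f : CoeffFun L) :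
    quant (Finsupp.single (0, k) f) - lieQuant (C f * X ^ k) ∈ opSmall L := by
  obtain ⟨z, hz, e⟩ := stdQuant_mul (X ^ k) (C f)
  have h1 : stdQuant (X ^ k) = (epsD ^ k : OpFam L) := by
    rw [← monomial_one_right_eq_X_pow, stdQuant_monomial, map_one, one_mul]
  have h2 : stdQuant (C f) = mulFam f := by simpa using stdQuant_monomial 0 f
  have h3 : stdQuant (C f * X ^ k) = mulFam f * epsD ^ k := by
    rw [C_mul_X_pow_eq_monomial, stdQuant_monomial]
  rw [h1, h2, mul_comm (X ^ k) (C f), h3] at e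
  have h4 : derivative (symbδ (C f * X ^ k)) = derivative (X ^ k) * symbδ (C f) := by
    rw [C_mul_X_pow_eq_monomial, symbδ_monomial, symbδ_C, ← C_mul_X_pow_eq_monomial,
      derivative_C_mul, mul_comm]
  have h5 : quant (Finsupp.single (0, k) f) - lieQuant (C f * X ^ k) = epsOp *
      ((1 / 2 : ℂ) • ((1 / 2 : ℂ) • stdQuant (derivative (derivative (X ^ k)) *
        symbδ (symbδ (C f))) + epsOp * z)) := by
    apply epsOp_cancel
    rw [quant_single, lieQuant, symQuant, h3, h4, e]
    simp only [mul_sub, mul_add, mul_smul_comm, ← mul_assoc, epsOp_mul_epsInv, one_mul, pow_succ,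
      pow_zero, smul_add]
    module
  rw [h5]
  exact epsOp_mul_mem (Subalgebra.smul_mem _ (add_mem (Subalgebra.smul_mem _ (stdQuant_mem _) _)
    (mul_mem epsOp_mem hz)) _)

end Expansion
end MagnusZassenhaus
namespace MagnusZassenhaus

/-! ### The integrals of the potential as smooth families -/

section Represent

variable {L : ℝ}

/-- A smooth family with values in the real functions `f h t`. -/
def Represents (g : StepFun L) (f : ℝ → ℝ → ℝ → ℝ) : Prop := ∀ h t x, g (h, t) x = f h t x

theorem Represents.add {g g' : StepFun L} {f f' : ℝ → ℝ → ℝ → ℝ} (h : Represents g f)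
    (h' : Represents g' f') : Represents (g + g') fun a t => f a t + f' a t := fun a t x => by
  rw [PFun.add_apply, h, h']; exact (Complex.ofReal_add _ _).symm

theorem Represents.sub {g g' : StepFun L} {f f' : ℝ → ℝ → ℝ → ℝ} (h : Represents g f)
    (h' : Represents g' f') : Represents (g - g') fun a t => f a t - f' a t := fun a t x => by
  rw [PFun.sub_apply, h, h']; exact (Complex.ofReal_sub _ _).symm

theorem Represents.mul {g g' : StepFun L} {f f' : ℝ → ℝ → ℝ → ℝ} (h : Represents g f)
    (h' : Represents g' f') : Represents (g * g') fun a t => f a t * f' a t := fun a t x => by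
  rw [PFun.mul_apply, h, h']; exact (Complex.ofReal_mul _ _).symm

theorem Represents.pow {g : StepFun L} {f : ℝ → ℝ → ℝ → ℝ} (h : Represents g f) (n : ℕ) :
    Represents (g ^ n) fun a t => f a t ^ n := fun a t x => by
  rw [PFun.pow_apply, h]; exact (Complex.ofReal_pow _ _).symm

theorem Represents.smul {g : StepFun L} {f : ℝ → ℝ → ℝ → ℝ} (h : Represents g f) (c : ℝ) :
    Represents ((c : ℂ) • g) fun a t => c • f a t := fun a t x => by
  rw [PFun.smul_apply, h]; exact (Complex.ofReal_mul _ _).symm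

theorem Represents.one : Represents (1 : StepFun L) 1 := fun _ _ _ => by simp

theorem Represents.deriv {g : StepFun L} {f : ℝ → ℝ → ℝ → ℝ} (h : Represents g f) :
    Represents (δ g) fun a t => _root_.deriv (f a t) := fun a t x => by
  have h1 : HasDerivAt (g (a, t)) (_root_.deriv (g (a, t)) x) x :=
    (g.differentiable_slice (a, t) x).hasDerivAt
  have h2 : HasDerivAt (f a t) (_root_.deriv (g (a, t)) x).re x := by
    have := (Complex.reCLM.hasFDerivAt.comp_hasDerivAt x h1)
    refine this.congr_of_eventuallyEq (Eventually.of_forall fun y => ?_)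
    simp [h a t y]
  have h3 : HasDerivAt (g (a, t)) ((_root_.deriv (g (a, t)) x).re : ℂ) x :=
    h2.ofReal_comp.congr_of_eventuallyEq (Eventually.of_forall fun y => h a t y)
  change _root_.deriv (g (a, t)) x = ((_root_.deriv (f a t) x : ℝ) : ℂ)
  rw [h2.deriv, h3.deriv, Complex.ofReal_re]

theorem Represents.iteratedDeriv {g : StepFun L} {f : ℝ → ℝ → ℝ → ℝ} (h : Represents g f)
    (k : ℕ) : Represents (δ^[k] g) fun a t => iteratedDeriv k (f a t) := by
  induction k with
  | zero => simpa using h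
  | succ k ih =>
    simp only [Function.iterate_succ_apply', iteratedDeriv_succ]
    exact ih.deriv

/-- The even part in the time step. -/
def evenStep (f : StepFun L) : StepFun L := (1 / 2 : ℂ) • (f + reflectStep f)

/-- The odd part in the time step. -/
def oddStep (f : StepFun L) : StepFun L := (1 / 2 : ℂ) • (f - reflectStep f)

/-- Powers of Bernoulli polynomials as weights. -/
def bernWeight (j k : ℕ) : ℝ × ℝ → ℝ := fun p => Polynomial.aeval p.1 (Polynomial.bernoulli j) ^ k

theorem contDiff_bernWeight (j k : ℕ) : ContDiff ℝ ∞ (bernWeight j k) :=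
  ((Polynomial.contDiff_aeval _ _).comp contDiff_fst).pow k

/-- The family of line integrals `μ_{j,k}`. -/
def momStep (F : StepFun L) (j k : ℕ) : StepFun L :=
  stepVar ^ (j * k + 1) * weighted (bernWeight j k) (contDiff_bernWeight j k) F 1

/-- The substitution `ζ = h s` gives `h ^ (j k)` from the Bernoulli factors and one `h` from the
measure. The case `h = 0` is separate because of the quotient `ζ / h`. -/
theorem represents_momStep {F : StepFun L} {W : ℝ → ℝ → ℝ → ℝ}
    (hF : ∀ h t x, F (h, t) x = W t x h) (j k : ℕ) :
    Represents (momStep F j k) fun h t => mom (W t) j k h := by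
  intro h t x
  rw [momStep, PFun.mul_apply, PFun.pow_apply, stepVar_apply, weighted_apply]
  simp only [hF, PFun.one_apply, mul_one, ← Complex.ofReal_mul, intervalIntegral.integral_ofReal,
    intervalIntegral.integral_const, sub_zero, one_smul, bernWeight, mom]
  rcases eq_or_ne h 0 with rfl | hh
  · simp
  have e := intervalIntegral.smul_integral_comp_mul_left (a := 0) (b := 1)
    (fun ζ => bern j h ζ ^ k * W t x (ζ - h / 2)) h
  rw [mul_zero, mul_one] at e
  rw [← e, smul_eq_mul, pow_succ', mul_assoc, Complex.ofReal_mul]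
  congr 1
  rw [← Complex.ofReal_pow, ← Complex.ofReal_mul, ← intervalIntegral.integral_const_mul]
  congr 2
  funext s
  rw [bern, mul_div_cancel_left₀ _ hh, mul_pow, ← pow_mul, mul_assoc]
  congr 3
  ring

/-- The family of integrals over triangles with the weight `w`. -/
def triStep (w : ℝ × ℝ → ℝ) (hw : ContDiff ℝ ∞ w) (d : ℕ) (f g : StepFun L) : StepFun L :=
  stepVar ^ (d + 2) * weighted w hw f g

/-- The map `ζ = h s`, `ξ = h s r` carries the unit square to the triangle with Jacobian `h² s`. The
kernel weights are homogeneous of degree `d`, and the factor `s` is absorbed in `w`. -/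
theorem tri_eq_integral {w : ℝ × ℝ → ℝ} {d : ℕ} {f : ℝ → ℝ → ℝ → ℝ}
    (hf : ∀ h s r, f h (h * s) (h * s * r) * s = h ^ d * w (s, r)) (K : ℝ → ℝ → ℝ → ℝ) (h x : ℝ) :
    tri f K h x = h ^ (d + 2) * ∫ s in (0 : ℝ)..1, ∫ r in (0 : ℝ)..1,
      w (s, r) * K x (h * (s - 1 / 2)) (h * (s * r - 1 / 2)) := by
  have e := fun g : ℝ → ℝ => intervalIntegral.smul_integral_comp_mul_left (a := 0) (b := 1) g
  simp only [mul_zero, mul_one] at e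
  rw [tri, ← e _ h, smul_eq_mul, ← intervalIntegral.integral_const_mul,
    ← intervalIntegral.integral_const_mul]
  congr 1
  funext s
  rw [← e _ (h * s), smul_eq_mul, ← intervalIntegral.integral_const_mul,
    ← intervalIntegral.integral_const_mul, ← intervalIntegral.integral_const_mul]
  congr 1
  funext r
  rw [show h * s - h / 2 = h * (s - 1 / 2) by ring,
    show h * s * r - h / 2 = h * (s * r - 1 / 2) by ring]
  linear_combination (h ^ 2 * K x (h * (s - 1 / 2)) (h * (s * r - 1 / 2))) * hf h s r

theorem integral_smul (c : ℂ) {E : Type} [NormedAddCommGroup E] [NormedSpace ℝ E] [ProperSpace E]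
    (f : PFun (ℝ × E) L) : (c • f).integral = c • f.integral := by
  ext e x
  exact intervalIntegral.integral_const_mul c fun s => f (s, e) x

/-- The even part of a triangle integral. -/
def triEven (w : ℝ × ℝ → ℝ) (hw : ContDiff ℝ ∞ w) (d : ℕ) (f g : StepFun L) : StepFun L :=
  (1 / 2 : ℂ) • (triStep w hw d f g + triStep w hw d (reflectStep f) (reflectStep g))

/-- The odd part of a triangle integral. -/
def triOdd (w : ℝ × ℝ → ℝ) (hw : ContDiff ℝ ∞ w) (d : ℕ) (f g : StepFun L) : StepFun L :=
  (1 / 2 : ℂ) • (triStep w hw d f g - triStep w hw d (reflectStep f) (reflectStep g))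

section Kernels

variable {w : ℝ × ℝ → ℝ} {d : ℕ} {f : ℝ → ℝ → ℝ → ℝ} {F G : StepFun L}
  {K : ℝ → ℝ → ℝ → ℝ → ℝ}

theorem represents_triStep (hw : ContDiff ℝ ∞ w)
    (hf : ∀ h s r, f h (h * s) (h * s * r) * s = h ^ d * w (s, r))
    (hK : ∀ t x p q, F (p, t) x * G (q, t) x = K t x p q) :
    Represents (triStep w hw d F G) fun h t => tri f (K t) h := by
  intro h t x
  change _ = ((tri f (K t) h x : ℝ) : ℂ)
  rw [triStep, PFun.mul_apply, PFun.pow_apply, stepVar_apply, weighted_apply, tri_eq_integral hf]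
  simp only [mul_assoc, hK, ← Complex.ofReal_mul, intervalIntegral.integral_ofReal]
  rw [← Complex.ofReal_pow, ← Complex.ofReal_mul]

theorem represents_triEven (hw : ContDiff ℝ ∞ w)
    (hf : ∀ h s r, f h (h * s) (h * s * r) * s = h ^ d * w (s, r))
    (hK : ∀ t x p q, F (p, t) x * G (q, t) x = K t x p q) :
    Represents (triEven w hw d F G) fun h t => tri f (evenKer (K t)) h := by
  intro h t x
  change _ = ((tri f (evenKer (K t)) h x : ℝ) : ℂ)
  have e : triEven w hw d F G = stepVar ^ (d + 2) * ((1 / 2 : ℂ) •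
      (weightFun w hw * outerVar F * innerVar G + weightFun w hw * outerVar (reflectStep F) *
        innerVar (reflectStep G)) : PFun (ℝ × (ℝ × (ℝ × ℝ))) L).integral.integral := by
    rw [integral_smul, integral_smul, PFun.integral_add, PFun.integral_add, mul_smul_comm, mul_add]
    rfl
  rw [e, PFun.mul_apply, PFun.pow_apply, stepVar_apply, tri_eq_integral hf, Complex.ofReal_mul,
    Complex.ofReal_pow, ← intervalIntegral.integral_ofReal, PFun.integral_apply]
  congr 2
  funext s
  rw [← intervalIntegral.integral_ofReal, PFun.integral_apply]
  congr 1
  funext r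
  rw [evenKer, Complex.ofReal_mul, Complex.ofReal_div, Complex.ofReal_add, ← hK, ← hK]
  change (1 / 2 : ℂ) * ((w (s, r) : ℂ) * F (h * (s - 1 / 2), t) x * G (h * (s * r - 1 / 2), t) x +
    (w (s, r) : ℂ) * F (-(h * (s - 1 / 2)), t) x *
    G (-(h * (s * r - 1 / 2)), t) x) = _
  push_cast
  ring

theorem represents_triOdd (hw : ContDiff ℝ ∞ w)
    (hf : ∀ h s r, f h (h * s) (h * s * r) * s = h ^ d * w (s, r))
    (hK : ∀ t x p q, F (p, t) x * G (q, t) x = K t x p q) :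
    Represents (triOdd w hw d F G) fun h t => tri f (oddKer (K t)) h := by
  intro h t x
  change _ = ((tri f (oddKer (K t)) h x : ℝ) : ℂ)
  have e : triOdd w hw d F G = stepVar ^ (d + 2) * ((1 / 2 : ℂ) •
      (weightFun w hw * outerVar F * innerVar G + (-1 : ℂ) • (weightFun w hw *
        outerVar (reflectStep F) * innerVar (reflectStep G))) :
          PFun (ℝ × (ℝ × (ℝ × ℝ))) L).integral.integral := by
    rw [integral_smul, integral_smul, PFun.integral_add, PFun.integral_add, integral_smul,
      integral_smul, mul_smul_comm, mul_add, mul_smul_comm, neg_one_smul, ← sub_eq_add_neg]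
    rfl
  rw [e, PFun.mul_apply, PFun.pow_apply, stepVar_apply, tri_eq_integral hf, Complex.ofReal_mul,
    Complex.ofReal_pow, ← intervalIntegral.integral_ofReal, PFun.integral_apply]
  congr 2
  funext s
  rw [← intervalIntegral.integral_ofReal, PFun.integral_apply]
  congr 1
  funext r
  rw [oddKer, Complex.ofReal_mul, Complex.ofReal_div, Complex.ofReal_sub, ← hK, ← hK]
  change (1 / 2 : ℂ) * ((w (s, r) : ℂ) * F (h * (s - 1 / 2), t) x * G (h * (s * r - 1 / 2), t) x +
    (-1 : ℂ) * ((w (s, r) : ℂ) * F (-(h * (s - 1 / 2)), t) x *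
    G (-(h * (s * r - 1 / 2)), t) x)) = _
  push_cast
  ring

end Kernels

theorem reflectStep_weighted (w : ℝ × ℝ → ℝ) (hw : ContDiff ℝ ∞ w) (f g : StepFun L) :
    reflectStep (weighted w hw f g) = weighted w hw (reflectStep f) (reflectStep g) := by
  ext ⟨h, t⟩ x
  rw [reflectStep_apply, weighted_apply, weighted_apply]
  simp only [reflectStep_apply, neg_mul]

theorem reflectStep_stepVar : reflectStep (stepVar : StepFun L) = -stepVar := by
  ext ⟨a, t⟩ x; simp

theorem reflectStep_reflectStep (f : StepFun L) : reflectStep (reflectStep f) = f := by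
  ext ⟨a, t⟩ x; simp

theorem reflectStep_evenStep (f : StepFun L) : reflectStep (evenStep f) = evenStep f := by
  rw [evenStep, map_smul, map_add, reflectStep_reflectStep, add_comm]

theorem reflectStep_oddStep (f : StepFun L) : reflectStep (oddStep f) = -oddStep f := by
  rw [oddStep, map_smul, map_sub, reflectStep_reflectStep, ← smul_neg, neg_sub]

theorem reflectStep_δ_iterate (k : ℕ) (f : StepFun L) :
    reflectStep (δ^[k] f) = δ^[k] (reflectStep f) := by
  induction k with
  | zero => rfl
  | succ k ih => rw [Function.iterate_succ_apply', Function.iterate_succ_apply', ← ih]; rfl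

theorem weighted_neg_left (w : ℝ × ℝ → ℝ) (hw : ContDiff ℝ ∞ w) (f g : StepFun L) :
    weighted w hw (-f) g = -weighted w hw f g := by
  ext ⟨h, t⟩ x
  rw [PFun.neg_apply, weighted_apply, weighted_apply]
  simp only [PFun.neg_apply, mul_neg, neg_mul, intervalIntegral.integral_neg]

theorem reflectStep_momStep_even (F : StepFun L) {j k : ℕ} (h : Even (j * k)) :
    reflectStep (momStep (evenStep F) j k) = -momStep (evenStep F) j k := by
  rw [momStep, map_mul, map_pow, reflectStep_stepVar, reflectStep_weighted, reflectStep_evenStep,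
    map_one, h.add_one.neg_pow, neg_mul]

theorem reflectStep_momStep_odd (F : StepFun L) {j k : ℕ} (h : Odd (j * k)) :
    reflectStep (momStep (oddStep F) j k) = -momStep (oddStep F) j k := by
  rw [momStep, map_mul, map_pow, reflectStep_stepVar, reflectStep_weighted, reflectStep_oddStep,
    map_one, h.add_one.neg_pow, weighted_neg_left, mul_neg]

theorem reflectStep_triEven (w : ℝ × ℝ → ℝ) (hw : ContDiff ℝ ∞ w) {d : ℕ} (hd : Odd d)
    (f g : StepFun L) : reflectStep (triEven w hw d f g) = -triEven w hw d f g := by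
  have h : Odd (d + 2) := hd.add_even even_two
  simp only [triEven, triStep, map_smul, map_add, map_mul, map_pow, reflectStep_stepVar,
    reflectStep_weighted, reflectStep_reflectStep, h.neg_pow, neg_mul]
  module

theorem reflectStep_triOdd (w : ℝ × ℝ → ℝ) (hw : ContDiff ℝ ∞ w) {d : ℕ} (hd : Even d)
    (f g : StepFun L) : reflectStep (triOdd w hw d f g) = -triOdd w hw d f g := by
  have h : Even (d + 2) := hd.add even_two
  simp only [triOdd, triStep, map_smul, map_sub, map_mul, map_pow, reflectStep_stepVar,
    reflectStep_weighted, reflectStep_reflectStep, h.neg_pow]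
  module

theorem triStep_add {w w' w'' : ℝ × ℝ → ℝ} (h : ∀ p, w'' p = w p + w' p) (hw : ContDiff ℝ ∞ w)
    (hw' : ContDiff ℝ ∞ w') (hw'' : ContDiff ℝ ∞ w'') (d : ℕ) (f g : StepFun L) :
    triStep w'' hw'' d f g = triStep w hw d f g + triStep w' hw' d f g := by
  have e : (weightFun w'' hw'' : PFun _ L) = weightFun w hw + weightFun w' hw' := by
    ext q x
    simp [weightFun_apply, h]
  rw [triStep, weighted, e, add_mul, add_mul, PFun.integral_add, PFun.integral_add, mul_add]
  rfl

/-- Reversing both time arguments differs from reversing `h` only through the prefactor `h ^ (d +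
2)`. The parity of the kernel thus selects the orders in `h` according to the parity of `d + n`. -/
theorem triStep_reflectStep (w : ℝ × ℝ → ℝ) (hw : ContDiff ℝ ∞ w) (d : ℕ) (f g : StepFun L) :
    triStep w hw d (reflectStep f) (reflectStep g) =
      (-1 : ℂ) ^ d • reflectStep (triStep w hw d f g) := by
  have h : (-1 : ℂ) ^ d * (-1) ^ d = 1 := by rw [← mul_pow]; norm_num
  have e : (-stepVar : StepFun L) ^ (d + 2) = (-1 : ℂ) ^ d • stepVar ^ (d + 2) := by
    ext q x
    simp only [PFun.pow_apply, PFun.neg_apply, PFun.smul_apply]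
    rw [neg_pow]; ring
  rw [triStep, triStep, map_mul, map_pow, reflectStep_stepVar, reflectStep_weighted, e,
    smul_mul_assoc, smul_smul, h, one_smul]

end Represent
end MagnusZassenhaus
namespace MagnusZassenhaus

/-! ### Taylor coefficients of the integrals -/

section Coefficients

variable {L : ℝ}

theorem taylorLin_stepVar_pow_mul (n m : ℕ) (g : StepFun L) :
    taylorLin n (stepVar ^ m * g) = if m ≤ n then taylorLin (n - m) g else 0 := by
  rw [taylorLin_apply, map_mul, map_pow, taylor_stepVar, PowerSeries.coeff_X_pow_mul',
    taylorLin_apply]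

theorem taylorLin_mul (n : ℕ) (f g : StepFun L) :
    taylorLin n (f * g) = ∑ p ∈ Finset.HasAntidiagonal.antidiagonal n,
      taylorLin p.1 f * taylorLin p.2 g := taylorCoeff_mul n f g

theorem taylorLin_δ_iterate (n k : ℕ) (f : StepFun L) :
    taylorLin n (δ^[k] f) = δ^[k] (taylorLin n f) := by
  rw [taylorLin_apply, taylorLin_apply, coeff_taylor_δ_iterate]

theorem taylorLin_one (n : ℕ) : taylorLin n (1 : StepFun L) = if n = 0 then 1 else 0 := by
  rw [taylorLin_apply, map_one, PowerSeries.coeff_one]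

theorem taylorLin_reflectStep (n : ℕ) (f : StepFun L) :
    taylorLin n (reflectStep f) = (-1 : ℂ) ^ n • taylorLin n f := by
  rw [taylorLin_apply, taylorLin_apply, coeff_taylor_reflectStep]

theorem taylorLin_eq_zero_of_reflectStep {f : StepFun L} (h : reflectStep f = -f) {n : ℕ}
    (hn : Even n) : taylorLin n f = 0 := by
  have e := taylorLin_reflectStep n f
  rw [h, map_neg, hn.neg_one_pow, one_smul] at e
  have h2 : (2 : ℂ) • taylorLin n f = 0 := by
    rw [two_smul]
    nth_rewrite 1 [← e]
    exact neg_add_cancel _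
  exact (smul_eq_zero_iff_right two_ne_zero).1 h2

theorem taylorLin_evenStep (n : ℕ) (f : StepFun L) :
    taylorLin n (evenStep f) = if Even n then taylorLin n f else 0 := by
  rw [evenStep, map_smul, map_add, taylorLin_reflectStep]
  split_ifs with h
  · rw [h.neg_one_pow]; module
  · rw [(Nat.not_even_iff_odd.1 h).neg_one_pow]; module

theorem taylorLin_oddStep (n : ℕ) (f : StepFun L) :
    taylorLin n (oddStep f) = if Even n then 0 else taylorLin n f := by
  rw [oddStep, map_smul, map_sub, taylorLin_reflectStep]
  split_ifs with h
  · rw [h.neg_one_pow]; module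
  · rw [(Nat.not_even_iff_odd.1 h).neg_one_pow]; module

theorem taylorLin_momStep (n : ℕ) (F : StepFun L) (j k : ℕ) :
    taylorLin n (momStep F j k) = if j * k + 1 ≤ n then
      (moment (bernWeight j k) (n - (j * k + 1)) 0 : ℂ) • taylorLin (n - (j * k + 1)) F else 0 := by
  rw [momStep, taylorLin_stepVar_pow_mul]
  congr 1
  generalize n - (j * k + 1) = m
  rw [show taylorLin m (weighted _ _ F 1) = _ from
    taylorCoeff_weighted (bernWeight j k) (contDiff_bernWeight j k) m F 1]
  rw [Finset.sum_eq_single (m, 0)]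
  · rw [show taylorCoeff 0 (1 : StepFun L) = _ from taylorLin_one 0, if_pos rfl, mul_one]; rfl
  · rintro ⟨p, q⟩ h h'
    have hq : q ≠ 0 := by
      rintro rfl
      exact h' (by simpa using h)
    rw [show taylorCoeff q (1 : StepFun L) = _ from taylorLin_one q, if_neg hq, mul_zero, smul_zero]
  · intro h; simp at h

theorem taylorLin_triStep (n : ℕ) (w : ℝ × ℝ → ℝ) (hw : ContDiff ℝ ∞ w) (d : ℕ) (f g : StepFun L) :
    taylorLin n (triStep w hw d f g) = if d + 2 ≤ n then
      ∑ p ∈ Finset.HasAntidiagonal.antidiagonal (n - (d + 2)),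
        (moment w p.1 p.2 : ℂ) • (taylorLin p.1 f * taylorLin p.2 g) else 0 := by
  rw [triStep, taylorLin_stepVar_pow_mul]
  congr 1
  exact taylorCoeff_weighted w hw _ f g

theorem taylorLin_triEven (n : ℕ) (w : ℝ × ℝ → ℝ) (hw : ContDiff ℝ ∞ w) (d : ℕ) (f g : StepFun L) :
    taylorLin n (triEven w hw d f g) =
      if Even (d + n) then taylorLin n (triStep w hw d f g) else 0 := by
  rw [triEven, map_smul, map_add, triStep_reflectStep, map_smul, taylorLin_reflectStep, smul_smul,
    ← pow_add]
  split_ifs with h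
  · rw [h.neg_one_pow]; module
  · rw [(Nat.not_even_iff_odd.1 h).neg_one_pow]; module

theorem taylorLin_triOdd (n : ℕ) (w : ℝ × ℝ → ℝ) (hw : ContDiff ℝ ∞ w) (d : ℕ) (f g : StepFun L) :
    taylorLin n (triOdd w hw d f g) =
      if Even (d + n) then 0 else taylorLin n (triStep w hw d f g) := by
  rw [triOdd, map_smul, map_sub, triStep_reflectStep, map_smul, taylorLin_reflectStep, smul_smul,
    ← pow_add]
  split_ifs with h
  · rw [h.neg_one_pow]; module
  · rw [(Nat.not_even_iff_odd.1 h).neg_one_pow]; module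

end Coefficients

/-! ### Moments of the weights -/

section Moments

set_option linter.unusedSimpArgs false

theorem integral_add_of_continuous {f g : ℝ → ℝ} (hf : Continuous f) (hg : Continuous g) :
    ∫ x in (0 : ℝ)..1, (f x + g x) = (∫ x in (0 : ℝ)..1, f x) + ∫ x in (0 : ℝ)..1, g x :=
  intervalIntegral.integral_add (hf.intervalIntegrable _ _) (hg.intervalIntegrable _ _)

theorem integral_sub_of_continuous {f g : ℝ → ℝ} (hf : Continuous f) (hg : Continuous g) :
    ∫ x in (0 : ℝ)..1, (f x - g x) = (∫ x in (0 : ℝ)..1, f x) - ∫ x in (0 : ℝ)..1, g x :=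
  intervalIntegral.integral_sub (hf.intervalIntegrable _ _) (hg.intervalIntegrable _ _)

theorem integral_const_mul_id (c : ℝ) : ∫ x in (0 : ℝ)..1, c * x = c / 2 := by
  rw [intervalIntegral.integral_const_mul, integral_id]; ring

theorem integral_neg_id : ∫ x in (0 : ℝ)..1, -x = -(1 / 2) := by
  rw [intervalIntegral.integral_neg, integral_id]; ring

theorem integral_const_add_id (c : ℝ) : ∫ x in (0 : ℝ)..1, (c + x) = c + 1 / 2 := by
  rw [integral_add_of_continuous continuous_const continuous_id', integral_id]; simp

theorem integral_const_sub_id (c : ℝ) : ∫ x in (0 : ℝ)..1, (c - x) = c - 1 / 2 := by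
  rw [integral_sub_of_continuous continuous_const continuous_id', integral_id]; simp

/-- The weight of an integral over a triangle. -/
def triWeight (f : ℝ → ℝ → ℝ → ℝ) : ℝ × ℝ → ℝ := fun p => p.1 * f 1 p.1 (p.1 * p.2)

/-- The weight is the constant one, so the odd moments vanish by symmetry about `s = 1/2`. -/
theorem moments_bernWeight_zero :
    moment (bernWeight 0 0) 0 0 = 1 ∧ moment (bernWeight 0 0) 1 0 = 0 ∧
    moment (bernWeight 0 0) 2 0 = 1 / 12 ∧ moment (bernWeight 0 0) 3 0 = 0 ∧
    moment (bernWeight 0 0) 4 0 = 1 / 80 ∧ moment (bernWeight 0 0) 5 0 = 0 := by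
  simp only [moment, bernWeight]
  ring_nf
  simp (disch := fun_prop) only [sub_zero, one_smul, integral_const_mul_id, integral_neg_id,
    integral_const_add_id, integral_const_sub_id,
    integral_add_of_continuous, integral_sub_of_continuous, intervalIntegral.integral_const_mul,
    intervalIntegral.integral_mul_const, intervalIntegral.integral_const, integral_pow, integral_id]
  norm_num

theorem bernWeight_one (k : ℕ) (p : ℝ × ℝ) : bernWeight 1 k p = (p.1 - 1 / 2) ^ k := by
  simp [bernWeight, Polynomial.bernoulli_one]

theorem bernWeight_two (p : ℝ × ℝ) : bernWeight 2 1 p = p.1 ^ 2 - p.1 + 1 / 6 := by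
  simp [bernWeight, Polynomial.bernoulli, Finset.sum_range_succ, bernoulli_two]
  ring

theorem bernWeight_three (p : ℝ × ℝ) :
    bernWeight 3 1 p = p.1 ^ 3 - 3 / 2 * p.1 ^ 2 + 1 / 2 * p.1 := by
  simp [bernWeight, Polynomial.bernoulli, Finset.sum_range_succ, bernoulli_two,
    bernoulli_eq_bernoulli'_of_ne_one]
  ring

theorem moments_bernWeight_one :
    moment (bernWeight 1 1) 0 0 = 0 ∧ moment (bernWeight 1 1) 1 0 = 1 / 12 ∧
    moment (bernWeight 1 1) 2 0 = 0 ∧ moment (bernWeight 1 1) 3 0 = 1 / 80 ∧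
    moment (bernWeight 1 1) 4 0 = 0 ∧ moment (bernWeight 1 2) 0 0 = 1 / 12 := by
  simp only [moment, bernWeight_one]
  ring_nf
  simp (disch := fun_prop) only [sub_zero, one_smul, integral_const_mul_id, integral_neg_id,
    integral_const_add_id, integral_const_sub_id,
    integral_add_of_continuous, integral_sub_of_continuous, intervalIntegral.integral_const_mul,
    intervalIntegral.integral_mul_const, intervalIntegral.integral_const, integral_pow, integral_id]
  norm_num

theorem moments_bernWeight_two :
    moment (bernWeight 2 1) 0 0 = 0 ∧ moment (bernWeight 2 1) 1 0 = 0 ∧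
    moment (bernWeight 2 1) 2 0 = 1 / 180 ∧ moment (bernWeight 2 1) 3 0 = 0 := by
  simp only [moment, bernWeight_two]
  ring_nf
  simp (disch := fun_prop) only [sub_zero, one_smul, integral_const_mul_id, integral_neg_id,
    integral_const_add_id, integral_const_sub_id,
    integral_add_of_continuous, integral_sub_of_continuous, intervalIntegral.integral_const_mul,
    intervalIntegral.integral_mul_const, intervalIntegral.integral_const, integral_pow, integral_id]
  norm_num

theorem moments_bernWeight_three :
    moment (bernWeight 3 1) 0 0 = 0 ∧ moment (bernWeight 3 1) 1 0 = -1 / 120 ∧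
    moment (bernWeight 3 1) 2 0 = 0 := by
  simp only [moment, bernWeight_three]
  ring_nf
  simp (disch := fun_prop) only [sub_zero, one_smul, integral_const_mul_id, integral_neg_id,
    integral_const_add_id, integral_const_sub_id,
    integral_add_of_continuous, integral_sub_of_continuous, intervalIntegral.integral_const_mul,
    intervalIntegral.integral_mul_const, intervalIntegral.integral_const, integral_pow, integral_id]
  norm_num

/-- In total degree zero the moment vanishes; in degrees one and three the moments are antisymmetric
in the two indices. This removes the orders three, four and six of `Λ[ψ]`, whose two kernel factors
are equal. -/
theorem moments_psi :
    moment (triWeight psi) 0 0 = 0 ∧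
    moment (triWeight psi) 0 1 = -1 / 72 ∧ moment (triWeight psi) 1 0 = 1 / 72 ∧
    moment (triWeight psi) 0 2 = 1 / 360 ∧ moment (triWeight psi) 1 1 = -1 / 120 ∧
    moment (triWeight psi) 2 0 = 1 / 360 ∧
    moment (triWeight psi) 0 3 = -1 / 480 ∧ moment (triWeight psi) 1 2 = 1 / 480 ∧
    moment (triWeight psi) 2 1 = -1 / 480 ∧ moment (triWeight psi) 3 0 = 1 / 480 := by
  simp only [moment, triWeight, psi]
  ring_nf
  simp (disch := fun_prop) only [sub_zero, one_smul, integral_const_mul_id, integral_neg_id,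
    integral_const_add_id, integral_const_sub_id,
    integral_add_of_continuous, integral_sub_of_continuous, intervalIntegral.integral_const_mul,
    intervalIntegral.integral_mul_const, intervalIntegral.integral_const, integral_pow, integral_id]
  norm_num

theorem moments_varphi₁_add_phi₁ :
    moment (triWeight (varphi₁ + phi₁)) 0 0 = 1 / 12 ∧
    moment (triWeight (varphi₁ + phi₁)) 0 1 = -7 / 120 ∧
    moment (triWeight (varphi₁ + phi₁)) 1 0 = -1 / 40 ∧
    moment (triWeight (varphi₁ + phi₁)) 0 2 = 1 / 240 ∧
    moment (triWeight (varphi₁ + phi₁)) 1 1 = -1 / 720 ∧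
    moment (triWeight (varphi₁ + phi₁)) 2 0 = 1 / 240 := by
  simp only [moment, triWeight, Pi.add_apply, varphi₁, phi₁]
  ring_nf
  simp (disch := fun_prop) only [sub_zero, one_smul, integral_const_mul_id, integral_neg_id,
    integral_const_add_id, integral_const_sub_id,
    integral_add_of_continuous, integral_sub_of_continuous, intervalIntegral.integral_const_mul,
    intervalIntegral.integral_mul_const, intervalIntegral.integral_const, integral_pow, integral_id]
  norm_num

/-- In total degrees zero and two these are the negatives of the moments in
`moments_varphi₁_add_phi₁` with the indices exchanged. Since the kernel factors are exchanged as
well, the even orders cancel in the sum. -/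
theorem moments_varphi₂_add_phi₂ :
    moment (triWeight (varphi₂ + phi₂)) 0 0 = -1 / 12 ∧
    moment (triWeight (varphi₂ + phi₂)) 0 1 = -1 / 120 ∧
    moment (triWeight (varphi₂ + phi₂)) 1 0 = -1 / 24 ∧
    moment (triWeight (varphi₂ + phi₂)) 0 2 = -1 / 240 ∧
    moment (triWeight (varphi₂ + phi₂)) 1 1 = 1 / 720 ∧
    moment (triWeight (varphi₂ + phi₂)) 2 0 = -1 / 240 := by
  simp only [moment, triWeight, Pi.add_apply, varphi₂, phi₂]
  ring_nf
  simp (disch := fun_prop) only [sub_zero, one_smul, integral_const_mul_id, integral_neg_id,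
    integral_const_add_id, integral_const_sub_id,
    integral_add_of_continuous, integral_sub_of_continuous, intervalIntegral.integral_const_mul,
    intervalIntegral.integral_mul_const, intervalIntegral.integral_const, integral_pow, integral_id]
  norm_num

end Moments
end MagnusZassenhaus
namespace MagnusZassenhaus

/-! ### Symbols of the exponents -/

section Symbols

variable {L : ℝ}

theorem contDiff_psiWeight : ContDiff ℝ ∞ (triWeight psi) := by
  unfold triWeight psi; fun_prop

theorem contDiff_phiWeight :
    ContDiff ℝ ∞ (triWeight varphi₁) ∧ ContDiff ℝ ∞ (triWeight varphi₂) ∧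
    ContDiff ℝ ∞ (triWeight phi₁) ∧ ContDiff ℝ ∞ (triWeight phi₂) ∧
    ContDiff ℝ ∞ (triWeight (varphi₁ + phi₁)) ∧ ContDiff ℝ ∞ (triWeight (varphi₂ + phi₂)) := by
  refine ⟨?_, ?_, ?_, ?_, ?_, ?_⟩ <;> unfold triWeight <;>
    simp only [Pi.add_apply, varphi₁, varphi₂, phi₁, phi₂] <;> fun_prop

theorem contDiff_phiWeight₁ : ContDiff ℝ ∞ (triWeight (varphi₁ + phi₁)) :=
  contDiff_phiWeight.2.2.2.2.1

theorem contDiff_phiWeight₂ : ContDiff ℝ ∞ (triWeight (varphi₂ + phi₂)) :=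
  contDiff_phiWeight.2.2.2.2.2

/-- The symbol `c ε^j h^a g ξ^k`. -/
def symTerm (j k a : ℕ) (c : ℂ) (g : StepFun L) : ℕ × ℕ →₀ StepFun L :=
  Finsupp.single (j, k) (c • (stepVar ^ a * g))

theorem symTerm_add (j k a : ℕ) (c : ℂ) (f g : StepFun L) :
    symTerm j k a c (f + g) = symTerm j k a c f + symTerm j k a c g := by
  rw [symTerm, mul_add, smul_add, Finsupp.single_add]; rfl

theorem ang_zero (f : ℝ → ℝ) (u : ℝ → ℂ) : ang f 0 u = mulOp f u := by
  rw [ang, iteratedDeriv_zero, iteratedDeriv_zero]; module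

theorem ang_one (k : ℕ) (u : ℝ → ℂ) : ang 1 k u = iteratedDeriv k u := by
  have h : ∀ v : ℝ → ℂ, mulOp 1 v = v := fun v => funext fun x => by simp [mulOp]
  rw [ang, h, h]; module

/-- The passage between symbols and the operators of the theorem: `hc` collects the powers of `h`
and `ε` into the scalar printed in front of the term. -/
theorem quantAt_symTerm {h t ε : ℝ} {g : StepFun L} {f : ℝ → ℝ} (hg : ∀ x, g (h, t) x = f x)
    {j k a : ℕ} {c c' : ℂ} (hc : c * (h : ℂ) ^ a * ((ε : ℂ) ^ j * (ε : ℂ)⁻¹ * (ε : ℂ) ^ k) = c')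
    (u : PerSmooth L) : (quantAt (h, t) ε (symTerm j k a c g) u : ℝ → ℂ) = c' • ang f k u := by
  rw [symTerm, quantAt_single, map_smul, angAt_stepVar_pow_mul, ← hc, mul_smul (c * (h : ℂ) ^ a),
    mul_smul ((ε : ℂ) ^ j * (ε : ℂ)⁻¹) ((ε : ℂ) ^ k), ang_eq_angAt hg]
  simp only [LinearMap.smul_apply, Submodule.coe_smul, smul_smul]
  congr 1
  ring

/-- The symbol of the Magnus expansion, in terms of its integrals. -/
def magnusSymbol (m₀ m₁ m₂ m₃ p q : StepFun L) : ℕ × ℕ →₀ StepFun L :=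
  symTerm 0 2 1 Complex.I 1 - symTerm 0 0 0 Complex.I m₀ - symTerm 0 1 0 2 (δ^[1] m₁)
  + symTerm 0 0 0 Complex.I p + symTerm 0 2 0 (2 * Complex.I) (δ^[2] m₂)
  + symTerm 0 1 0 (1 / 6) q + symTerm 0 3 0 (4 / 3) (δ^[3] m₃)
  + symTerm 2 0 0 (1 / 4 * Complex.I) (δ^[4] m₂)

variable (F : StepFun L)

/-- The integral `Λ[ψ]`. -/
def psiInt : StepFun L := triStep (triWeight psi) contDiff_psiWeight 1 (δ^[1] F) (δ^[1] F)

/-- The even part of `Λ[ψ]`. -/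
def psiEven : StepFun L := triEven (triWeight psi) contDiff_psiWeight 1 (δ^[1] F) (δ^[1] F)

/-- The integral `Λ[φ₁ + ϕ₁] + Λ[φ₂ + ϕ₂]`. -/
def phiInt : StepFun L :=
  triStep (triWeight (varphi₁ + phi₁)) contDiff_phiWeight₁ 2 (δ^[1] F) (δ^[2] F) +
  triStep (triWeight (varphi₂ + phi₂)) contDiff_phiWeight₂ 2 (δ^[2] F) (δ^[1] F)

/-- The odd part of `Λ[φ₁ + ϕ₁] + Λ[φ₂ + ϕ₂]`. -/
def phiOdd : StepFun L :=
  triOdd (triWeight (varphi₁ + phi₁)) contDiff_phiWeight₁ 2 (δ^[1] F) (δ^[2] F) +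
  triOdd (triWeight (varphi₂ + phi₂)) contDiff_phiWeight₂ 2 (δ^[2] F) (δ^[1] F)

/-- The symbol of `Θ₄`. -/
def symTheta : ℕ × ℕ →₀ StepFun L := magnusSymbol (momStep F 0 0) (momStep F 1 1) (momStep F 2 1)
  (momStep F 3 1) (psiInt F) (phiInt F)

/-- The symbol of the odd form of `Θ₄`. -/
def symThetaOdd : ℕ × ℕ →₀ StepFun L := magnusSymbol (momStep (evenStep F) 0 0)
  (momStep (oddStep F) 1 1) (momStep (evenStep F) 2 1) (momStep (oddStep F) 3 1) (psiEven F)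
  (phiOdd F)

variable (L) in
/-- The symbol of `W0`. -/
def symW0 : ℕ × ℕ →₀ StepFun L := symTerm 0 2 1 Complex.I 1

/-- The symbol of `W1`. -/
def symW1 : ℕ × ℕ →₀ StepFun L := symTerm 0 0 0 (-Complex.I) (momStep (evenStep F) 0 0)

/-- The symbol of `W2`. -/
def symW2 : ℕ × ℕ →₀ StepFun L :=
  symTerm 0 0 1 (1 / 6 * Complex.I) ((δ^[1] (momStep (evenStep F) 0 0)) ^ 2)
  - symTerm 0 1 0 2 (δ^[1] (momStep (oddStep F) 1 1))
  + symTerm 0 2 2 (1 / 6 * Complex.I) (δ^[2] (momStep (evenStep F) 0 0))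

/-- The symbol of `W3`. -/
def symW3 : ℕ × ℕ →₀ StepFun L :=
  let m : ℕ → StepFun L := fun k => δ^[k] (momStep (evenStep F) 0 0)
  let n : ℕ → StepFun L := fun k => δ^[k] (momStep (oddStep F) 1 1)
  symTerm 0 0 0 Complex.I (psiEven F)
  - symTerm 2 0 2 (1 / 24 * Complex.I) (m 4)
  - symTerm 0 0 0 (1 / 6 * Complex.I) (m 1 ^ 2 * δ^[2] (momStep (evenStep F) 1 2))
  - symTerm 0 0 2 (2 / 45 * Complex.I) (m 1 ^ 2 * m 2)
  + symTerm 0 1 0 (1 / 6) (phiOdd F)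
  + symTerm 0 1 1 1 (m 1 * n 2 - ((1 / 3 : ℝ) : ℂ) • (m 2 * n 1))
  + symTerm 0 2 3 (1 / 30 * Complex.I) (m 2 ^ 2 - ((2 : ℝ) : ℂ) • (m 1 * m 3))
  + symTerm 0 2 0 (2 * Complex.I) (δ^[2] (momStep (evenStep F) 2 1))
  + symTerm 0 3 0 (4 / 3) (δ^[3] (momStep (oddStep F) 3 1))
  + symTerm 0 3 2 (1 / 3) (n 3)
  - symTerm 0 4 4 (1 / 120 * Complex.I) (m 4)

variable {F}

/-! ### Identification of the symbols -/

section Identification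

variable {V : ℝ → ℝ → ℝ}

theorem represents_momStep_shift (hF : ∀ h t x, F (h, t) x = V x (t + h)) (j k : ℕ) :
    Represents (momStep F j k) fun h t => mom (shift V t) j k h :=
  represents_momStep hF j k

theorem represents_momStep_even (hF : ∀ h t x, F (h, t) x = V x (t + h)) (j k : ℕ) :
    Represents (momStep (evenStep F) j k) fun h t => mom (evenPart (shift V t)) j k h :=
  represents_momStep (fun h t x => by
    simp only [evenStep, PFun.smul_apply, PFun.add_apply, reflectStep_apply, hF, evenPart, shift]
    push_cast; ring) j k

theorem represents_momStep_odd (hF : ∀ h t x, F (h, t) x = V x (t + h)) (j k : ℕ) :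
    Represents (momStep (oddStep F) j k) fun h t => mom (oddPart (shift V t)) j k h :=
  represents_momStep (fun h t x => by
    simp only [oddStep, PFun.smul_apply, PFun.sub_apply, reflectStep_apply, hF, oddPart, shift]
    push_cast; ring) j k

theorem prodKer_eq (hF : ∀ h t x, F (h, t) x = V x (t + h)) (a b : ℕ) (t x p q : ℝ) :
    (δ^[a] F) (p, t) x * (δ^[b] F) (q, t) x = prodKer (shift V t) a b x p q := by
  have h : Represents F fun p t y => V y (t + p) := hF
  rw [h.iteratedDeriv a p t x, h.iteratedDeriv b q t x, ← Complex.ofReal_mul]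
  rfl

theorem represents_psiInt (hF : ∀ h t x, F (h, t) x = V x (t + h)) :
    Represents (psiInt F) fun h t => tri psi (prodKer (shift V t) 1 1) h :=
  represents_triStep _ (fun h s r => by simp only [triWeight, psi]; ring) (prodKer_eq hF 1 1)

theorem represents_psiEven (hF : ∀ h t x, F (h, t) x = V x (t + h)) :
    Represents (psiEven F) fun h t => tri psi (evenKer (prodKer (shift V t) 1 1)) h :=
  represents_triEven _ (fun h s r => by simp only [triWeight, psi]; ring) (prodKer_eq hF 1 1)

theorem represents_phiOdd (hF : ∀ h t x, F (h, t) x = V x (t + h)) :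
    Represents (phiOdd F) fun h t =>
      tri (varphi₁ + phi₁) (oddKer (prodKer (shift V t) 1 2)) h +
      tri (varphi₂ + phi₂) (oddKer (prodKer (shift V t) 2 1)) h :=
  Represents.add
    (represents_triOdd _ (fun h s r => by simp only [triWeight, Pi.add_apply, varphi₁, phi₁]; ring)
      (prodKer_eq hF 1 2))
    (represents_triOdd _ (fun h s r => by simp only [triWeight, Pi.add_apply, varphi₂, phi₂]; ring)
      (prodKer_eq hF 2 1))

/-- `Θ₄` has two separate first-order terms of this kind, which the symbol merges into one. The two
summands undo the merger. -/
theorem exists_represents_phiInt (hF : ∀ h t x, F (h, t) x = V x (t + h)) :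
    ∃ G H : StepFun L, phiInt F = G + H ∧
      Represents G (fun h t => tri varphi₁ (prodKer (shift V t) 1 2) h +
        tri varphi₂ (prodKer (shift V t) 2 1) h) ∧
      Represents H (fun h t => tri phi₁ (prodKer (shift V t) 1 2) h +
        tri phi₂ (prodKer (shift V t) 2 1) h) := by
  obtain ⟨h1, h2, h3, h4, -, -⟩ := contDiff_phiWeight
  refine ⟨triStep (triWeight varphi₁) h1 2 (δ^[1] F) (δ^[2] F) +
    triStep (triWeight varphi₂) h2 2 (δ^[2] F) (δ^[1] F),
    triStep (triWeight phi₁) h3 2 (δ^[1] F) (δ^[2] F) +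
    triStep (triWeight phi₂) h4 2 (δ^[2] F) (δ^[1] F), ?_, ?_, ?_⟩
  · have e : ∀ (f g : ℝ → ℝ → ℝ → ℝ) (p : ℝ × ℝ),
        triWeight (f + g) p = triWeight f p + triWeight g p := fun f g p => mul_add _ _ _
    rw [phiInt, triStep_add (e _ _) h1 h3, triStep_add (e _ _) h2 h4]
    abel
  · exact Represents.add
      (represents_triStep _ (fun h s r => by simp only [triWeight, varphi₁]; ring)
        (prodKer_eq hF 1 2))
      (represents_triStep _ (fun h s r => by simp only [triWeight, varphi₂]; ring)
        (prodKer_eq hF 2 1))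
  · exact Represents.add
      (represents_triStep _ (fun h s r => by simp only [triWeight, phi₁]; ring)
        (prodKer_eq hF 1 2))
      (represents_triStep _ (fun h s r => by simp only [triWeight, phi₂]; ring)
        (prodKer_eq hF 2 1))

theorem quantAt_symW0 (h t : ℝ) {ε : ℝ} (hε : ε ≠ 0) (u : PerSmooth L) :
    (quantAt (h, t) ε (symW0 L) u : ℝ → ℂ) = W0 h ε u := by
  have hε' : (ε : ℂ) ≠ 0 := by exact_mod_cast hε
  rw [symW0, quantAt_symTerm (Represents.one h t)
    (show _ = Complex.I * h * ε by field_simp), Pi.one_apply, Pi.one_apply, ang_one, W0]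

theorem quantAt_symW1 (hF : ∀ h t x, F (h, t) x = V x (t + h)) (h t : ℝ) {ε : ℝ} (hε : ε ≠ 0)
    (u : PerSmooth L) :
    (quantAt (h, t) ε (symW1 F) u : ℝ → ℂ) = W1 (shift V t) h ε u := by
  have hε' : (ε : ℂ) ≠ 0 := by exact_mod_cast hε
  rw [symW1, quantAt_symTerm (represents_momStep_even hF 0 0 h t)
    (show _ = -(Complex.I * (ε : ℂ)⁻¹) by field_simp), ang_zero, W1]

theorem quantAt_symW2 (hF : ∀ h t x, F (h, t) x = V x (t + h)) (h t : ℝ) {ε : ℝ} (hε : ε ≠ 0)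
    (u : PerSmooth L) :
    (quantAt (h, t) ε (symW2 F) u : ℝ → ℂ) = W2 (shift V t) h ε u := by
  have hε' : (ε : ℂ) ≠ 0 := by exact_mod_cast hε
  have m := fun k => (represents_momStep_even hF 0 0).iteratedDeriv k
  have n := fun k => (represents_momStep_odd hF 1 1).iteratedDeriv k
  simp only [symW2, map_add, map_sub, LinearMap.add_apply, LinearMap.sub_apply, Submodule.coe_add,
    Submodule.coe_sub]
  rw [quantAt_symTerm (((m 1).pow 2) h t)
      (show _ = 1 / 6 * Complex.I * h * (ε : ℂ)⁻¹ by field_simp),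
    quantAt_symTerm (n 1 h t) (show _ = (2 : ℂ) by field_simp),
    quantAt_symTerm (m 2 h t) (show _ = 1 / 6 * Complex.I * (h : ℂ) ^ 2 * ε by field_simp),
    ang_zero, W2]

theorem quantAt_symW3 (hF : ∀ h t x, F (h, t) x = V x (t + h)) (h t : ℝ) {ε : ℝ} (hε : ε ≠ 0)
    (u : PerSmooth L) :
    (quantAt (h, t) ε (symW3 F) u : ℝ → ℂ) = W3 (shift V t) h ε u := by
  have hε' : (ε : ℂ) ≠ 0 := by exact_mod_cast hε
  have m := fun k => (represents_momStep_even hF 0 0).iteratedDeriv k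
  have n := fun k => (represents_momStep_odd hF 1 1).iteratedDeriv k
  simp only [symW3, map_add, map_sub, LinearMap.add_apply, LinearMap.sub_apply, Submodule.coe_add,
    Submodule.coe_sub]
  rw [quantAt_symTerm (represents_psiEven hF h t)
      (show _ = Complex.I * (ε : ℂ)⁻¹ by field_simp),
    quantAt_symTerm (m 4 h t) (show _ = 1 / 24 * Complex.I * (h : ℂ) ^ 2 * ε by field_simp),
    quantAt_symTerm ((((m 1).pow 2).mul ((represents_momStep_even hF 1 2).iteratedDeriv 2)) h t)
      (show _ = 1 / 6 * Complex.I * (ε : ℂ)⁻¹ by field_simp),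
    quantAt_symTerm ((((m 1).pow 2).mul (m 2)) h t)
      (show _ = 2 / 45 * Complex.I * (h : ℂ) ^ 2 * (ε : ℂ)⁻¹ by field_simp),
    quantAt_symTerm (represents_phiOdd hF h t) (show _ = (1 / 6 : ℂ) by field_simp),
    quantAt_symTerm ((((m 1).mul (n 2)).sub (((m 2).mul (n 1)).smul (1 / 3))) h t)
      (show _ = (h : ℂ) by field_simp),
    quantAt_symTerm ((((m 2).pow 2).sub (((m 1).mul (m 3)).smul 2)) h t)
      (show _ = 1 / 30 * Complex.I * (h : ℂ) ^ 3 * ε by field_simp),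
    quantAt_symTerm ((represents_momStep_even hF 2 1).iteratedDeriv 2 h t)
      (show _ = 2 * Complex.I * ε by field_simp),
    quantAt_symTerm ((represents_momStep_odd hF 3 1).iteratedDeriv 3 h t)
      (show _ = 4 / 3 * (ε : ℂ) ^ 2 by field_simp),
    quantAt_symTerm (n 3 h t) (show _ = 1 / 3 * (h : ℂ) ^ 2 * (ε : ℂ) ^ 2 by field_simp),
    quantAt_symTerm (m 4 h t)
      (show _ = 1 / 120 * Complex.I * (h : ℂ) ^ 4 * (ε : ℂ) ^ 3 by field_simp)]
  simp only [ang_zero, W3]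

theorem quantAt_symThetaOdd (hF : ∀ h t x, F (h, t) x = V x (t + h)) (h t : ℝ) {ε : ℝ} (hε : ε ≠ 0)
    (u : PerSmooth L) :
    (quantAt (h, t) ε (symThetaOdd F) u : ℝ → ℂ) = Theta4Odd (shift V t) h ε u := by
  have hε' : (ε : ℂ) ≠ 0 := by exact_mod_cast hε
  have e := represents_momStep_even hF
  have o := represents_momStep_odd hF
  simp only [symThetaOdd, magnusSymbol, map_add, map_sub, LinearMap.add_apply, LinearMap.sub_apply,
    Submodule.coe_add, Submodule.coe_sub]
  rw [quantAt_symTerm (Represents.one h t) (show _ = Complex.I * h * ε by field_simp),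
    quantAt_symTerm (e 0 0 h t) (show _ = Complex.I * (ε : ℂ)⁻¹ by field_simp),
    quantAt_symTerm ((o 1 1).iteratedDeriv 1 h t) (show _ = (2 : ℂ) by field_simp),
    quantAt_symTerm (represents_psiEven hF h t) (show _ = Complex.I * (ε : ℂ)⁻¹ by field_simp),
    quantAt_symTerm ((e 2 1).iteratedDeriv 2 h t) (show _ = 2 * Complex.I * ε by field_simp),
    quantAt_symTerm (represents_phiOdd hF h t) (show _ = (1 / 6 : ℂ) by field_simp),
    quantAt_symTerm ((o 3 1).iteratedDeriv 3 h t) (show _ = 4 / 3 * (ε : ℂ) ^ 2 by field_simp),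
    quantAt_symTerm ((e 2 1).iteratedDeriv 4 h t) (show _ = 1 / 4 * Complex.I * ε by field_simp)]
  simp only [ang_zero, Theta4Odd, Pi.one_apply, ang_one]

theorem quantAt_symTheta (hF : ∀ h t x, F (h, t) x = V x (t + h)) (h t : ℝ) {ε : ℝ} (hε : ε ≠ 0)
    (u : PerSmooth L) :
    (quantAt (h, t) ε (symTheta F) u : ℝ → ℂ) = Theta4 (shift V t) h ε u := by
  have hε' : (ε : ℂ) ≠ 0 := by exact_mod_cast hε
  have e := represents_momStep_shift hF
  obtain ⟨G, H, hGH, hG, hH⟩ := exists_represents_phiInt hF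
  simp only [symTheta, magnusSymbol, hGH, symTerm_add, map_add, map_sub, LinearMap.add_apply,
    LinearMap.sub_apply, Submodule.coe_add, Submodule.coe_sub]
  rw [quantAt_symTerm (Represents.one h t) (show _ = Complex.I * h * ε by field_simp),
    quantAt_symTerm (e 0 0 h t) (show _ = Complex.I * (ε : ℂ)⁻¹ by field_simp),
    quantAt_symTerm ((e 1 1).iteratedDeriv 1 h t) (show _ = (2 : ℂ) by field_simp),
    quantAt_symTerm (represents_psiInt hF h t) (show _ = Complex.I * (ε : ℂ)⁻¹ by field_simp),
    quantAt_symTerm ((e 2 1).iteratedDeriv 2 h t) (show _ = 2 * Complex.I * ε by field_simp),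
    quantAt_symTerm (hG h t) (show _ = (1 / 6 : ℂ) by field_simp),
    quantAt_symTerm (hH h t) (show _ = (1 / 6 : ℂ) by field_simp),
    quantAt_symTerm ((e 3 1).iteratedDeriv 3 h t) (show _ = 4 / 3 * (ε : ℂ) ^ 2 by field_simp),
    quantAt_symTerm ((e 2 1).iteratedDeriv 4 h t) (show _ = 1 / 4 * Complex.I * ε by field_simp)]
  simp only [ang_zero, Theta4, Pi.one_apply, ang_one]
  abel

end Identification

/-! ### Parity in the time step -/

theorem Represents.neg_step {g : StepFun L} {f : ℝ → ℝ → ℝ → ℝ} (h : Represents g f)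
    (hg : reflectStep g = -g) (a t : ℝ) : f (-a) t = -f a t := by
  funext x
  have e : reflectStep g (a, t) x = (-g) (a, t) x := by rw [hg]
  rw [reflectStep_apply, PFun.neg_apply, h, h] at e
  exact_mod_cast e

theorem reflectStep_psiEven (F : StepFun L) : reflectStep (psiEven F) = -psiEven F :=
  reflectStep_triEven _ _ odd_one _ _

theorem reflectStep_phiOdd (F : StepFun L) : reflectStep (phiOdd F) = -phiOdd F := by
  rw [phiOdd, map_add, reflectStep_triOdd _ _ even_two, reflectStep_triOdd _ _ even_two, neg_add]

theorem mulOp_neg (f : ℝ → ℝ) (u : ℝ → ℂ) : mulOp (-f) u = -mulOp f u := by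
  funext x; simp [mulOp]

theorem ang_neg (f : ℝ → ℝ) (k : ℕ) (u : ℝ → ℂ) : ang (-f) k u = -ang f k u := by
  have h : iteratedDeriv k (-mulOp f u) = -iteratedDeriv k (mulOp f u) :=
    funext fun x => iteratedDeriv_neg k (mulOp f u) x
  rw [ang, mulOp_neg, mulOp_neg, h, ang]
  module

/-- The operator is linear in `h` and in the integrals it contains, all of which are odd in `h`. -/
theorem Theta4Odd_neg {V : ℝ → ℝ → ℝ} (hF : ∀ h t x, F (h, t) x = V x (t + h)) (t ε h : ℝ)
    (u : ℝ → ℂ) : Theta4Odd (shift V t) (-h) ε u = -Theta4Odd (shift V t) h ε u := by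
  have d : ∀ (k : ℕ) (f : ℝ → ℝ), iteratedDeriv k (-f) = -iteratedDeriv k f := fun k f =>
    funext fun x => iteratedDeriv_neg k f x
  have e0 := (represents_momStep_even hF 0 0).neg_step (reflectStep_momStep_even F (by decide)) h t
  have e1 := (represents_momStep_odd hF 1 1).neg_step (reflectStep_momStep_odd F (by decide)) h t
  have e2 := (represents_momStep_even hF 2 1).neg_step (reflectStep_momStep_even F (by decide)) h t
  have e3 := (represents_momStep_odd hF 3 1).neg_step (reflectStep_momStep_odd F (by decide)) h t
  have e4 := (represents_psiEven hF).neg_step (reflectStep_psiEven F) h t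
  have e5 := (represents_phiOdd hF).neg_step (reflectStep_phiOdd F) h t
  simp only [Theta4Odd, e0, e1, e2, e3, e4, e5, d, ang_neg, mulOp_neg, Complex.ofReal_neg]
  module

end Symbols
end MagnusZassenhaus
namespace MagnusZassenhaus

/-! ### Coefficients of the symbols -/

section SymbolCoefficients

variable {L : ℝ}

theorem symbolCoeff_symTerm (n j k a : ℕ) (c : ℂ) (g : StepFun L) :
    symbolCoeff n (symTerm j k a c g) =
      Finsupp.single (j, k) (if a ≤ n then c • taylorLin (n - a) g else 0) := by
  rw [symTerm, symbolCoeff_single, map_smul, taylorLin_stepVar_pow_mul, smul_ite, smul_zero]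

theorem symbolCoeff_symTerm_of_reflect {j k a : ℕ} {c : ℂ} {g : StepFun L} {n : ℕ} (hn : Even n)
    (h : reflectStep (stepVar ^ a * g) = -(stepVar ^ a * g)) :
    symbolCoeff n (symTerm j k a c g) = 0 := by
  rw [symTerm, symbolCoeff_single, map_smul, taylorLin_eq_zero_of_reflectStep h hn, smul_zero,
    Finsupp.single_zero]

theorem δ_iterate_neg (k : ℕ) (f : StepFun L) : δ^[k] (-f) = -δ^[k] f := iterate_map_neg _ _ _

variable (F : StepFun L)

theorem reflectStep_integrals :
    reflectStep (momStep (evenStep F) 0 0) = -momStep (evenStep F) 0 0 ∧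
    reflectStep (momStep (oddStep F) 1 1) = -momStep (oddStep F) 1 1 ∧
    reflectStep (momStep (evenStep F) 1 2) = -momStep (evenStep F) 1 2 ∧
    reflectStep (momStep (evenStep F) 2 1) = -momStep (evenStep F) 2 1 ∧
    reflectStep (momStep (oddStep F) 3 1) = -momStep (oddStep F) 3 1 :=
  ⟨reflectStep_momStep_even F (by decide), reflectStep_momStep_odd F (by decide),
    reflectStep_momStep_even F (by decide), reflectStep_momStep_even F (by decide),
    reflectStep_momStep_odd F (by decide)⟩

/-- Counting the explicit powers of `h` together with the integrals, each term is a product of an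
odd number of odd factors. -/
theorem symbolCoeff_even {n : ℕ} (hn : Even n) :
    symbolCoeff n (symThetaOdd F) = 0 ∧ symbolCoeff n (symW0 L) = 0 ∧
    symbolCoeff n (symW1 F) = 0 ∧ symbolCoeff n (symW2 F) = 0 ∧ symbolCoeff n (symW3 F) = 0 := by
  obtain ⟨h1, h2, h3, h4, h5⟩ := reflectStep_integrals F
  have z : ∀ {j k a : ℕ} {c : ℂ} {g : StepFun L},
      reflectStep (stepVar ^ a * g) = -(stepVar ^ a * g) →
      symbolCoeff n (symTerm j k a c g) = 0 := fun h => symbolCoeff_symTerm_of_reflect hn h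
  refine ⟨?_, ?_, ?_, ?_, ?_⟩
  · simp only [symThetaOdd, magnusSymbol, map_add, map_sub]
    repeat rw [z (by
      simp only [map_mul, map_pow, map_one, reflectStep_stepVar, reflectStep_δ_iterate,
        δ_iterate_neg, reflectStep_psiEven, reflectStep_phiOdd, h1, h2, h4, h5]
      ring)]
    simp
  · rw [symW0, z (by simp only [map_mul, map_pow, map_one, reflectStep_stepVar]; ring)]
  · rw [symW1, z (by simp only [map_mul, map_pow, h1, reflectStep_stepVar]; ring)]
  · simp only [symW2, map_add, map_sub]
    repeat rw [z (by
      simp only [map_mul, map_pow, reflectStep_stepVar, reflectStep_δ_iterate,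
        δ_iterate_neg, h1, h2]
      ring)]
    simp
  · simp only [symW3, map_add, map_sub]
    repeat rw [z (by
      simp only [map_mul, map_pow, map_sub, map_smul, reflectStep_stepVar, reflectStep_δ_iterate,
        δ_iterate_neg, reflectStep_psiEven, reflectStep_phiOdd, h1, h2, h3, h4, h5]
      algebra)]
    simp

theorem taylorLin_momStep_even_zero :
    taylorLin 0 (momStep (evenStep F) 0 0) = 0 ∧
    taylorLin 1 (momStep (evenStep F) 0 0) = taylorLin 0 F ∧
    taylorLin 2 (momStep (evenStep F) 0 0) = 0 ∧
    taylorLin 3 (momStep (evenStep F) 0 0) = (1 / 12 : ℂ) • taylorLin 2 F ∧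
    taylorLin 4 (momStep (evenStep F) 0 0) = 0 ∧
    taylorLin 5 (momStep (evenStep F) 0 0) = (1 / 80 : ℂ) • taylorLin 4 F := by
  simp [taylorLin_momStep, taylorLin_evenStep, moments_bernWeight_zero, Nat.even_iff]

theorem taylorLin_momStep_odd_one :
    taylorLin 0 (momStep (oddStep F) 1 1) = 0 ∧ taylorLin 1 (momStep (oddStep F) 1 1) = 0 ∧
    taylorLin 2 (momStep (oddStep F) 1 1) = 0 ∧
    taylorLin 3 (momStep (oddStep F) 1 1) = (1 / 12 : ℂ) • taylorLin 1 F ∧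
    taylorLin 4 (momStep (oddStep F) 1 1) = 0 ∧
    taylorLin 5 (momStep (oddStep F) 1 1) = (1 / 80 : ℂ) • taylorLin 3 F := by
  simp [taylorLin_momStep, taylorLin_oddStep, moments_bernWeight_one, Nat.even_iff]

theorem taylorLin_momStep_even_one :
    taylorLin 0 (momStep (evenStep F) 1 2) = 0 ∧ taylorLin 1 (momStep (evenStep F) 1 2) = 0 ∧
    taylorLin 2 (momStep (evenStep F) 1 2) = 0 ∧
    taylorLin 3 (momStep (evenStep F) 1 2) = (1 / 12 : ℂ) • taylorLin 0 F := by
  simp [taylorLin_momStep, taylorLin_evenStep, moments_bernWeight_one]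

theorem taylorLin_momStep_even_two :
    taylorLin 1 (momStep (evenStep F) 2 1) = 0 ∧ taylorLin 3 (momStep (evenStep F) 2 1) = 0 ∧
    taylorLin 5 (momStep (evenStep F) 2 1) = (1 / 180 : ℂ) • taylorLin 2 F := by
  simp [taylorLin_momStep, taylorLin_evenStep, moments_bernWeight_two]

theorem taylorLin_momStep_odd_three :
    taylorLin 1 (momStep (oddStep F) 3 1) = 0 ∧ taylorLin 3 (momStep (oddStep F) 3 1) = 0 ∧
    taylorLin 5 (momStep (oddStep F) 3 1) = (-1 / 120 : ℂ) • taylorLin 1 F := by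
  simp [taylorLin_momStep, taylorLin_oddStep, moments_bernWeight_three, Nat.even_iff]

theorem taylorLin_psiEven :
    taylorLin 1 (psiEven F) = 0 ∧ taylorLin 3 (psiEven F) = 0 ∧
    taylorLin 5 (psiEven F) = (1 / 180 : ℂ) • (δ^[1] (taylorLin 0 F) * δ^[1] (taylorLin 2 F)) -
      (1 / 120 : ℂ) • (δ^[1] (taylorLin 1 F)) ^ 2 := by
  refine ⟨?_, ?_, ?_⟩ <;> rw [psiEven, taylorLin_triEven, taylorLin_triStep]
  · simp
  · simp [moments_psi]
  · simp only [Nat.reduceAdd, Nat.reduceLeDiff, Nat.reduceSub, Nat.even_iff, Nat.reduceMod,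
      if_true, Finset.Nat.antidiagonal_succ, Finset.Nat.antidiagonal_zero,
      Finset.sum_cons, Finset.map_cons, Finset.map_singleton, Finset.sum_singleton,
      Function.Embedding.prodMap, Function.Embedding.coeFn_mk, Prod.map_apply,
      Function.Embedding.refl_apply, Nat.succ_eq_add_one, moments_psi, taylorLin_δ_iterate]
    push_cast
    algebra

theorem taylorLin_phiOdd :
    taylorLin 1 (phiOdd F) = 0 ∧ taylorLin 3 (phiOdd F) = 0 ∧
    taylorLin 5 (phiOdd F) = (-1 / 10 : ℂ) • (δ^[1] (taylorLin 0 F) * δ^[2] (taylorLin 1 F)) -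
      (1 / 30 : ℂ) • (δ^[1] (taylorLin 1 F) * δ^[2] (taylorLin 0 F)) := by
  refine ⟨?_, ?_, ?_⟩ <;>
    rw [phiOdd, map_add, taylorLin_triOdd, taylorLin_triOdd, taylorLin_triStep, taylorLin_triStep]
  · simp
  · simp
  · simp only [Nat.reduceAdd, Nat.reduceLeDiff, Nat.reduceSub, Nat.even_iff, Nat.reduceMod,
      if_true, Finset.Nat.antidiagonal_succ, Finset.Nat.antidiagonal_zero,
      Finset.sum_cons, Finset.map_singleton, Finset.sum_singleton,
      Function.Embedding.prodMap, Function.Embedding.coeFn_mk, Prod.map_apply,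
      Function.Embedding.refl_apply, Nat.succ_eq_add_one, moments_varphi₁_add_phi₁,
      moments_varphi₂_add_phi₂, taylorLin_δ_iterate]
    push_cast
    algebra

end SymbolCoefficients
end MagnusZassenhaus
namespace MagnusZassenhaus

/-! ### Explicit coefficients of the symbols at orders one, three and five -/

section Exponents

variable {L : ℝ} (F : StepFun L)

theorem δ_iterate_smul (k : ℕ) (c : ℂ) (f : CoeffFun L) : δ^[k] (c • f) = c • δ^[k] f := by
  induction k with
  | zero => rfl
  | succ k ih =>
    rw [Function.iterate_succ_apply', ih, Derivation.map_smul, Function.iterate_succ_apply']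

theorem δ_iterate_zero (k : ℕ) : δ^[k] (0 : CoeffFun L) = 0 := iterate_map_zero _ _

theorem symbolCoeff_symW0 :
    symbolCoeff 1 (symW0 L) = Complex.I • Finsupp.single (0, 2) 1 ∧
    symbolCoeff 3 (symW0 L) = 0 ∧ symbolCoeff 5 (symW0 L) = 0 := by
  simp [symW0, symbolCoeff_symTerm, taylorLin_one]

theorem symbolCoeff_symW1 :
    symbolCoeff 1 (symW1 F) = -Complex.I • Finsupp.single (0, 0) (taylorLin 0 F) ∧
    symbolCoeff 3 (symW1 F) = (-Complex.I * (1 / 12)) • Finsupp.single (0, 0) (taylorLin 2 F) ∧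
    symbolCoeff 5 (symW1 F) = (-Complex.I * (1 / 80)) • Finsupp.single (0, 0) (taylorLin 4 F) := by
  simp only [symW1, symbolCoeff_symTerm, taylorLin_momStep_even_zero, zero_le, if_true,
    Nat.sub_zero, smul_smul, Finsupp.smul_single, and_self]

theorem taylorLin_sq_deriv_line :
    taylorLin 0 ((δ^[1] (momStep (evenStep F) 0 0)) ^ 2) = 0 ∧
    taylorLin 2 ((δ^[1] (momStep (evenStep F) 0 0)) ^ 2) = (δ^[1] (taylorLin 0 F)) ^ 2 ∧
    taylorLin 4 ((δ^[1] (momStep (evenStep F) 0 0)) ^ 2) =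
      (1 / 6 : ℂ) • (δ^[1] (taylorLin 0 F) * δ^[1] (taylorLin 2 F)) := by
  refine ⟨?_, ?_, ?_⟩ <;>
  · simp only [pow_two, taylorLin_mul, Finset.Nat.antidiagonal_succ, Finset.Nat.antidiagonal_zero,
      Finset.sum_cons, Finset.map_cons, Finset.map_singleton, Finset.sum_singleton,
      Function.Embedding.prodMap, Function.Embedding.coeFn_mk, Prod.map_apply,
      Function.Embedding.refl_apply, Nat.succ_eq_add_one, Nat.reduceAdd, taylorLin_δ_iterate,
      taylorLin_momStep_even_zero, δ_iterate_smul, δ_iterate_zero]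
    algebra

theorem symbolCoeff_symW2 :
    symbolCoeff 1 (symW2 F) = 0 ∧
    symbolCoeff 3 (symW2 F) =
      (1 / 6 * Complex.I) • Finsupp.single (0, 0) ((δ^[1] (taylorLin 0 F)) ^ 2) -
      (1 / 6 : ℂ) • Finsupp.single (0, 1) (δ^[1] (taylorLin 1 F)) +
      (1 / 6 * Complex.I) • Finsupp.single (0, 2) (δ^[2] (taylorLin 0 F)) ∧
    symbolCoeff 5 (symW2 F) = (1 / 36 * Complex.I) •
        Finsupp.single (0, 0) (δ^[1] (taylorLin 0 F) * δ^[1] (taylorLin 2 F)) -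
      (1 / 40 : ℂ) • Finsupp.single (0, 1) (δ^[1] (taylorLin 3 F)) +
      (1 / 72 * Complex.I) • Finsupp.single (0, 2) (δ^[2] (taylorLin 2 F)) := by
  refine ⟨?_, ?_, ?_⟩ <;>
  · simp only [symW2, map_add, map_sub, symbolCoeff_symTerm, Nat.reduceLeDiff, Nat.reduceSub,
      if_true, if_false, le_refl, Nat.sub_self, Nat.sub_zero, zero_le, taylorLin_sq_deriv_line,
      taylorLin_δ_iterate, taylorLin_momStep_even_zero, taylorLin_momStep_odd_one, δ_iterate_smul,
      δ_iterate_zero,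
      smul_smul, smul_zero, Finsupp.single_zero, sub_zero, add_zero, ← Finsupp.smul_single]
    try module

theorem taylorLin_cubic_terms :
    taylorLin 1 ((δ^[1] (momStep (evenStep F) 0 0)) ^ 2 * δ^[2] (momStep (evenStep F) 1 2)) = 0 ∧
    taylorLin 3 ((δ^[1] (momStep (evenStep F) 0 0)) ^ 2 * δ^[2] (momStep (evenStep F) 1 2)) = 0 ∧
    taylorLin 5 ((δ^[1] (momStep (evenStep F) 0 0)) ^ 2 * δ^[2] (momStep (evenStep F) 1 2)) =
      (1 / 12 : ℂ) • ((δ^[1] (taylorLin 0 F)) ^ 2 * δ^[2] (taylorLin 0 F)) ∧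
    taylorLin 1 ((δ^[1] (momStep (evenStep F) 0 0)) ^ 2 * δ^[2] (momStep (evenStep F) 0 0)) = 0 ∧
    taylorLin 3 ((δ^[1] (momStep (evenStep F) 0 0)) ^ 2 * δ^[2] (momStep (evenStep F) 0 0)) =
      (δ^[1] (taylorLin 0 F)) ^ 2 * δ^[2] (taylorLin 0 F) := by
  refine ⟨?_, ?_, ?_, ?_, ?_⟩ <;>
  · simp only [pow_two, taylorLin_mul, Finset.Nat.antidiagonal_succ, Finset.Nat.antidiagonal_zero,
      Finset.sum_cons, Finset.map_cons, Finset.map_singleton, Finset.sum_singleton,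
      Function.Embedding.prodMap, Function.Embedding.coeFn_mk, Prod.map_apply,
      Function.Embedding.refl_apply, Nat.succ_eq_add_one, Nat.reduceAdd, taylorLin_δ_iterate,
      taylorLin_momStep_even_zero, taylorLin_momStep_even_one, δ_iterate_smul, δ_iterate_zero,
      zero_mul, mul_zero, smul_zero, add_zero, zero_add, mul_smul_comm]

theorem taylorLin_quadratic_terms :
    taylorLin 0 (δ^[1] (momStep (evenStep F) 0 0) * δ^[2] (momStep (oddStep F) 1 1) -
      ((1 / 3 : ℝ) : ℂ) • (δ^[2] (momStep (evenStep F) 0 0) * δ^[1] (momStep (oddStep F) 1 1))) =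
        0 ∧
    taylorLin 2 (δ^[1] (momStep (evenStep F) 0 0) * δ^[2] (momStep (oddStep F) 1 1) -
      ((1 / 3 : ℝ) : ℂ) • (δ^[2] (momStep (evenStep F) 0 0) * δ^[1] (momStep (oddStep F) 1 1))) =
        0 ∧
    taylorLin 4 (δ^[1] (momStep (evenStep F) 0 0) * δ^[2] (momStep (oddStep F) 1 1) -
      ((1 / 3 : ℝ) : ℂ) • (δ^[2] (momStep (evenStep F) 0 0) * δ^[1] (momStep (oddStep F) 1 1))) =
      (1 / 12 : ℂ) • (δ^[1] (taylorLin 0 F) * δ^[2] (taylorLin 1 F)) -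
      (1 / 36 : ℂ) • (δ^[2] (taylorLin 0 F) * δ^[1] (taylorLin 1 F)) ∧
    taylorLin 0 ((δ^[2] (momStep (evenStep F) 0 0)) ^ 2 - ((2 : ℝ) : ℂ) •
      (δ^[1] (momStep (evenStep F) 0 0) * δ^[3] (momStep (evenStep F) 0 0))) = 0 ∧
    taylorLin 2 ((δ^[2] (momStep (evenStep F) 0 0)) ^ 2 - ((2 : ℝ) : ℂ) •
      (δ^[1] (momStep (evenStep F) 0 0) * δ^[3] (momStep (evenStep F) 0 0))) =
      (δ^[2] (taylorLin 0 F)) ^ 2 - (2 : ℂ) • (δ^[1] (taylorLin 0 F) * δ^[3] (taylorLin 0 F)) := by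
  refine ⟨?_, ?_, ?_, ?_, ?_⟩ <;>
  · simp only [map_sub, map_smul, pow_two, taylorLin_mul, Finset.Nat.antidiagonal_succ,
      Finset.Nat.antidiagonal_zero,
      Finset.sum_cons, Finset.map_cons, Finset.map_singleton, Finset.sum_singleton,
      Function.Embedding.prodMap, Function.Embedding.coeFn_mk, Prod.map_apply,
      Function.Embedding.refl_apply, Nat.succ_eq_add_one, Nat.reduceAdd, taylorLin_δ_iterate,
      taylorLin_momStep_even_zero, taylorLin_momStep_odd_one, δ_iterate_smul, δ_iterate_zero,
      mul_zero, add_zero, zero_add, mul_smul_comm]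
    push_cast
    try module

/-- Terms with the same symbol merge at order five. The two cubic ones give `1/6 · 1/12 + 2/45 =
7/120`, and the two of third degree in the momentum give `-4/3 · 1/120 + 1/3 · 1/12 = 1/60`. The
only term at order three carries two extra powers of `ε`. -/
theorem symbolCoeff_symW3 :
    symbolCoeff 1 (symW3 F) = 0 ∧
    symbolCoeff 3 (symW3 F) =
      -((1 / 24 * Complex.I) • Finsupp.single (2, 0) (δ^[4] (taylorLin 0 F))) ∧
    symbolCoeff 5 (symW3 F) =
      Complex.I • Finsupp.single (0, 0)
        ((1 / 180 : ℂ) • (δ^[1] (taylorLin 0 F) * δ^[1] (taylorLin 2 F)) -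
          (1 / 120 : ℂ) • (δ^[1] (taylorLin 1 F)) ^ 2) -
      (1 / 288 * Complex.I) • Finsupp.single (2, 0) (δ^[4] (taylorLin 2 F)) -
      (7 / 120 * Complex.I) • Finsupp.single (0, 0)
        ((δ^[1] (taylorLin 0 F)) ^ 2 * δ^[2] (taylorLin 0 F)) +
      (1 / 6 : ℂ) • Finsupp.single (0, 1)
        ((-1 / 10 : ℂ) • (δ^[1] (taylorLin 0 F) * δ^[2] (taylorLin 1 F)) -
          (1 / 30 : ℂ) • (δ^[1] (taylorLin 1 F) * δ^[2] (taylorLin 0 F))) +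
      Finsupp.single (0, 1) ((1 / 12 : ℂ) • (δ^[1] (taylorLin 0 F) * δ^[2] (taylorLin 1 F)) -
        (1 / 36 : ℂ) • (δ^[2] (taylorLin 0 F) * δ^[1] (taylorLin 1 F))) +
      (1 / 30 * Complex.I) • Finsupp.single (0, 2) ((δ^[2] (taylorLin 0 F)) ^ 2 -
        (2 : ℂ) • (δ^[1] (taylorLin 0 F) * δ^[3] (taylorLin 0 F))) +
      (1 / 90 * Complex.I) • Finsupp.single (0, 2) (δ^[2] (taylorLin 2 F)) +
      (1 / 60 : ℂ) • Finsupp.single (0, 3) (δ^[3] (taylorLin 1 F)) -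
      (1 / 120 * Complex.I) • Finsupp.single (0, 4) (δ^[4] (taylorLin 0 F)) := by
  refine ⟨?_, ?_, ?_⟩ <;>
  · simp only [symW3, map_add, map_sub _ (symTerm _ _ _ _ _), map_sub _ (_ - _), map_sub _ (_ + _),
      symbolCoeff_symTerm, Nat.reduceLeDiff, Nat.reduceSub,
      if_true, if_false, le_refl, Nat.sub_self, Nat.sub_zero, zero_le, taylorLin_cubic_terms,
      taylorLin_quadratic_terms, taylorLin_psiEven, taylorLin_phiOdd,
      taylorLin_δ_iterate, taylorLin_momStep_even_zero, taylorLin_momStep_odd_one,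
      taylorLin_momStep_even_two, taylorLin_momStep_odd_three, δ_iterate_smul, δ_iterate_zero,
      smul_smul, smul_zero, Finsupp.single_zero, sub_zero, add_zero, zero_sub,
      ← Finsupp.smul_single]
    try module

theorem symbolCoeff_symThetaOdd :
    symbolCoeff 1 (symThetaOdd F) = Complex.I • Finsupp.single (0, 2) 1 -
      Complex.I • Finsupp.single (0, 0) (taylorLin 0 F) ∧
    symbolCoeff 3 (symThetaOdd F) =
      -((1 / 12 * Complex.I) • Finsupp.single (0, 0) (taylorLin 2 F)) -
      (1 / 6 : ℂ) • Finsupp.single (0, 1) (δ^[1] (taylorLin 1 F)) ∧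
    symbolCoeff 5 (symThetaOdd F) =
      -((1 / 80 * Complex.I) • Finsupp.single (0, 0) (taylorLin 4 F)) -
      (1 / 40 : ℂ) • Finsupp.single (0, 1) (δ^[1] (taylorLin 3 F)) +
      Complex.I • Finsupp.single (0, 0)
        ((1 / 180 : ℂ) • (δ^[1] (taylorLin 0 F) * δ^[1] (taylorLin 2 F)) -
          (1 / 120 : ℂ) • (δ^[1] (taylorLin 1 F)) ^ 2) +
      (1 / 90 * Complex.I) • Finsupp.single (0, 2) (δ^[2] (taylorLin 2 F)) +
      (1 / 6 : ℂ) • Finsupp.single (0, 1)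
        ((-1 / 10 : ℂ) • (δ^[1] (taylorLin 0 F) * δ^[2] (taylorLin 1 F)) -
          (1 / 30 : ℂ) • (δ^[1] (taylorLin 1 F) * δ^[2] (taylorLin 0 F))) -
      (1 / 90 : ℂ) • Finsupp.single (0, 3) (δ^[3] (taylorLin 1 F)) +
      (1 / 720 * Complex.I) • Finsupp.single (2, 0) (δ^[4] (taylorLin 2 F)) := by
  refine ⟨?_, ?_, ?_⟩ <;>
  · simp only [symThetaOdd, magnusSymbol, map_add, map_sub,
      symbolCoeff_symTerm, Nat.reduceLeDiff, Nat.reduceSub, OfNat.ofNat_ne_zero,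
      if_true, if_false, le_refl, Nat.sub_self, Nat.sub_zero, zero_le, taylorLin_one,
      taylorLin_psiEven, taylorLin_phiOdd,
      taylorLin_δ_iterate, taylorLin_momStep_even_zero, taylorLin_momStep_odd_one,
      taylorLin_momStep_even_two, taylorLin_momStep_odd_three, δ_iterate_smul, δ_iterate_zero,
      smul_smul, smul_zero, Finsupp.single_zero, sub_zero, add_zero, zero_sub,
      ← Finsupp.smul_single]
    try module

/-- Only even `n` need an argument. Orders zero and two lie below the prefactor `h³`, and at orders
four and six the antisymmetric moments cancel in pairs, as the kernel factors commute. -/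
theorem taylorLin_psiInt {n : ℕ} (hn : n < 7) :
    taylorLin n (psiInt F) = taylorLin n (psiEven F) := by
  rw [psiEven, taylorLin_triEven]
  split_ifs with h
  · rfl
  · rw [psiInt, taylorLin_triStep]
    interval_cases n
    all_goals first
      | exact absurd (by decide) h
      | simp only [Nat.reduceAdd, Nat.reduceLeDiff, Nat.reduceSub, if_false, if_true,
          Finset.Nat.antidiagonal_succ, Finset.Nat.antidiagonal_zero,
          Finset.sum_cons, Finset.map_cons, Finset.map_singleton, Finset.sum_singleton,
          Function.Embedding.prodMap, Function.Embedding.coeFn_mk, Prod.map_apply,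
          Function.Embedding.refl_apply, Nat.succ_eq_add_one, moments_psi]
    all_goals
      push_cast
      generalize taylorLin 0 (δ^[1] F) = a₀
      generalize taylorLin 1 (δ^[1] F) = a₁
      generalize taylorLin 2 (δ^[1] F) = a₂
      generalize taylorLin 3 (δ^[1] F) = a₃
      algebra

theorem taylorLin_phiInt {n : ℕ} (hn : n < 7) :
    taylorLin n (phiInt F) = taylorLin n (phiOdd F) := by
  rw [phiOdd, map_add, taylorLin_triOdd, taylorLin_triOdd]
  split_ifs with h
  · rw [phiInt, map_add, taylorLin_triStep, taylorLin_triStep]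
    interval_cases n
    all_goals first
      | exact absurd h (by decide)
      | simp only [Nat.reduceAdd, Nat.reduceLeDiff, Nat.reduceSub, if_false, if_true,
          Finset.Nat.antidiagonal_succ, Finset.Nat.antidiagonal_zero,
          Finset.sum_cons, Finset.map_cons, Finset.map_singleton, Finset.sum_singleton,
          Function.Embedding.prodMap, Function.Embedding.coeFn_mk, Prod.map_apply,
          Function.Embedding.refl_apply, Nat.succ_eq_add_one, moments_varphi₁_add_phi₁,
          moments_varphi₂_add_phi₂]
    all_goals
      push_cast
      algebra
  · rw [phiInt, map_add]

/-- At odd orders the two forms contain the same terms. At even orders below seven all integrals in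
`Θ₄` have zero coefficients because the relevant moments vanish or cancel. -/
theorem symbolCoeff_symTheta {n : ℕ} (hn : n < 7) :
    symbolCoeff n (symTheta F) = symbolCoeff n (symThetaOdd F) := by
  have h : taylorLin n (momStep F 0 0) = taylorLin n (momStep (evenStep F) 0 0) ∧
      taylorLin n (momStep F 1 1) = taylorLin n (momStep (oddStep F) 1 1) ∧
      taylorLin n (momStep F 2 1) = taylorLin n (momStep (evenStep F) 2 1) ∧
      taylorLin n (momStep F 3 1) = taylorLin n (momStep (oddStep F) 3 1) ∧
      taylorLin n (psiInt F) = taylorLin n (psiEven F) ∧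
      taylorLin n (phiInt F) = taylorLin n (phiOdd F) := by
    refine ⟨?_, ?_, ?_, ?_, taylorLin_psiInt F hn, taylorLin_phiInt F hn⟩
    · interval_cases n <;> simp [taylorLin_momStep, taylorLin_evenStep, moments_bernWeight_zero,
        Nat.even_iff]
    · interval_cases n <;> simp [taylorLin_momStep, taylorLin_oddStep, moments_bernWeight_one,
        Nat.even_iff]
    · interval_cases n <;> simp [taylorLin_momStep, taylorLin_evenStep, moments_bernWeight_two,
        Nat.even_iff]
    · interval_cases n <;> simp [taylorLin_momStep, taylorLin_oddStep, moments_bernWeight_three,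
        Nat.even_iff]
  obtain ⟨h1, h2, h3, h4, h5, h6⟩ := h
  simp only [symTheta, symThetaOdd, magnusSymbol, map_add, map_sub, symbolCoeff_symTerm, zero_le,
    if_true, Nat.sub_zero, taylorLin_δ_iterate, h1, h2, h3, h4, h5, h6]

end Exponents
end MagnusZassenhaus
namespace MagnusZassenhaus

section Remainder

variable {L : ℝ}

/-! ### Exact commutators -/

theorem lie_epsInv_mul {x y z : OpFam L} (h : x * y - y * x = epsOp * z) :
    ⁅epsInv * x, epsInv * y⁆ = epsInv * z := by
  have k : ∀ x y : OpFam L, epsInv * x * (epsInv * y) = epsInv * (epsInv * (x * y)) := fun x y => by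
    rw [mul_assoc, ← mul_assoc x, ← epsInv_comm, mul_assoc]
  rw [Ring.lie_def, k, k, ← mul_sub, ← mul_sub, h, ← mul_assoc epsInv epsOp, epsInv_mul_epsOp,
    one_mul]

theorem quant_zero_zero (f : CoeffFun L) : quant (Finsupp.single (0, 0) f) = epsInv * mulFam f := by
  rw [quant_single, pow_zero, pow_zero, one_mul, mul_one, one_mul, ← two_smul ℂ, mul_smul_comm,
    smul_smul]
  norm_num

theorem quant_two_zero (f : CoeffFun L) :
    quant (Finsupp.single (2, 0) f) = epsInv * (epsOp * (epsOp * mulFam f)) := by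
  rw [quant_single, pow_zero, mul_one, one_mul, ← two_smul ℂ, mul_smul_comm, mul_smul_comm,
    smul_smul, pow_two, mul_assoc]
  norm_num

theorem quant_zero_one (f : CoeffFun L) : quant (Finsupp.single (0, 1) f) =
    epsInv * ((1 / 2 : ℂ) • (mulFam f * epsD + epsD * mulFam f)) := by
  rw [quant_single, pow_zero, one_mul, pow_one, mul_smul_comm]

theorem quant_zero_two (f : CoeffFun L) : quant (Finsupp.single (0, 2) f) =
    epsInv * ((1 / 2 : ℂ) • (mulFam f * (epsD * epsD) + epsD * epsD * mulFam f)) := by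
  rw [quant_single, pow_zero, one_mul, pow_two, mul_smul_comm]

theorem quant_zero_two_one :
    quant (Finsupp.single (0, 2) (1 : CoeffFun L)) = epsInv * (epsD * epsD) := by
  rw [quant_zero_two, map_one, one_mul, mul_one, ← two_smul ℂ, smul_smul]
  norm_num

theorem epsD_commutator (f : CoeffFun L) :
    epsD * mulFam f - mulFam f * epsD = epsOp * mulFam (δ f) := by
  rw [epsD_mul_mulFam, add_sub_cancel_left]

/-- From `[D², f] = [D, f] D + D [D, f]`, which is already symmetric, so the formula has no
lower-order correction. -/
theorem lie_kinetic_mul (f : CoeffFun L) :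
    ⁅quant (Finsupp.single (0, 2) (1 : CoeffFun L)), quant (Finsupp.single (0, 0) f)⁆ =
      (2 : ℂ) • quant (Finsupp.single (0, 1) (δ f)) := by
  have h : epsD * epsD * mulFam f - mulFam f * (epsD * epsD) =
      epsOp * (mulFam (δ f) * epsD + epsD * mulFam (δ f)) := by
    have e : epsD * epsD * mulFam f - mulFam f * (epsD * epsD) =
        (epsD * mulFam f - mulFam f * epsD) * epsD +
        epsD * (epsD * mulFam f - mulFam f * epsD) := by noncomm_ring
    rw [e, epsD_commutator, mul_add, ← mul_assoc epsD, ← epsOp_comm]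
    simp only [mul_assoc]
  rw [quant_zero_two_one, quant_zero_zero, lie_epsInv_mul h, quant_zero_one, mul_smul_comm,
    smul_smul]
  norm_num

theorem lie_mul_transport (f g : CoeffFun L) :
    ⁅quant (Finsupp.single (0, 0) f), quant (Finsupp.single (0, 1) g)⁆ =
      -quant (Finsupp.single (0, 0) (g * δ f)) := by
  have h : mulFam f * ((1 / 2 : ℂ) • (mulFam g * epsD + epsD * mulFam g)) -
      ((1 / 2 : ℂ) • (mulFam g * epsD + epsD * mulFam g)) * mulFam f =
      epsOp * -mulFam (g * δ f) := by
    have c : mulFam f * mulFam g = mulFam g * mulFam f := by rw [← map_mul, mul_comm, map_mul]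
    have e : mulFam f * (mulFam g * epsD + epsD * mulFam g) -
        (mulFam g * epsD + epsD * mulFam g) * mulFam f =
        -(mulFam g * (epsD * mulFam f - mulFam f * epsD) +
          (epsD * mulFam f - mulFam f * epsD) * mulFam g) + (mulFam f * mulFam g -
            mulFam g * mulFam f) * epsD + epsD * (mulFam f * mulFam g - mulFam g * mulFam f) := by
      noncomm_ring
    have c' : mulFam (δ f) * mulFam g = mulFam g * mulFam (δ f) := by
      rw [← map_mul, mul_comm, map_mul]
    rw [mul_smul_comm, smul_mul_assoc, ← smul_sub, e, epsD_commutator, c, sub_self, zero_mul,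
      mul_zero, add_zero, add_zero, ← mul_assoc, ← epsOp_comm, mul_assoc, mul_assoc, c', map_mul,
      mul_neg, ← two_smul ℂ, smul_neg, smul_smul]
    norm_num
  rw [quant_zero_zero, quant_zero_zero, quant_zero_one, lie_epsInv_mul h, mul_neg]

/-- The correction must be kept because the third order admits no error. It comes from symmetrising
`D g' D`, which equals `½ (g' D² + D² g')` minus `½ ε² g'''`. -/
theorem lie_kinetic_transport (g : CoeffFun L) :
    ⁅quant (Finsupp.single (0, 2) (1 : CoeffFun L)), quant (Finsupp.single (0, 1) g)⁆ =
      (2 : ℂ) • quant (Finsupp.single (0, 2) (δ g)) -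
      (1 / 2 : ℂ) • quant (Finsupp.single (2, 0) (δ^[3] g)) := by
  have h1 : epsD * (mulFam g * epsD + epsD * mulFam g) -
      (mulFam g * epsD + epsD * mulFam g) * epsD =
      epsOp * (mulFam (δ g) * epsD + epsD * mulFam (δ g)) := by
    have e : epsD * (mulFam g * epsD + epsD * mulFam g) -
        (mulFam g * epsD + epsD * mulFam g) * epsD =
        (epsD * mulFam g - mulFam g * epsD) * epsD +
        epsD * (epsD * mulFam g - mulFam g * epsD) := by noncomm_ring
    rw [e, epsD_commutator, mul_add, ← mul_assoc epsD, ← epsOp_comm]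
    simp only [mul_assoc]
  have h2 : epsD * mulFam (δ g) * epsD = (1 / 2 : ℂ) • (mulFam (δ g) * (epsD * epsD) +
      epsD * epsD * mulFam (δ g) - epsOp * (epsOp * mulFam (δ^[3] g))) := by
    have e : epsOp * (epsOp * mulFam (δ^[3] g)) =
        epsD * (epsOp * mulFam (δ (δ g))) - epsOp * mulFam (δ (δ g)) * epsD := by
      rw [← mul_assoc epsD, ← epsOp_comm, mul_assoc, mul_assoc, ← mul_sub, epsD_commutator]
      rfl
    rw [e, ← epsD_commutator]
    have e' : mulFam (δ g) * (epsD * epsD) + epsD * epsD * mulFam (δ g) -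
        (epsD * (epsD * mulFam (δ g) - mulFam (δ g) * epsD) -
          (epsD * mulFam (δ g) - mulFam (δ g) * epsD) * epsD) =
        epsD * mulFam (δ g) * epsD + epsD * mulFam (δ g) * epsD := by noncomm_ring
    rw [e', ← two_smul ℂ, smul_smul]
    norm_num
  have h : epsD * epsD * ((1 / 2 : ℂ) • (mulFam g * epsD + epsD * mulFam g)) -
      ((1 / 2 : ℂ) • (mulFam g * epsD + epsD * mulFam g)) * (epsD * epsD) =
      epsOp * ((mulFam (δ g) * (epsD * epsD) + epsD * epsD * mulFam (δ g)) -
        (1 / 2 : ℂ) • (epsOp * (epsOp * mulFam (δ^[3] g)))) := by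
    generalize hx : mulFam g * epsD + epsD * mulFam g = x at h1 ⊢
    have e : epsD * epsD * x - x * (epsD * epsD) =
        epsD * (epsD * x - x * epsD) + (epsD * x - x * epsD) * epsD := by noncomm_ring
    rw [mul_smul_comm, smul_mul_assoc, ← smul_sub, e, h1, ← mul_assoc epsD epsOp, ← epsOp_comm,
      mul_assoc, mul_assoc, ← mul_add, ← mul_smul_comm]
    congr 1
    have e2 : epsD * (mulFam (δ g) * epsD + epsD * mulFam (δ g)) +
        (mulFam (δ g) * epsD + epsD * mulFam (δ g)) * epsD =
        mulFam (δ g) * (epsD * epsD) + epsD * epsD * mulFam (δ g) +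
        (epsD * mulFam (δ g) * epsD + epsD * mulFam (δ g) * epsD) := by noncomm_ring
    rw [e2, h2]
    module
  rw [quant_zero_two_one, quant_zero_one, lie_epsInv_mul h, quant_zero_two, quant_two_zero,
    mul_sub, mul_smul_comm, mul_smul_comm, smul_smul]
  norm_num

/-! ### Operators with a principal symbol -/

open Polynomial

theorem opSmall_le_opLie {x : OpFam L} (hx : x ∈ opSmall L) : x ∈ opLie L := by
  have h : x = epsOp * (epsInv * x) := by rw [← mul_assoc, epsOp_mul_epsInv, one_mul]
  rw [mem_opLie, h]
  exact mul_mem epsOp_mem (mul_mem epsOp_mem (mem_opSmall.1 hx))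

theorem symQuant_add (p q : (CoeffFun L)[X]) : symQuant (p + q) = symQuant p + symQuant q := by
  simp only [symQuant, map_add, mul_add, smul_add]; abel

theorem symbδ_smul (c : ℂ) (p : (CoeffFun L)[X]) : symbδ (c • p) = c • symbδ p := map_smul _ _ _

theorem symQuant_smul (c : ℂ) (p : (CoeffFun L)[X]) : symQuant (c • p) = c • symQuant p := by
  simp only [symQuant, map_smul, derivative_smul, mul_smul_comm]
  module

/-- Operators with a given principal symbol. -/
def HasSymbol (x : OpFam L) (p : (CoeffFun L)[X]) : Prop := x - lieQuant p ∈ opSmall L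

theorem HasSymbol.mem_opLie {x : OpFam L} {p : (CoeffFun L)[X]} (h : HasSymbol x p) :
    x ∈ opLie L := by
  have := add_mem (opSmall_le_opLie h) (lieQuant_mem p)
  rwa [sub_add_cancel] at this

theorem HasSymbol.add {x y : OpFam L} {p q : (CoeffFun L)[X]} (h : HasSymbol x p)
    (h' : HasSymbol y q) : HasSymbol (x + y) (p + q) := by
  have := add_mem h h'
  rw [HasSymbol, lieQuant, symQuant_add, mul_add, add_sub_add_comm]
  exact this

theorem HasSymbol.smul {x : OpFam L} {p : (CoeffFun L)[X]} (h : HasSymbol x p) (c : ℂ) :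
    HasSymbol (c • x) (c • p) := by
  rw [HasSymbol, lieQuant, symQuant_smul, mul_smul_comm, ← smul_sub]
  exact Submodule.smul_mem _ c h

theorem HasSymbol.neg {x : OpFam L} {p : (CoeffFun L)[X]} (h : HasSymbol x p) :
    HasSymbol (-x) (-p) := by
  simpa only [neg_one_smul] using h.smul (-1)

theorem HasSymbol.sub {x y : OpFam L} {p q : (CoeffFun L)[X]} (h : HasSymbol x p)
    (h' : HasSymbol y q) : HasSymbol (x - y) (p - q) := by
  rw [sub_eq_add_neg, sub_eq_add_neg]; exact h.add h'.neg

/-- The symbol parts obey `lieQuant_lie`, and an error in `opSmall` remains there under a bracket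
with an element of `opLie`. Nested commutators can therefore be computed on symbols. -/
theorem HasSymbol.lie {x y : OpFam L} {p q : (CoeffFun L)[X]} (h : HasSymbol x p)
    (h' : HasSymbol y q) : HasSymbol ⁅x, y⁆ (poisson p q) := by
  have e : ⁅x, y⁆ - lieQuant (poisson p q) = ⁅x - lieQuant p, y⁆ + ⁅lieQuant p, y - lieQuant q⁆ +
      (⁅lieQuant p, lieQuant q⁆ - lieQuant (poisson p q)) := by
    simp only [Ring.lie_def]; noncomm_ring
  rw [HasSymbol, e]
  exact add_mem (add_mem (opSmall_lie_mem h h'.mem_opLie)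
    (lie_opSmall_mem (lieQuant_mem p) h')) (lieQuant_lie p q)

theorem hasSymbol_zero_iff {x : OpFam L} : HasSymbol x 0 ↔ x ∈ opSmall L := by
  have h : lieQuant (0 : (CoeffFun L)[X]) = 0 := by simp [lieQuant, symQuant]
  rw [HasSymbol, h, sub_zero]

theorem hasSymbol_quant (k : ℕ) (f : CoeffFun L) :
    HasSymbol (quant (Finsupp.single (0, k) f)) (C f * X ^ k) := quant_single_sub_lieQuant_mem k f

theorem hasSymbol_quant_two (k : ℕ) (f : CoeffFun L) :
    HasSymbol (quant (Finsupp.single (2, k) f)) 0 :=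
  hasSymbol_zero_iff.2 (quant_single_mem_opSmall 0 k f)

end Remainder
end MagnusZassenhaus
namespace MagnusZassenhaus

/-! ### The exponent of the splitting -/

section Splitting

open PowerSeries (coeff)

variable {R : Type*} [Ring R] [Algebra ℂ R]

/-- Three nested symmetric products, from the inside outwards. As `C` and `D` start at order three,
their exponents just add up to order five, and conjugation by `B` contributes a single double
commutator. The outermost factor is left to `symmetric_bch_of_monomial`. -/
theorem exists_palindromic_formalExp {K : Submodule ℂ R} (hK : IsLieClosed K)
    {A B C D : PowerSeries R} (hA : IsOddSeries A) (hB : IsOddSeries B) (hC : IsOddSeries C)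
    (hD : IsOddSeries D) (hAK : CoeffsIn K A) (hBK : CoeffsIn K B) (hCK : CoeffsIn K C)
    (hDK : CoeffsIn K D) (hC1 : coeff 1 C = 0)
    (hD1 : coeff 1 D = 0) :
    ∃ Y Z : PowerSeries R, IsOddSeries Z ∧ CoeffsIn K Z ∧
      formalExp Z = formalExp ((1 / 2 : ℂ) • A) * formalExp ((1 / 2 : ℂ) • B) *
        formalExp ((1 / 2 : ℂ) • C) * formalExp D * formalExp ((1 / 2 : ℂ) • C) *
        formalExp ((1 / 2 : ℂ) • B) * formalExp ((1 / 2 : ℂ) • A) ∧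
      IsOddSeries Y ∧
      formalExp Z = formalExp ((1 / 2 : ℂ) • A) * formalExp Y * formalExp ((1 / 2 : ℂ) • A) ∧
      coeff 1 Y = coeff 1 B ∧ coeff 3 Y = coeff 3 B + (coeff 3 C + coeff 3 D) ∧
      coeff 5 Y = coeff 5 B + (coeff 5 C + coeff 5 D) -
        (1 / 24 : ℂ) • ⁅coeff 1 B, ⁅coeff 1 B, coeff 3 C + coeff 3 D⁆⁆ := by
  obtain ⟨X, hX, hXK, eX⟩ := exists_symmetric_formalExp hK hC hD hCK hDK
  obtain ⟨Y, hY, hYK, eY⟩ := exists_symmetric_formalExp hK hB hX hBK hXK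
  obtain ⟨Z, hZ, hZK, eZ⟩ := exists_symmetric_formalExp hK hA hY hAK hYK
  obtain ⟨x1, x3, x5⟩ := symmetric_bch_of_coeff_one_eq_zero hC hD hX hD1 eX
  rw [hC1] at x1
  obtain ⟨y1, y3, y5⟩ := symmetric_bch_of_coeff_one_eq_zero hB hX hY x1 eY
  refine ⟨Y, Z, hZ, hZK, ?_, hY, eZ, y1, by rw [y3, x3], ?_⟩
  · rw [eZ, eY, eX]; simp only [mul_assoc]
  · rw [y5, x5, x3, hC1]
    simp only [Ring.lie_def, zero_mul, mul_zero, sub_zero, smul_zero]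

end Splitting

/-! ### Comparison of the splitting with the Magnus expansion at orders three and five -/

section Remainder

open PowerSeries (coeff)

variable {L : ℝ}

/-- The power series of operators with the Taylor coefficients of a symbol. -/
def symbolSeries (p : ℕ × ℕ →₀ StepFun L) : PowerSeries (OpFam L) :=
  PowerSeries.mk fun n => quant (symbolCoeff n p)

theorem coeff_symbolSeries (p : ℕ × ℕ →₀ StepFun L) (n : ℕ) :
    coeff n (symbolSeries p) = quant (symbolCoeff n p) := PowerSeries.coeff_mk _ _

theorem symbolSeries_coeffsIn (p : ℕ × ℕ →₀ StepFun L) : CoeffsIn (opLie L) (symbolSeries p) :=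
  fun n => by rw [coeff_symbolSeries]; exact quant_mem_opLie _

theorem lie_csmul (c d : ℂ) (x y : OpFam L) : ⁅c • x, d • y⁆ = (c * d) • ⁅x, y⁆ := by
  simp only [Ring.lie_def, smul_mul_smul_comm, smul_sub, mul_comm d c]

/-- The third order of the exponent of the splitting is that of the Magnus expansion. -/
theorem splitting_third_order (f g k : CoeffFun L) {a b c d : OpFam L}
    (ha : a = Complex.I • quant (Finsupp.single (0, 2) 1))
    (hb : b = -Complex.I • quant (Finsupp.single (0, 0) f))
    (hc : c = (1 / 6 * Complex.I) • quant (Finsupp.single (0, 0) ((δ^[1] f) ^ 2)) -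
      (1 / 6 : ℂ) • quant (Finsupp.single (0, 1) (δ^[1] g)) +
      (1 / 6 * Complex.I) • quant (Finsupp.single (0, 2) (δ^[2] f)))
    (hd : d = -((1 / 24 * Complex.I) • quant (Finsupp.single (2, 0) (δ^[4] f)))) :
    (-Complex.I * (1 / 12)) • quant (Finsupp.single (0, 0) k) + (c + d)
      - (1 / 24 : ℂ) • ⁅a, ⁅a, b⁆⁆ - (1 / 12 : ℂ) • ⁅b, ⁅a, b⁆⁆ =
    -((1 / 12 * Complex.I) • quant (Finsupp.single (0, 0) k)) -
      (1 / 6 : ℂ) • quant (Finsupp.single (0, 1) (δ^[1] g)) := by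
  have e1 : ⁅a, b⁆ = (2 : ℂ) • quant (Finsupp.single (0, 1) (δ f)) := by
    rw [ha, hb, lie_csmul, lie_kinetic_mul, smul_smul, mul_neg, Complex.I_mul_I]
    norm_num
  have e2 : (δ^[1] f) ^ 2 = δ f * δ f := pow_two _
  -- The principal parts of the two double commutators cancel the quadratic and second-order terms
  -- of `c`. The `ε²` correction in `[a, [a, b]]` cancels `d`, which is the reason for the
  -- fourth-derivative term of `W3` with factor `1/24`.
  rw [e1, ha, hb, lie_csmul, lie_csmul, lie_kinetic_transport, lie_mul_transport, hc, hd, e2]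
  have e3 : δ^[2] f = δ (δ f) := rfl
  have e4 : δ^[4] f = δ^[3] (δ f) := rfl
  rw [e3, e4]
  module

open Polynomial

theorem HasSymbol.congr {x : OpFam L} {p q : (CoeffFun L)[X]} (h : HasSymbol x p) (e : p = q) :
    HasSymbol x q := e ▸ h

theorem HasSymbol.poisson {x y : OpFam L} {p q r : (CoeffFun L)[X]} (hx : HasSymbol x p)
    (hy : HasSymbol y q) (e : MagnusZassenhaus.poisson p q = r) : HasSymbol ⁅x, y⁆ r :=
  (hx.lie hy).congr e

/-- `F`, `G`, `K` stand for derivatives of Taylor coefficients of the potential, constant in the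
momentum `X`. The imaginary unit is a letter `i`, and each square of it is removed through `hI`, so
that all results are at most linear in `i`. -/
theorem poisson_brackets {i : ℂ} (hI : i • i • (1 : (CoeffFun L)[X]) = -1)
    {F G K : ℕ → (CoeffFun L)[X]} (dF : ∀ n, derivative (F n) = 0)
    (dG : ∀ n, derivative (G n) = 0) (dK : ∀ n, derivative (K n) = 0)
    (sF : ∀ n, symbδ (F n) = F (n + 1)) (sG : ∀ n, symbδ (G n) = G (n + 1))
    (sK : ∀ n, symbδ (K n) = K (n + 1)) :
    let A : (CoeffFun L)[X] := i • X ^ 2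
    let B := -i • F 0
    let C₃ := (1 / 6 * i) • F 1 ^ 2 - (1 / 6 : ℂ) • (G 1 * X) + (1 / 6 * i) • (F 2 * X ^ 2)
    let Y₃ := (-i * (1 / 12)) • K 0 + C₃
    let AB := (2 : ℂ) • (F 1 * X)
    let AAB := (4 * i) • (F 2 * X ^ 2)
    let BAB := (2 * i) • F 1 ^ 2
    let AAAB := (-8 : ℂ) • (F 3 * X ^ 3)
    let AY₃ := (1 / 6 : ℂ) • (K 1 * X) - (2 / 3 : ℂ) • (F 1 * F 2 * X) -
      (1 / 3 * i) • (G 2 * X ^ 2) - (1 / 3 : ℂ) • (F 3 * X ^ 3)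
    let BC₃ := -((1 / 6 * i) • (F 1 * G 1)) - (1 / 3 : ℂ) • (F 1 * F 2 * X)
    (poisson A B = AB ∧ poisson A AB = AAB ∧ poisson B AB = BAB ∧ poisson A AAB = AAAB ∧
      poisson A Y₃ = AY₃ ∧ poisson B C₃ = BC₃) ∧
    (poisson A AAAB = (-16 * i) • (F 4 * X ^ 4) ∧ poisson B AAAB = (-24 * i) • (F 1 * F 3 * X ^ 2) ∧
      poisson A BAB = (-8 : ℂ) • (F 1 * F 2 * X) ∧ poisson B AAB = (-8 : ℂ) • (F 1 * F 2 * X) ∧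
      poisson A ((-8 : ℂ) • (F 1 * F 2 * X)) = (-16 * i) • ((F 2 ^ 2 + F 1 * F 3) * X ^ 2) ∧
      poisson B ((-8 : ℂ) • (F 1 * F 2 * X)) = (-8 * i) • (F 1 ^ 2 * F 2)) ∧
    (poisson B BAB = 0 ∧ poisson A AY₃ = (1 / 3 * i) • (K 2 * X ^ 2) -
        (4 / 3 * i) • ((F 2 ^ 2 + F 1 * F 3) * X ^ 2) + (2 / 3 : ℂ) • (G 3 * X ^ 3) -
        (2 / 3 * i) • (F 4 * X ^ 4) ∧
      poisson Y₃ AB = -((1 / 3 : ℂ) • (G 1 * F 2 * X)) + (2 / 3 * i) • (F 2 ^ 2 * X ^ 2) +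
        (1 / 6 * i) • (F 1 * K 1) - (2 / 3 * i) • (F 1 ^ 2 * F 2) +
        (1 / 3 : ℂ) • (F 1 * G 2 * X) - (1 / 3 * i) • (F 1 * F 3 * X ^ 2) ∧
      poisson B AY₃ = (1 / 6 * i) • (F 1 * K 1) - (2 / 3 * i) • (F 1 ^ 2 * F 2) +
        (2 / 3 : ℂ) • (F 1 * G 2 * X) - i • (F 1 * F 3 * X ^ 2) ∧
      poisson B BC₃ = -((1 / 3 * i) • (F 1 ^ 2 * F 2))) ∧ poisson A 0 = 0 ∧ poisson B 0 = 0 := by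
  refine ⟨⟨?_, ?_, ?_, ?_, ?_, ?_⟩, ⟨?_, ?_, ?_, ?_, ?_, ?_⟩, ⟨?_, ?_, ?_, ?_, ?_⟩, ?_, ?_⟩
  all_goals simp only [poisson, symbδ_smul, symbδ_X, symbδ_mul, pow_succ, pow_zero, one_mul,
    map_add,
    map_sub, map_neg, map_zero, derivative_smul, derivative_mul, derivative_X, dF, dG, dK, sF, sG,
    sK, Nat.reduceAdd, mul_zero, zero_mul, smul_zero, add_zero, zero_add, sub_zero, zero_sub,
    mul_one]
  · linear_combination (norm := algebra) (-2 * F 1 * X) * hI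
  · algebra
  · algebra
  · linear_combination (norm := algebra) (8 * F 3 * X ^ 3) * hI
  · linear_combination (norm := algebra) ((-1 / 6 : ℂ) • K 1 * X + (2 / 3 : ℂ) • (F 1 * F 2 * X) +
      (1 / 3 : ℂ) • (F 3 * X ^ 3)) * hI
  · linear_combination (norm := algebra) ((1 / 3 : ℂ) • (F 1 * F 2 * X)) * hI
  · algebra
  · algebra
  · linear_combination (norm := algebra) (8 * F 1 * F 2 * X) * hI
  · linear_combination (norm := algebra) (8 * F 1 * F 2 * X) * hI
  · algebra
  · algebra
  · linear_combination (norm := algebra) ((-2 / 3 : ℂ) • (G 3 * X ^ 3)) * hI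
  · algebra
  · linear_combination (norm := algebra) ((-2 / 3 : ℂ) • (F 1 * G 2 * X)) * hI
  · algebra

set_option maxHeartbeats 1000000 in
/-- The fifth order of the exponent of the splitting is that of the Magnus expansion, up to
operators of lower order. -/
theorem splitting_fifth_order (f g k l m : CoeffFun L) {a b c₃ d₃ y₃ c₅ d₅ : OpFam L}
    (ha : a = Complex.I • quant (Finsupp.single (0, 2) 1))
    (hb : b = -Complex.I • quant (Finsupp.single (0, 0) f))
    (hc₃ : c₃ = (1 / 6 * Complex.I) • quant (Finsupp.single (0, 0) ((δ^[1] f) ^ 2)) -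
      (1 / 6 : ℂ) • quant (Finsupp.single (0, 1) (δ^[1] g)) +
      (1 / 6 * Complex.I) • quant (Finsupp.single (0, 2) (δ^[2] f)))
    (hd₃ : d₃ = -((1 / 24 * Complex.I) • quant (Finsupp.single (2, 0) (δ^[4] f))))
    (hy₃ : y₃ = (-Complex.I * (1 / 12)) • quant (Finsupp.single (0, 0) k) + (c₃ + d₃))
    (hc₅ : c₅ = (1 / 36 * Complex.I) • quant (Finsupp.single (0, 0) (δ^[1] f * δ^[1] k)) -
      (1 / 40 : ℂ) • quant (Finsupp.single (0, 1) (δ^[1] l)) +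
      (1 / 72 * Complex.I) • quant (Finsupp.single (0, 2) (δ^[2] k)))
    (hd₅ : d₅ = Complex.I • quant (Finsupp.single (0, 0)
        ((1 / 180 : ℂ) • (δ^[1] f * δ^[1] k) - (1 / 120 : ℂ) • (δ^[1] g) ^ 2)) -
      (1 / 288 * Complex.I) • quant (Finsupp.single (2, 0) (δ^[4] k)) -
      (7 / 120 * Complex.I) • quant (Finsupp.single (0, 0) ((δ^[1] f) ^ 2 * δ^[2] f)) +
      (1 / 6 : ℂ) • quant (Finsupp.single (0, 1)
        ((-1 / 10 : ℂ) • (δ^[1] f * δ^[2] g) - (1 / 30 : ℂ) • (δ^[1] g * δ^[2] f))) +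
      quant (Finsupp.single (0, 1) ((1 / 12 : ℂ) • (δ^[1] f * δ^[2] g) -
        (1 / 36 : ℂ) • (δ^[2] f * δ^[1] g))) +
      (1 / 30 * Complex.I) • quant (Finsupp.single (0, 2) ((δ^[2] f) ^ 2 -
        (2 : ℂ) • (δ^[1] f * δ^[3] f))) +
      (1 / 90 * Complex.I) • quant (Finsupp.single (0, 2) (δ^[2] k)) +
      (1 / 60 : ℂ) • quant (Finsupp.single (0, 3) (δ^[3] g)) -
      (1 / 120 * Complex.I) • quant (Finsupp.single (0, 4) (δ^[4] f))) :
    (-Complex.I * (1 / 80)) • quant (Finsupp.single (0, 0) m) + (c₅ + d₅)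
      - (1 / 24 : ℂ) • ⁅b, ⁅b, c₃ + d₃⁆⁆
      - (1 / 24 : ℂ) • ⁅a, ⁅a, y₃⁆⁆ - (1 / 12 : ℂ) • ⁅y₃, ⁅a, b⁆⁆ - (1 / 12 : ℂ) • ⁅b, ⁅a, y₃⁆⁆
      + (7 / 5760 : ℂ) • ⁅a, ⁅a, ⁅a, ⁅a, b⁆⁆⁆⁆ + (1 / 360 : ℂ) • ⁅b, ⁅a, ⁅a, ⁅a, b⁆⁆⁆⁆
      + (1 / 480 : ℂ) • ⁅a, ⁅a, ⁅b, ⁅a, b⁆⁆⁆⁆ + (1 / 120 : ℂ) • ⁅b, ⁅b, ⁅a, ⁅a, b⁆⁆⁆⁆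
      - (1 / 360 : ℂ) • ⁅a, ⁅b, ⁅b, ⁅a, b⁆⁆⁆⁆ + (1 / 720 : ℂ) • ⁅b, ⁅b, ⁅b, ⁅a, b⁆⁆⁆⁆ -
    (-((1 / 80 * Complex.I) • quant (Finsupp.single (0, 0) m)) -
      (1 / 40 : ℂ) • quant (Finsupp.single (0, 1) (δ^[1] l)) +
      Complex.I • quant (Finsupp.single (0, 0)
        ((1 / 180 : ℂ) • (δ^[1] f * δ^[1] k) - (1 / 120 : ℂ) • (δ^[1] g) ^ 2)) +
      (1 / 90 * Complex.I) • quant (Finsupp.single (0, 2) (δ^[2] k)) +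
      (1 / 6 : ℂ) • quant (Finsupp.single (0, 1)
        ((-1 / 10 : ℂ) • (δ^[1] f * δ^[2] g) - (1 / 30 : ℂ) • (δ^[1] g * δ^[2] f))) -
      (1 / 90 : ℂ) • quant (Finsupp.single (0, 3) (δ^[3] g)) +
      (1 / 720 * Complex.I) • quant (Finsupp.single (2, 0) (δ^[4] k))) ∈ opSmall L := by
  have q := fun n f => hasSymbol_quant (L := L) n f
  have q₂ := fun f => hasSymbol_quant_two (L := L) 0 f
  have hI : Complex.I • Complex.I • (1 : (CoeffFun L)[X]) = -1 := by
    rw [smul_smul, Complex.I_mul_I, neg_one_smul]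
  -- The unit is made opaque: only its square, recorded in `hI`, is needed.
  obtain ⟨i, hi⟩ : ∃ i, i = Complex.I := ⟨_, rfl⟩
  rw [← hi] at ha hb hc₃ hd₃ hy₃ hc₅ hd₅ hI ⊢
  clear hi
  have A : HasSymbol a (i • X ^ 2) := ha ▸ ((q 2 1).smul i).congr (by rw [C_1, one_mul])
  have B : HasSymbol b (-i • C f) := hb ▸ ((q 0 f).smul (-i)).congr (by rw [pow_zero, mul_one])
  have C₃ : HasSymbol (c₃ + d₃) ((1 / 6 * i) • C (δ^[1] f) ^ 2 - (1 / 6 : ℂ) • (C (δ^[1] g) * X) +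
      (1 / 6 * i) • (C (δ^[2] f) * X ^ 2)) := by
    -- `d₃` carries `ε²`, so its symbol is zero and it plays no role at order five.
    rw [hc₃, hd₃]
    refine (((((q _ _).smul _).sub ((q _ _).smul _)).add ((q _ _).smul _)).add
      ((q₂ _).smul _).neg).congr ?_
    simp only [map_pow, pow_zero, pow_one, mul_one, smul_zero, neg_zero, add_zero]
  have Y₃ : HasSymbol y₃ ((-i * (1 / 12)) • C k + ((1 / 6 * i) • C (δ^[1] f) ^ 2 -
      (1 / 6 : ℂ) • (C (δ^[1] g) * X) + (1 / 6 * i) • (C (δ^[2] f) * X ^ 2))) :=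
    hy₃ ▸ (((q 0 k).smul _).congr (by rw [pow_zero, mul_one])).add C₃
  have d : ∀ (f : CoeffFun L) n, derivative (C (δ^[n] f)) = 0 := fun _ _ => derivative_C
  have s : ∀ (f : CoeffFun L) n, symbδ (C (δ^[n] f)) = C (δ^[n + 1] f) := fun f n => by
    rw [symbδ_C, Function.iterate_succ_apply']
  obtain ⟨⟨h1, h2, h3, h4, h5, h6⟩, ⟨h7, h8, h9, h10, h11, h12⟩, ⟨h13, h14, h15, h16, h17⟩, h18,
    h19⟩ := poisson_brackets hI (d f) (d g) (d k) (s f) (s g) (s k)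
  have AB := A.poisson B h1
  have AAB := A.poisson AB h2
  have BAB := B.poisson AB h3
  have AAAB := A.poisson AAB h4
  have AY₃ := A.poisson Y₃ h5
  have BC₃ := B.poisson C₃ h6
  have AAAAB := A.poisson AAAB h7
  have BAAAB := B.poisson AAAB h8
  have ABAB := A.poisson BAB h9
  have BAAB := B.poisson AAB h10
  have AABAB := A.poisson ABAB h11
  have BBAAB := B.poisson BAAB h12
  have BBAB := B.poisson BAB h13
  have AAY₃ := A.poisson AY₃ h14
  have Y₃AB := Y₃.poisson AB h15
  have BAY₃ := B.poisson AY₃ h16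
  have BBC₃ := B.poisson BC₃ h17
  have ABBAB := A.poisson BBAB h18
  have BBBAB := B.poisson BBAB h19
  -- The difference lies in `opSmall` once its symbol vanishes. The symbol is assembled term by term
  -- in the shape of the expression.
  rw [← hasSymbol_zero_iff, hc₅, hd₅]
  refine ((((((((((((((q _ _).smul _).add (((((q _ _).smul _).sub ((q _ _).smul _)).add
    ((q _ _).smul _)).add ((((((((((q _ _).smul _).sub ((q₂ _).smul _)).sub ((q _ _).smul _)).add
    ((q _ _).smul _)).add (q _ _)).add ((q _ _).smul _)).add ((q _ _).smul _)).add
    ((q _ _).smul _)).sub ((q _ _).smul _)))).sub (BBC₃.smul _)).sub (AAY₃.smul _)).sub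
    (Y₃AB.smul _)).sub (BAY₃.smul _)).add (AAAAB.smul _)).add (BAAAB.smul _)).add
    (AABAB.smul _)).add (BBAAB.smul _)).sub (ABBAB.smul _)).add (BBBAB.smul _)).sub
    (((((((((q _ _).smul _).neg).sub ((q _ _).smul _)).add ((q _ _).smul _)).add
    ((q _ _).smul _)).add ((q _ _).smul _)).sub ((q _ _).smul _)).add ((q₂ _).smul _))).congr ?_
  -- What remains is an identity between polynomials, linear in `i` since every square of it has
  -- been eliminated.
  simp only [map_sub, map_mul, map_pow, ← smul_C, pow_zero, mul_one, pow_one, smul_zero]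
  generalize C (δ^[1] f) = f₁
  generalize C (δ^[2] f) = f₂
  generalize C (δ^[3] f) = f₃
  generalize C (δ^[4] f) = f₄
  generalize C (δ^[1] g) = g₁
  generalize C (δ^[2] g) = g₂
  generalize C (δ^[3] g) = g₃
  generalize C (δ^[1] k) = k₁
  generalize C (δ^[2] k) = k₂
  generalize C (δ^[1] l) = l₁
  algebra

end Remainder
end MagnusZassenhaus
namespace MagnusZassenhaus

/-! ### The remainder series, its size and the theorem -/

section Conclusion

open PowerSeries (coeff)

variable {L : ℝ}

theorem symbolSeries_isOddSeries (F : StepFun L) :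
    IsOddSeries (symbolSeries (symW0 L)) ∧ IsOddSeries (symbolSeries (symW1 F)) ∧
    IsOddSeries (symbolSeries (symW2 F)) ∧ IsOddSeries (symbolSeries (symW3 F)) := by
  refine ⟨fun n hn => ?_, fun n hn => ?_, fun n hn => ?_, fun n hn => ?_⟩ <;>
  · obtain ⟨-, h0, h1, h2, h3⟩ := symbolCoeff_even F hn
    simp only [coeff_symbolSeries, h0, h1, h2, h3, map_zero]

/-- The remainder is the logarithm of the splitting minus the series of `Θ₄`. Working with families
over all midpoints and all `ε` at once yields memberships in `opSmall` and `opLie`, from which the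
uniform sizes follow. -/
theorem exists_remainder (F : StepFun L) : ∃ R : PowerSeries (OpFam L),
    (∀ n < 7, n ≠ 5 → coeff n R = 0) ∧ coeff 5 R ∈ opSmall L ∧ CoeffsIn (opLie L) R ∧
    formalExp (symbolSeries (symTheta F) + R) =
      formalExp ((1 / 2 : ℂ) • symbolSeries (symW0 L)) *
      formalExp ((1 / 2 : ℂ) • symbolSeries (symW1 F)) *
      formalExp ((1 / 2 : ℂ) • symbolSeries (symW2 F)) * formalExp (symbolSeries (symW3 F)) *
      formalExp ((1 / 2 : ℂ) • symbolSeries (symW2 F)) *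
      formalExp ((1 / 2 : ℂ) • symbolSeries (symW1 F)) *
      formalExp ((1 / 2 : ℂ) • symbolSeries (symW0 L)) := by
  obtain ⟨o0, o1, o2, o3⟩ := symbolSeries_isOddSeries F
  obtain ⟨a1, a3, a5⟩ := symbolCoeff_symW0 (L := L)
  obtain ⟨b1, b3, b5⟩ := symbolCoeff_symW1 F
  obtain ⟨c1, c3, c5⟩ := symbolCoeff_symW2 F
  obtain ⟨d1, d3, d5⟩ := symbolCoeff_symW3 F
  obtain ⟨t1, t3, t5⟩ := symbolCoeff_symThetaOdd F
  obtain ⟨Y, Z, hZ, hZK, e, hY, eY, y1, y3, y5⟩ := exists_palindromic_formalExp opLie_isLieClosed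
    o0 o1 o2 o3 (symbolSeries_coeffsIn _) (symbolSeries_coeffsIn _) (symbolSeries_coeffsIn _)
    (symbolSeries_coeffsIn _) (by rw [coeff_symbolSeries, c1, map_zero])
    (by rw [coeff_symbolSeries, d1, map_zero])
  obtain ⟨z1, z3, z5⟩ := symmetric_bch_of_monomial o0 hY hZ
    (by rw [coeff_symbolSeries, a3, map_zero]) (by rw [coeff_symbolSeries, a5, map_zero]) eY
  simp only [coeff_symbolSeries] at y1 y3 y5 z1 z3 z5
  rw [y1] at z1 z3 z5
  have θ : ∀ n < 7, coeff n (Z - symbolSeries (symTheta F)) =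
      coeff n Z - quant (symbolCoeff n (symThetaOdd F)) := fun n hn => by
    rw [map_sub, coeff_symbolSeries, symbolCoeff_symTheta F hn]
  refine ⟨Z - symbolSeries (symTheta F), ?_, ?_, hZK.sub (symbolSeries_coeffsIn _), ?_⟩
  · intro n hn h5
    rw [θ n hn]
    rcases n.even_or_odd with he | ho
    · rw [hZ n he, (symbolCoeff_even F he).1, map_zero, sub_zero]
    · have : n = 1 ∨ n = 3 := by obtain ⟨m, rfl⟩ := ho; omega
      rcases this with rfl | rfl
      · rw [z1, a1, b1, t1]
        simp only [map_sub, map_smul]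
        module
      · rw [z3, y3, t3, sub_eq_zero, b3, map_smul]
        refine (splitting_third_order (taylorLin 0 F) (taylorLin 1 F) (taylorLin 2 F) ?_ ?_
          ?_ ?_).trans ?_
        · rw [a1, map_smul]
        · rw [b1, map_smul]
        · rw [c3]; simp only [map_add, map_sub, map_smul]
        · rw [d3]; simp only [map_neg, map_smul]
        · simp only [map_neg, map_sub, map_smul]
  · have h := splitting_fifth_order (taylorLin 0 F) (taylorLin 1 F) (taylorLin 2 F) (taylorLin 3 F)
      (taylorLin 4 F) (a := quant (symbolCoeff 1 (symW0 L))) (b := quant (symbolCoeff 1 (symW1 F)))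
      (c₃ := quant (symbolCoeff 3 (symW2 F))) (d₃ := quant (symbolCoeff 3 (symW3 F)))
      (c₅ := quant (symbolCoeff 5 (symW2 F))) (d₅ := quant (symbolCoeff 5 (symW3 F)))
      (by rw [a1, map_smul]) (by rw [b1, map_smul])
      (by rw [c3]; simp only [map_add, map_sub, map_smul])
      (by rw [d3]; simp only [map_neg, map_smul]) rfl
      (by rw [c5]; simp only [map_add, map_sub, map_smul])
      (by rw [d5]; simp only [map_add quant, map_sub quant, map_smul quant])
    rw [θ 5 (by norm_num), z5, y5, y3, b5, b3, t5]
    simp only [map_add quant, map_sub quant, map_smul quant, map_neg quant]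
    convert h using 1
  · rw [add_sub_cancel, e]

/-! ### Sizes -/

theorem HasSize.congr {A B : ℝ → PerSmooth L → (ℝ → ℂ)} {p : ℝ} (hA : HasSize A p)
    (h : ∀ ε, 0 < ε → ∀ u, A ε u = B ε u) : HasSize B p := fun u hu =>
  (hA u hu).congr' (eventually_pos.mono fun ε hε => congrArg (l2norm L) (h ε hε (u ε)))
    EventuallyEq.rfl

theorem hasSize_of_eq_zero {A : ℝ → PerSmooth L → (ℝ → ℂ)} (p : ℝ) (h : ∀ ε u, A ε u = 0) :
    HasSize A p := fun u _ => IsBigO.of_bound 0 (Eventually.of_forall fun ε => by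
      simp [h, l2norm])

theorem stepVar_pow_dvd_of_symbolCoeff {N : ℕ} {p : ℕ × ℕ →₀ StepFun L} {jk : ℕ × ℕ}
    (h : ∀ n < N, symbolCoeff n p jk = 0) : stepVar ^ N ∣ p jk :=
  stepVar_pow_dvd_iff.2 fun n hn => by rw [← taylorLin_apply, ← symbolCoeff_apply, h n hn]

/-- The coefficients below the stated order vanish, with the one exception of the third order of
`symW3`. It sits at two extra powers of `ε`, where only `h³` is required. -/
theorem stepVar_pow_dvd_symbols (F : StepFun L) (jk : ℕ × ℕ) :
    stepVar ^ (1 - jk.1) ∣ symW0 L jk ∧ stepVar ^ (1 - jk.1) ∣ symW1 F jk ∧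
    stepVar ^ (3 - jk.1) ∣ symW2 F jk ∧ stepVar ^ (5 - jk.1) ∣ symW3 F jk ∧
    stepVar ^ (7 - jk.1) ∣ (symTheta F - symThetaOdd F) jk := by
  refine ⟨?_, ?_, ?_, ?_, ?_⟩ <;> refine stepVar_pow_dvd_of_symbolCoeff fun n hn => ?_
  · obtain rfl : n = 0 := by omega
    rw [(symbolCoeff_even F Even.zero).2.1, Finsupp.zero_apply]
  · obtain rfl : n = 0 := by omega
    rw [(symbolCoeff_even F Even.zero).2.2.1, Finsupp.zero_apply]
  · rcases n.even_or_odd with he | ho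
    · rw [(symbolCoeff_even F he).2.2.2.1, Finsupp.zero_apply]
    · obtain rfl : n = 1 := by obtain ⟨m, rfl⟩ := ho; omega
      rw [(symbolCoeff_symW2 F).1, Finsupp.zero_apply]
  · rcases n.even_or_odd with he | ho
    · rw [(symbolCoeff_even F he).2.2.2.2, Finsupp.zero_apply]
    · have : n = 1 ∨ n = 3 := by obtain ⟨m, rfl⟩ := ho; omega
      rcases this with rfl | rfl
      · rw [(symbolCoeff_symW3 F).1, Finsupp.zero_apply]
      -- At the index `(2, 0)` the bound `n < 5 - 2` excludes `n = 3`.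
      · have hjk : ((2, 0) : ℕ × ℕ) ≠ jk := by rintro rfl; simp at hn
        rw [(symbolCoeff_symW3 F).2.1, Finsupp.neg_apply, Finsupp.smul_apply,
          Finsupp.single_eq_of_ne' hjk, smul_zero, neg_zero]
  · rw [map_sub, symbolCoeff_symTheta F (by omega), sub_self, Finsupp.zero_apply]

theorem hasSize_exponents (hL : 0 < L) {F : StepFun L} {V : ℝ → ℝ → ℝ}
    (hF : ∀ h t x, F (h, t) x = V x (t + h)) {t h : ℝ → ℝ} {T : ℝ} (ht : ∀ ε, |t ε| ≤ T) {σ : ℝ}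
    (hσ0 : 0 < σ) (hσ : σ ≤ 1) (hh : h =O[𝓝[>] (0 : ℝ)] fun ε => ε ^ σ) :
    HasSize (L := L) (fun ε u => W0 (h ε) ε u) (σ - 1) ∧
    HasSize (L := L) (fun ε u => W1 (shift V (t ε)) (h ε) ε u) (σ - 1) ∧
    HasSize (L := L) (fun ε u => W2 (shift V (t ε)) (h ε) ε u) (3 * σ - 1) ∧
    HasSize (L := L) (fun ε u => W3 (shift V (t ε)) (h ε) ε u) (5 * σ - 1) ∧
    HasSize (L := L) (fun ε u => Theta4 (shift V (t ε)) (h ε) ε u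
      - Theta4Odd (shift V (t ε)) (h ε) ε u) (7 * σ - 1) := by
  have H := fun N p hp => hasSize_quantAt hL ht hσ0 hσ hh N p hp
  have D := stepVar_pow_dvd_symbols F
  have h0 := H 1 (symW0 L) fun jk => (D jk).1
  have h1 := H 1 (symW1 F) fun jk => (D jk).2.1
  have h2 := H 3 (symW2 F) fun jk => (D jk).2.2.1
  have h3 := H 5 (symW3 F) fun jk => (D jk).2.2.2.1
  have h4 := H 7 (symTheta F - symThetaOdd F) fun jk => (D jk).2.2.2.2
  rw [Nat.cast_one, one_mul] at h0 h1
  rw [Nat.cast_ofNat] at h2 h3 h4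
  refine ⟨h0.congr fun ε hε u => quantAt_symW0 _ _ hε.ne' u,
    h1.congr fun ε hε u => quantAt_symW1 hF _ _ hε.ne' u,
    h2.congr fun ε hε u => quantAt_symW2 hF _ _ hε.ne' u,
    h3.congr fun ε hε u => quantAt_symW3 hF _ _ hε.ne' u, h4.congr fun ε hε u => ?_⟩
  rw [map_sub, LinearMap.sub_apply, Submodule.coe_sub, quantAt_symTheta hF _ _ hε.ne',
    quantAt_symThetaOdd hF _ _ hε.ne']

/-- Order five has size `5σ + 1 ≥ 7σ - 1` since `σ ≤ 1`, and orders from seven on have size `nσ - 1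
≥ 7σ - 1`. Nothing else occurs. -/
theorem hasSize_remainder (hL : 0 < L) {R : PowerSeries (OpFam L)}
    (h0 : ∀ n < 7, n ≠ 5 → coeff n R = 0) (h5 : coeff 5 R ∈ opSmall L) (hR : CoeffsIn (opLie L) R)
    {t h : ℝ → ℝ} {T : ℝ} (ht : ∀ ε, |t ε| ≤ T) {σ : ℝ}
    (hσ0 : 0 < σ) (hσ : σ ≤ 1) (hh : h =O[𝓝[>] (0 : ℝ)] fun ε => ε ^ σ) (n : ℕ) :
    HasSize (fun ε u => (h ε : ℂ) ^ n • (evalOp (t ε, ε) (coeff n R) u : ℝ → ℂ)) (7 * σ - 1) := by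
  rcases lt_or_ge n 7 with hn | hn
  · by_cases hn5 : n = 5
    · subst hn5
      exact hasSize_of_mem_opSmall hL ht hh h5 (by push_cast; linarith)
    · refine hasSize_of_eq_zero _ fun ε u => ?_
      rw [h0 n hn hn5, map_zero, LinearMap.zero_apply, Submodule.coe_zero, smul_zero]
  · refine hasSize_of_mem_opLie hL ht hh (hR n) ?_
    have : (7 : ℝ) ≤ n := by exact_mod_cast hn
    nlinarith

/-- The potential, as a function of the time step, the midpoint and the position. -/
def potential (V : ℝ → ℝ → ℝ) (hV : ContDiff ℝ ∞ (Function.uncurry V))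
    (hper : ∀ t : ℝ, Function.Periodic (fun x => V x t) L) : StepFun L :=
  PFun.mk (fun p x => (V x (p.2 + p.1) : ℂ))
    (Complex.ofRealCLM.contDiff.comp
      (hV.comp (contDiff_snd.prodMk ((contDiff_snd.add contDiff_fst).comp contDiff_fst))))
    fun p x => congrArg Complex.ofReal (hper (p.2 + p.1) x)

/-- Evaluation of the coefficients of a power series of operators. -/
def evalSeries (t ε : ℝ) :
    PowerSeries (OpFam L) →+* PowerSeries (Module.End ℂ (PerSmooth L)) :=
  PowerSeries.map ((evalOp (t, ε) : OpFam L →ₐ[ℂ] _) : OpFam L →+* _)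

theorem coeff_evalSeries (t ε : ℝ) (X : PowerSeries (OpFam L)) (n : ℕ) :
    coeff n (evalSeries t ε X) = evalOp (t, ε) (coeff n X) := PowerSeries.coeff_map _ _ _

theorem evalSeries_formalExp (t ε : ℝ) (X : PowerSeries (OpFam L)) :
    evalSeries t ε (formalExp X) = formalExp (evalSeries t ε X) := by
  ext1 n
  simp only [coeff_evalSeries, formalExp, PowerSeries.coeff_mk, map_sum, map_smul, ← map_pow]

theorem evalSeries_csmul (t ε : ℝ) (c : ℂ) (X : PowerSeries (OpFam L)) :
    evalSeries t ε (c • X) = c • evalSeries t ε X := by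
  ext1 n
  rw [coeff_evalSeries, coeff_csmul, map_smul, ← coeff_evalSeries]
  rfl

theorem hasExpansion_evalSeries {p : ℕ × ℕ →₀ StepFun L} (t : ℝ) {ε : ℝ} (hε : 0 < ε)
    {A : ℝ → PerSmooth L → (ℝ → ℂ)} (hA : ∀ h u, (quantAt (h, t) ε p u : ℝ → ℂ) = A h u) :
    HasExpansion A (evalSeries t ε (symbolSeries p)) := by
  have h := hasExpansion_quantAt t ε p
  have e : evalSeries t ε (symbolSeries p) =
      PowerSeries.mk fun n => quantAt t ε (symbolCoeff n p) := by
    ext1 n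
    rw [coeff_evalSeries, coeff_symbolSeries, PowerSeries.coeff_mk, evalOp_quant, epos_of_pos hε]
  rw [e]
  simpa only [hA] using h

theorem coeff_zero_evalSeries {p : ℕ × ℕ →₀ StepFun L} (t ε : ℝ) (h : symbolCoeff 0 p = 0) :
    coeff 0 (evalSeries t ε (symbolSeries p)) = 0 := by
  rw [coeff_evalSeries, coeff_symbolSeries, h, map_zero, map_zero]

end Conclusion
end MagnusZassenhaus
end

theorem mainTheorem2 (L : ℝ) (hL : 0 < L) (V : ℝ → ℝ → ℝ)
    (hV : ContDiff ℝ ∞ (Function.uncurry V))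
    (hper : ∀ t : ℝ, Function.Periodic (fun x => V x t) L) :
    -- the second form of the Magnus expansion is odd in the time step
    (∀ (tm ε h : ℝ) (u : PerSmooth L),
      Theta4Odd (shift V tm) (-h) ε u = -Theta4Odd (shift V tm) h ε u) ∧
    -- sizes of the exponents, and agreement of the two forms of the Magnus expansion
    (∀ σ : ℝ, 0 < σ → σ ≤ 1 → ∀ h tm : ℝ → ℝ,
      (∀ᶠ ε in 𝓝[>] (0 : ℝ), 0 < h ε) → h =O[𝓝[>] (0 : ℝ)] (fun ε => ε ^ σ) →
      (∃ T : ℝ, ∀ ε, |tm ε| ≤ T) →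
      HasSize (L := L) (fun ε u => W0 (h ε) ε u) (σ - 1) ∧
      HasSize (L := L) (fun ε u => W1 (shift V (tm ε)) (h ε) ε u) (σ - 1) ∧
      HasSize (L := L) (fun ε u => W2 (shift V (tm ε)) (h ε) ε u) (3 * σ - 1) ∧
      HasSize (L := L) (fun ε u => W3 (shift V (tm ε)) (h ε) ε u) (5 * σ - 1) ∧
      HasSize (L := L) (fun ε u => Theta4 (shift V (tm ε)) (h ε) ε u
        - Theta4Odd (shift V (tm ε)) (h ε) ε u) (7 * σ - 1)) ∧
    -- the seven-exponential palindromic splitting, with exponentials of formal power series in `h`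
    ∃ (θ w₀ w₁ w₂ w₃ r : ℝ → ℝ → PowerSeries (Module.End ℂ (PerSmooth L))),
      (∀ tm ε : ℝ, 0 < ε →
        HasExpansion (fun h u => Theta4 (shift V tm) h ε u) (θ tm ε) ∧
        HasExpansion (fun h u => W0 h ε u) (w₀ tm ε) ∧
        HasExpansion (fun h u => W1 (shift V tm) h ε u) (w₁ tm ε) ∧
        HasExpansion (fun h u => W2 (shift V tm) h ε u) (w₂ tm ε) ∧
        HasExpansion (fun h u => W3 (shift V tm) h ε u) (w₃ tm ε) ∧
        PowerSeries.coeff 0 (θ tm ε) = 0 ∧ PowerSeries.coeff 0 (w₀ tm ε) = 0 ∧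
        PowerSeries.coeff 0 (w₁ tm ε) = 0 ∧ PowerSeries.coeff 0 (w₂ tm ε) = 0 ∧
        PowerSeries.coeff 0 (w₃ tm ε) = 0 ∧ PowerSeries.coeff 0 (r tm ε) = 0 ∧
        formalExp (θ tm ε + r tm ε) =
          formalExp ((1 / 2 : ℂ) • w₀ tm ε) * formalExp ((1 / 2 : ℂ) • w₁ tm ε) *
          formalExp ((1 / 2 : ℂ) • w₂ tm ε) * formalExp (w₃ tm ε) *
          formalExp ((1 / 2 : ℂ) • w₂ tm ε) * formalExp ((1 / 2 : ℂ) • w₁ tm ε) *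
          formalExp ((1 / 2 : ℂ) • w₀ tm ε)) ∧
      (∀ σ : ℝ, 0 < σ → σ ≤ 1 → ∀ h tm : ℝ → ℝ,
        (∀ᶠ ε in 𝓝[>] (0 : ℝ), 0 < h ε) → h =O[𝓝[>] (0 : ℝ)] (fun ε => ε ^ σ) →
        (∃ T : ℝ, ∀ ε, |tm ε| ≤ T) →
        ∀ n : ℕ, HasSize (fun ε u => (h ε : ℂ) ^ n •
          (PowerSeries.coeff n (r (tm ε) ε) u : ℝ → ℂ)) (7 * σ - 1)) := by
  obtain ⟨F, hF⟩ : ∃ F : StepFun L, ∀ h t x, F (h, t) x = V x (t + h) :=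
    ⟨potential V hV hper, fun _ _ _ => rfl⟩
  obtain ⟨R, hR0, hR5, hRK, hR⟩ := exists_remainder F
  obtain ⟨e, e0, e1, e2, e3⟩ := symbolCoeff_even F Even.zero
  -- `Θ₄` itself is not odd, but its constant term agrees with that of the odd form.
  rw [← symbolCoeff_symTheta F (by norm_num)] at e
  refine ⟨fun tm ε h u => Theta4Odd_neg hF tm ε h u, ?_,
    fun tm ε => evalSeries tm ε (symbolSeries (symTheta F)),
    fun tm ε => evalSeries tm ε (symbolSeries (symW0 L)),
    fun tm ε => evalSeries tm ε (symbolSeries (symW1 F)),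
    fun tm ε => evalSeries tm ε (symbolSeries (symW2 F)),
    fun tm ε => evalSeries tm ε (symbolSeries (symW3 F)),
    fun tm ε => evalSeries tm ε R, ?_, ?_⟩
  · rintro σ hσ0 hσ h tm - hh ⟨T, ht⟩
    exact hasSize_exponents hL hF ht hσ0 hσ hh
  · intro tm ε hε
    refine ⟨hasExpansion_evalSeries tm hε fun h u => quantAt_symTheta hF h tm hε.ne' u,
      hasExpansion_evalSeries tm hε fun h u => quantAt_symW0 h tm hε.ne' u,
      hasExpansion_evalSeries tm hε fun h u => quantAt_symW1 hF h tm hε.ne' u,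
      hasExpansion_evalSeries tm hε fun h u => quantAt_symW2 hF h tm hε.ne' u,
      hasExpansion_evalSeries tm hε fun h u => quantAt_symW3 hF h tm hε.ne' u,
      coeff_zero_evalSeries tm ε e, coeff_zero_evalSeries tm ε e0, coeff_zero_evalSeries tm ε e1,
      coeff_zero_evalSeries tm ε e2, coeff_zero_evalSeries tm ε e3, ?_, ?_⟩
    · rw [coeff_evalSeries, hR0 0 (by norm_num) (by norm_num), map_zero]
    -- Evaluation at a midpoint and a value of `ε` is a ring homomorphism compatible with
    -- `formalExp`, so the identity between families specialises.
    · have h := congrArg (evalSeries tm ε) hR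
      simp only [map_mul, evalSeries_formalExp, evalSeries_csmul, map_add] at h
      exact h
  · rintro σ hσ0 hσ h tm - hh ⟨T, ht⟩ n
    simp only [coeff_evalSeries]
    exact hasSize_remainder hL hR0 hR5 hRK ht hσ0 hσ hh n
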